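/- **Notation.** Let $p$ be a prime, $|\cdot|$ the normalized absolute value on $\mathbb{Q}_p$, and $\psi(x)=e^{-2\pi i r}$ for $r\in\mathbb{Z}[1/p]$ with $x-r\in\mathbb{Z}_p$. Unless said otherwise measures are Haar measures giving $\mathbb{Z}_p$ (and products of it) volume one. For a character $\delta$ of $\mathbb{Q}_p^\times$ put $L(s,\delta)=(1-\delta(p)p^{-s})^{-1}$ if $\delta$ is unramified and $L(s,\delta)=1$ otherwise. Let $\gamma(a)=|2a|^{1/2}\lim_{k\to\infty}\int_{p^{-k}\mathbb{Z}_p}\psi(ax^2)\,dx$ be the Weil constant and $\chi_S(a)=\langle -S,a\rangle$ (quadratic Hilbert symbol). *The group.* $G_2$ is the split group, embedded in $SO(3,4)\subset GL_7$, with short simple root $\alpha$, long simple root $\beta$ and root subgroups $x_\gamma$. Put $n(a_1,\dots,a_4,u)=x_\beta(a_1)x_{\alpha+\beta}(a_2)x_{2\alpha+\beta}(a_3)x_{3\alpha+\beta}(a_4)x_{3\alpha+2\beta}(u)$, $z_U(z_1,z_2)=x_{3\alpha+\beta}(z_1)x_{3\alpha+2\beta}(z_2)$, $v(x,y,z)=x_\alpha(x)x_{\alpha+\beta}(y)x_{2\alpha+\beta}(z+xy)$.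 The pinning is such that $n(\mathbf a,u)n(\mathbf b,u')=n(\mathbf a+\mathbf b,u+u'-a_4b_1+3a_3b_2)$ and, modulo $z_U(\cdot,\cdot)$, $v(x,y,z)v(x',y',z')=v(x+x',y+y',z+z'+yx'-xy')$. Let $m,\ell:GL_2\to G_2$ be the two standard Levi embeddings, with $m\begin{pmatrix}1&b\\0&1\end{pmatrix}=x_\alpha(-b)$, $\ell\begin{pmatrix}1&b\\0&1\end{pmatrix}=x_\beta(-b)$, $\ell(\mathrm{diag}(a,d))=m(\mathrm{diag}(ad,a))$. Thus $P=MN$, with $N=\{n(\mathbf a,u)\}$ and $M=m(GL_2)$, is the Heisenberg parabolic subgroup. Put $w_\alpha=m\begin{pmatrix}0&-1\\1&0\end{pmatrix}$, $w_\beta=\ell\begin{pmatrix}0&1\\-1&0\end{pmatrix}$, $\iota=w_\beta w_\alpha w_\beta w_\alpha w_\beta^{-1}$. On $W=N/[N,N]=\{\mathbf a=(a_1,\dots,a_4)\}$ the group $M$ acts by $\mathrm{Ad}(m(A))\mathbf a=\det(A)^{-1}\rho_3(A)\mathbf a$, where $f_{\mathbf a}(u,v)=a_1u^3+3a_2u^2v+3a_3uv^2+a_4v^3$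 and $f_{\rho_3(A)\mathbf a}(u,v)=f_{\mathbf a}(du+bv,cu+av)$ for $A=\begin{pmatrix}a&b\\c&d\end{pmatrix}$. Put $q(\mathbf a)=-3a_2^2a_3^2+4a_1a_3^3+4a_2^3a_4-6a_1a_2a_3a_4+a_1^2a_4^2$, $\langle\mathbf a,\mathbf b\rangle=a_1b_4-3a_2b_3+3a_3b_2-a_4b_1$, $\psi_w(n(\mathbf a,u))=\psi(\langle w,\mathbf a\rangle)$. For $w$ with $q(w)\ne0$ let $E_w=\mathbb{Q}_p[x]/(f_w(x,1))$ if $\deg f_w(x,1)=3$ and $E_w=\mathbb{Q}_p[x]/(f_w(x,1))\times\mathbb{Q}_p$ if the degree is $2$; $L(s,\mu_{E_w})$ is the local factor of the base change $\mu\circ N_{E_w/\mathbb{Q}_p}$ (the product of the factors over the fields that make up $E_w$). *The representations.* Let $\mu:\mathbb{Q}_p^\times\to\mathbb{C}^1$ be a continuous unitary character and $s\in\mathbb{C}$. $I(s,\mu)$ is the space of functions $\phi$ on $G_2(\mathbb{Q}_p)$, right invariant under some open subgroup, with $\phi(n\,m(A)\,g)=|\det A|^{s+3/2}\mu(\det A)\phi(g)$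 for $n\in N$; $(v\cdot\phi)(g)=\phi(gv)$. For $S\in\mathbb{Q}_p^\times$ let $\psi_S(x)=\psi(Sx)$ and let $d_Sx=|2S|^{1/2}dx$ be the measure self-dual for $F_S\Phi(t)=\int\Phi(x)\psi_S(-2tx)\,d_Sx$. The Weil representation on locally constant compactly supported functions $\Phi$ on $X_\alpha(\mathbb{Q}_p)=\mathbb{Q}_p$ is given by $$\omega_S(v(x,y,z))\Phi(t)=\psi_S(z-2ty-xy)\Phi(t+x)$$ and, on the double cover $\widetilde{SL_2(\mathbb{Q}_p)}$, whose elements are pairs $(h,\varepsilon)$ with $h\in SL_2(\mathbb{Q}_p)$ and $\varepsilon=\pm1$, by $$\omega_S\Big(\begin{pmatrix}a&b\\0&a^{-1}\end{pmatrix},\varepsilon\Big)\Phi(t)=\varepsilon\tfrac{\gamma(S)}{\gamma(aS)}|a|^{1/2}\psi_S(-abt^2)\Phi(at),$$ $$\omega_S\Big(\begin{pmatrix}a&b\\c&d\end{pmatrix},\varepsilon\Big)\Phi(t)=\varepsilon\,\gamma(S/c)\,|c|^{-1/2}\psi_S(-\tfrac ac t^2)\int\psi_S\big(\tfrac2c tx-\tfrac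 dc x^2\big)\Phi(x)\,d_Sx\quad(c\ne0),$$ so that $(w_\beta,\varepsilon)$ acts by $\varepsilon\gamma(-S)F_S$. *The functionals.* All integrals below are understood by continuation: one inserts the factor $|\det A|^z$ (at the argument $n\,m(A)\,k$ of $\phi$, with $n\in N$ and $k\in G_2(\mathbb{Z}_p)$), respectively $|a|^z$ (at the argument $\begin{pmatrix}a&*\\0&a^{-1}\end{pmatrix}k$ of $f$, with $k\in SL_2(\mathbb{Z}_p)$). The continuation *exists* if for $\mathrm{Re}(z)$ large the integral converges absolutely and is a rational function of $p^{-z}$ that is regular at $z=0$, and the value at $z=0$ is then taken. Let $$\Lambda_w=\frac{L(s+\frac12,\mu)L(s+\frac32,\mu)L(2s+1,\mu)L(3s+\frac32,\mu)}{L(s+\frac12,\mu_{E_w})},\qquad \widetilde{\mathbf w}_w(\phi)=|q(w)|^{3/4}\Lambda_w\int_{N(\mathbb{Q}_p)}\phi(\iota n)\overline{\psi_w(n)}\,dn .$$ For $h'=(h,\varepsilon)\in\widetilde{SL_2(\mathbb{Q}_p)}$ let $$\beta_S(h';\phi\otimes\overline\Phi)=\Lambda_w\frac{L(s+\frac12,\mu\chi_S)}{L(2s+1,\mu^2)}\int\!\!\int\!\!\int\phi(\iota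 w_\beta z_Uv(y,0,z)\ell(h))\,\overline{(\omega_S(v(y,0,z))\omega_S(h')\Phi)(0)}\,dz_U\,dy\,dz ,$$ and for a character $\delta$, $t\in\mathbb{Q}_p^\times$ and a function $f$ on $\widetilde{SL_2(\mathbb{Q}_p)}$ let $$w_t^{\delta,s}(f)=|t|^{1/2}\frac{L(2s+1,\delta^2)}{L(s+\frac12,\delta)}\int_{\mathbb{Q}_p}f\big((w_\beta x_\beta(b),1)\big)\overline{\psi(tb)}\,db .$$ **Lemma.** Let $S,t\in\mathbb{Q}_p^\times$, $\phi\in I(s,\mu)$, $\Phi$ a locally constant compactly supported function on $\mathbb{Q}_p$, and $w=\mathrm{Ad}(w_\alpha)(t,0,\frac13S,0)$. Let $\mathrm{Re}(s)>-\frac23$, and assume that none of $L(s+\frac12,\mu)$, $L(2s+1,\mu)$, $L(3s+\frac32,\mu)$, $L(s+\frac12,\mu\chi_S)$, $L(2s+1,\mu^2)$ has a pole at $s$ (a condition only on the line $\mathrm{Re}(s)=-\frac12$). Then the continuations defining $\beta_S(h';\phi\otimes\overline\Phi)$ for all $h'$, $w_t^{\mu\chi_S,s}(\beta_S(\ast;\phi\otimes\overline\Phi))$,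 and $\widetilde{\mathbf w}_w(v(x,0,0)\cdot\phi)$ for all $x\in\mathbb{Q}_p$ exist, the function $x\mapsto\overline{\Phi(x)}\,\widetilde{\mathbf w}_w(v(x,0,0)\cdot\phi)$ is integrable, and $$w_t^{\mu\chi_S,s}\big(\beta_S(\ast;\phi\otimes\overline\Phi)\big)=\mu(-1)\,\gamma(S)\,\Big|\frac4{27}S^3\Big|^{-3/4}|t|^{-1/4}\int_{\mathbb{Q}_p}\overline{\Phi(x)}\;\widetilde{\mathbf w}_w\big(v(x,0,0)\cdot\phi\big)\,d_Sx .$$ -/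

import Mathlib

noncomputable section

namespace FJ

open MeasureTheory Filter

variable (p : ℕ) [Fact p.Prime]

/-! ### Haar measure and the standard additive character on the field of p-adic numbers -/

instance : MeasurableSpace ℚ_[p] := borel _

instance : BorelSpace ℚ_[p] := ⟨rfl⟩

/-- The ring of p-adic integers as a compact set with non-empty interior. -/
def unitBall : TopologicalSpace.PositiveCompacts ℚ_[p] where
  carrier := Metric.closedBall 0 1
  isCompact' := isCompact_closedBall _ _
  interior_nonempty' := by
    rw [(IsUltrametricDist.isOpen_closedBall (0 : ℚ_[p]) one_ne_zero).interior_eq]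
    exact ⟨0, by simp⟩

/-- The Haar measure giving the ring of p-adic integers volume one. -/
def haar : Measure ℚ_[p] := Measure.addHaarMeasure (unitBall p)

theorem exists_frac (x : ℚ_[p]) : ∃ (a : ℤ) (n : ℕ), ‖x - (a : ℚ_[p]) / (p : ℚ_[p]) ^ n‖ ≤ 1 := by
  have hp : (0 : ℝ) < p := by exact_mod_cast (Fact.out : p.Prime).pos
  have hp1 : (1 : ℝ) < p := by exact_mod_cast (Fact.out : p.Prime).one_lt
  obtain ⟨n, hn⟩ := pow_unbounded_of_one_lt ‖x‖ hp1
  have hy : ‖(p : ℚ_[p]) ^ n * x‖ ≤ 1 := by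
    rw [norm_mul, norm_pow, Padic.norm_p, inv_pow, inv_mul_le_iff₀ (by positivity)]
    simpa using hn.le
  obtain ⟨y, hydef⟩ : ∃ y : ℤ_[p], (y : ℚ_[p]) = (p : ℚ_[p]) ^ n * x := ⟨⟨_, hy⟩, rfl⟩
  refine ⟨(y.appr n : ℤ), n, ?_⟩
  have h := (PadicInt.norm_le_pow_iff_mem_span_pow _ n).mpr (PadicInt.appr_spec n y)
  have h2 : ‖(p : ℚ_[p]) ^ n * x - (y.appr n : ℚ_[p])‖ ≤ (p : ℝ) ^ (-n : ℤ) := by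
    rw [← hydef]
    simpa [PadicInt.norm_def] using h
  have hp0 : (p : ℚ_[p]) ≠ 0 := by exact_mod_cast (Fact.out : p.Prime).ne_zero
  have h3 : x - ((y.appr n : ℤ) : ℚ_[p]) / (p : ℚ_[p]) ^ n =
      ((p : ℚ_[p]) ^ n)⁻¹ * ((p : ℚ_[p]) ^ n * x - (y.appr n : ℚ_[p])) := by
    push_cast
    field_simp
  rw [h3, norm_mul, norm_inv, norm_pow, Padic.norm_p, inv_pow, inv_inv]
  calc (p : ℝ) ^ n * _ ≤ (p : ℝ) ^ n * (p : ℝ) ^ (-n : ℤ) := by gcongr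
    _ = 1 := by rw [zpow_neg, zpow_natCast]; field_simp

/-- The standard additive character: `ψ(x) = exp(-2πi r)` for any `r = a / p ^ n` such that
`x - r` is a p-adic integer. -/
def psi (x : ℚ_[p]) : ℂ :=
  Complex.exp (-2 * Real.pi * Complex.I *
    ((exists_frac p x).choose / (p : ℂ) ^ (exists_frac p x).choose_spec.choose))

theorem psi_eq (x : ℚ_[p]) (a : ℤ) (n : ℕ) (h : ‖x - (a : ℚ_[p]) / (p : ℚ_[p]) ^ n‖ ≤ 1) :
    psi p x = Complex.exp (-2 * Real.pi * Complex.I * (a / (p : ℂ) ^ n)) := by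
  have hs := (exists_frac p x).choose_spec.choose_spec
  unfold psi
  set b := (exists_frac p x).choose
  set m := (exists_frac p x).choose_spec.choose
  have hp0 : (p : ℚ_[p]) ≠ 0 := by exact_mod_cast (Fact.out : p.Prime).ne_zero
  have hpc : (p : ℂ) ≠ 0 := by exact_mod_cast (Fact.out : p.Prime).ne_zero
  have hp : (0 : ℝ) < p := by exact_mod_cast (Fact.out : p.Prime).pos
  have h1 : ‖(a : ℚ_[p]) / (p : ℚ_[p]) ^ n - (b : ℚ_[p]) / (p : ℚ_[p]) ^ m‖ ≤ 1 := by
    have := IsUltrametricDist.norm_add_le_max (x - (b : ℚ_[p]) / (p : ℚ_[p]) ^ m)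
      (-(x - (a : ℚ_[p]) / (p : ℚ_[p]) ^ n))
    rw [norm_neg] at this
    refine le_trans (le_of_eq ?_) (this.trans (max_le hs h))
    congr 1
    ring
  have h2 : ‖((a * p ^ m - b * p ^ n : ℤ) : ℚ_[p])‖ ≤ (p : ℝ) ^ (-(n + m : ℕ) : ℤ) := by
    have : ((a * p ^ m - b * p ^ n : ℤ) : ℚ_[p]) = (p : ℚ_[p]) ^ (n + m) *
        ((a : ℚ_[p]) / (p : ℚ_[p]) ^ n - (b : ℚ_[p]) / (p : ℚ_[p]) ^ m) := by
      push_cast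
      rw [mul_sub, pow_add]
      field_simp
    rw [this, norm_mul, norm_pow, Padic.norm_p, zpow_neg, zpow_natCast, inv_pow]
    exact mul_le_of_le_one_right (by positivity) h1
  rw [Padic.norm_int_le_pow_iff_dvd] at h2
  obtain ⟨k, hk⟩ := h2
  have h3 : (a : ℂ) / (p : ℂ) ^ n = b / (p : ℂ) ^ m + k := by
    have : (a : ℂ) * p ^ m - b * p ^ n = p ^ (n + m) * k := by exact_mod_cast hk
    field_simp
    linear_combination this
  rw [h3, Complex.exp_eq_exp_iff_exists_int]
  exact ⟨k, by ring⟩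

/-! ### The split group of type `G₂` inside `GL₇` -/

/-- The roots of `G₂`; `a` is the short and `b` the long simple root, and `n_` marks negatives. -/
inductive Root where
  | a | b | ab | a2b | a3b | a3b2
  | n_a | n_b | n_ab | n_a2b | n_a3b | n_a3b2

/-- The root vectors in the seven-dimensional representation. -/
def rootVecZ : Root → Matrix (Fin 7) (Fin 7) ℤ
  | .a => !![0, 0, 0, 0, 0, 0, 0; -1, 0, 0, 0, 0, 0, 0; 0, 0, 0, 0, 0, 0, 0;
      0, 0, -1, 0, 0, 0, 0; 0, 0, 0, -2, 0, 0, 0; 0, 0, 0, 0, 0, 0, 1; 0, 0, 0, 0, 0, 0, 0]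
  | .b => !![0, 0, 0, 0, -1, 0, 0; 0, 0, 0, 0, 0, 0, 0; 0, 0, 0, 0, 0, 1, 0;
      0, 0, 0, 0, 0, 0, 0; 0, 0, 0, 0, 0, 0, 0; 0, 0, 0, 0, 0, 0, 0; 0, 0, 0, 0, 0, 0, 0]
  | .ab => !![0, 0, 0, 2, 0, 0, 0; 0, 0, 0, 0, -1, 0, 0; 0, 0, 0, 0, 0, 0, 1;
      0, 0, 0, 0, 0, 1, 0; 0, 0, 0, 0, 0, 0, 0; 0, 0, 0, 0, 0, 0, 0; 0, 0, 0, 0, 0, 0, 0]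
  | .a2b => !![0, 0, -1, 0, 0, 0, 0; 0, 0, 0, 2, 0, 0, 0; 0, 0, 0, 0, 0, 0, 0;
      0, 0, 0, 0, 0, 0, 1; 0, 0, 0, 0, 0, 1, 0; 0, 0, 0, 0, 0, 0, 0; 0, 0, 0, 0, 0, 0, 0]
  | .a3b => !![0, 0, 0, 0, 0, 0, 0; 0, 0, -1, 0, 0, 0, 0; 0, 0, 0, 0, 0, 0, 0;
      0, 0, 0, 0, 0, 0, 0; 0, 0, 0, 0, 0, 0, 1; 0, 0, 0, 0, 0, 0, 0; 0, 0, 0, 0, 0, 0, 0]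
  | .a3b2 => !![0, 0, 0, 0, 0, 0, -1; 0, 0, 0, 0, 0, 1, 0; 0, 0, 0, 0, 0, 0, 0;
      0, 0, 0, 0, 0, 0, 0; 0, 0, 0, 0, 0, 0, 0; 0, 0, 0, 0, 0, 0, 0; 0, 0, 0, 0, 0, 0, 0]
  | .n_a => !![0, -1, 0, 0, 0, 0, 0; 0, 0, 0, 0, 0, 0, 0; 0, 0, 0, -2, 0, 0, 0;
      0, 0, 0, 0, -1, 0, 0; 0, 0, 0, 0, 0, 0, 0; 0, 0, 0, 0, 0, 0, 0; 0, 0, 0, 0, 0, 1, 0]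
  | .n_b => !![0, 0, 0, 0, 0, 0, 0; 0, 0, 0, 0, 0, 0, 0; 0, 0, 0, 0, 0, 0, 0;
      0, 0, 0, 0, 0, 0, 0; -1, 0, 0, 0, 0, 0, 0; 0, 0, 1, 0, 0, 0, 0; 0, 0, 0, 0, 0, 0, 0]
  | .n_ab => !![0, 0, 0, 0, 0, 0, 0; 0, 0, 0, 0, 0, 0, 0; 0, 0, 0, 0, 0, 0, 0;
      1, 0, 0, 0, 0, 0, 0; 0, -1, 0, 0, 0, 0, 0; 0, 0, 0, 2, 0, 0, 0; 0, 0, 1, 0, 0, 0, 0]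
  | .n_a2b => !![0, 0, 0, 0, 0, 0, 0; 0, 0, 0, 0, 0, 0, 0; -1, 0, 0, 0, 0, 0, 0;
      0, 1, 0, 0, 0, 0, 0; 0, 0, 0, 0, 0, 0, 0; 0, 0, 0, 0, 1, 0, 0; 0, 0, 0, 2, 0, 0, 0]
  | .n_a3b => !![0, 0, 0, 0, 0, 0, 0; 0, 0, 0, 0, 0, 0, 0; 0, -1, 0, 0, 0, 0, 0;
      0, 0, 0, 0, 0, 0, 0; 0, 0, 0, 0, 0, 0, 0; 0, 0, 0, 0, 0, 0, 0; 0, 0, 0, 0, 1, 0, 0]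
  | .n_a3b2 => !![0, 0, 0, 0, 0, 0, 0; 0, 0, 0, 0, 0, 0, 0; 0, 0, 0, 0, 0, 0, 0;
      0, 0, 0, 0, 0, 0, 0; 0, 0, 0, 0, 0, 0, 0; 0, 1, 0, 0, 0, 0, 0; -1, 0, 0, 0, 0, 0, 0]

theorem rootVecZ_cube (γ : Root) : rootVecZ γ ^ 3 = 0 := by
  cases γ <;> decide

/-- The root vectors with p-adic entries. -/
def rootVec (γ : Root) : Matrix (Fin 7) (Fin 7) ℚ_[p] := (rootVecZ γ).map (Int.castRingHom ℚ_[p])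

theorem rootVec_cube (γ : Root) : rootVec p γ ^ 3 = 0 := by
  rw [rootVec, ← RingHom.mapMatrix_apply, ← map_pow, rootVecZ_cube, map_zero]

theorem smul_rootVec_cube (γ : Root) (u : ℚ_[p]) : (u • rootVec p γ) ^ 3 = 0 := by
  rw [smul_pow, rootVec_cube, smul_zero]

/-- The element `exp(u X_γ)` of `GL₇`. -/
def rootGL (γ : Root) (u : ℚ_[p]) : GL (Fin 7) ℚ_[p] where
  val := IsNilpotent.exp (u • rootVec p γ)
  inv := IsNilpotent.exp (-(u • rootVec p γ))
  val_inv := IsNilpotent.exp_mul_exp_neg_self ⟨3, smul_rootVec_cube p γ u⟩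
  inv_val := IsNilpotent.exp_neg_mul_exp_self ⟨3, smul_rootVec_cube p γ u⟩

theorem rootGL_val (γ : Root) (u : ℚ_[p]) :
    (rootGL p γ u : Matrix (Fin 7) (Fin 7) ℚ_[p]) =
      1 + u • rootVec p γ + (u ^ 2 / 2) • rootVec p γ ^ 2 := by
  have h2 : (2 : ℚ)⁻¹ • (u • rootVec p γ) ^ 2 = (u ^ 2 / 2) • rootVec p γ ^ 2 := by
    ext i j
    simp [smul_pow, Matrix.smul_apply, Rat.smul_def]
    ring
  simp only [rootGL, IsNilpotent.exp_eq_sum (smul_rootVec_cube p γ u)]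
  simp [Finset.sum_range_succ, Nat.factorial, h2]

/-- The seven-dimensional matrix attached to a two by two matrix by the Levi factor `M`. -/
def mMat (A : Matrix (Fin 2) (Fin 2) ℚ_[p]) : Matrix (Fin 7) (Fin 7) ℚ_[p] :=
  let a := A 0 0
  let b := A 0 1
  let c := A 1 0
  let d := A 1 1
  let e := (A.det)⁻¹
  !![d, c, 0, 0, 0, 0, 0;
     b, a, 0, 0, 0, 0, 0;
     0, 0, d ^ 2 * e, 2 * c * d * e, c ^ 2 * e, 0, 0;
     0, 0, b * d * e, (a * d + b * c) * e, a * c * e, 0, 0;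
     0, 0, b ^ 2 * e, 2 * a * b * e, a ^ 2 * e, 0, 0;
     0, 0, 0, 0, 0, a * e, -b * e;
     0, 0, 0, 0, 0, -c * e, d * e]

/-- The seven-dimensional matrix attached to a two by two matrix by the Levi factor `L`. -/
def lMat (A : Matrix (Fin 2) (Fin 2) ℚ_[p]) : Matrix (Fin 7) (Fin 7) ℚ_[p] :=
  let a := A 0 0
  let b := A 0 1
  let c := A 1 0
  let d := A 1 1
  let e := (A.det)⁻¹
  !![a, 0, 0, 0, b, 0, 0;
     0, A.det, 0, 0, 0, 0, 0;
     0, 0, a * e, 0, 0, -b * e, 0;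
     0, 0, 0, 1, 0, 0, 0;
     c, 0, 0, 0, d, 0, 0;
     0, 0, -c * e, 0, 0, d * e, 0;
     0, 0, 0, 0, 0, 0, e]

theorem mMat_mul (A B : Matrix (Fin 2) (Fin 2) ℚ_[p]) : mMat p (A * B) = mMat p A * mMat p B := by
  have h : (A * B).det⁻¹ = A.det⁻¹ * B.det⁻¹ := by rw [Matrix.det_mul, mul_inv]
  unfold mMat
  rw [h]
  simp only [Matrix.mul_apply (M := A), Fin.sum_univ_two]
  generalize A.det⁻¹ = x
  generalize B.det⁻¹ = y
  generalize A 0 0 = a, A 0 1 = b, A 1 0 = c, A 1 1 = d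
  generalize B 0 0 = a', B 0 1 = b', B 1 0 = c', B 1 1 = d'
  simp only [Matrix.cons_mul, Matrix.vecMul_cons, Matrix.head_cons, Matrix.tail_cons, zero_smul,
    zero_add, add_zero, Matrix.empty_mul, Matrix.smul_cons, smul_eq_mul, mul_zero,
    Matrix.smul_empty, Matrix.empty_add_empty, Equiv.symm_apply_apply, Matrix.empty_vecMul,
    Matrix.cons_add_cons, EmbeddingLike.apply_eq_iff_eq, Matrix.vecCons_inj, and_true, true_and]
  and_intros <;> ring

theorem lMat_mul (A B : Matrix (Fin 2) (Fin 2) ℚ_[p]) : lMat p (A * B) = lMat p A * lMat p B := by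
  have h : (A * B).det⁻¹ = A.det⁻¹ * B.det⁻¹ := by rw [Matrix.det_mul, mul_inv]
  have h' : (A * B).det = A.det * B.det := Matrix.det_mul A B
  unfold lMat
  rw [h, h']
  simp only [Matrix.mul_apply (M := A), Fin.sum_univ_two]
  generalize A.det⁻¹ = x
  generalize B.det⁻¹ = y
  generalize A.det = x'
  generalize B.det = y'
  generalize A 0 0 = a, A 0 1 = b, A 1 0 = c, A 1 1 = d
  generalize B 0 0 = a', B 0 1 = b', B 1 0 = c', B 1 1 = d'
  simp only [Matrix.cons_mul, Matrix.vecMul_cons, Matrix.head_cons, Matrix.tail_cons, zero_smul,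
    zero_add, add_zero, Matrix.empty_mul, Matrix.smul_cons, smul_eq_mul, mul_zero, mul_one,
    Matrix.smul_empty, Matrix.empty_add_empty, Equiv.symm_apply_apply, Matrix.empty_vecMul,
    Matrix.cons_add_cons, EmbeddingLike.apply_eq_iff_eq, Matrix.vecCons_inj, and_true, true_and]
  and_intros <;> ring

theorem mMat_one : mMat p 1 = 1 := by
  have h : mMat p 1 = !![1, 0, 0, 0, 0, 0, 0; 0, 1, 0, 0, 0, 0, 0; 0, 0, 1, 0, 0, 0, 0;
      0, 0, 0, 1, 0, 0, 0; 0, 0, 0, 0, 1, 0, 0; 0, 0, 0, 0, 0, 1, 0; 0, 0, 0, 0, 0, 0, 1] := by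
    simp [mMat]
  rw [h]
  ext i j
  fin_cases i <;> fin_cases j <;> rfl

theorem lMat_one : lMat p 1 = 1 := by
  have h : lMat p 1 = !![1, 0, 0, 0, 0, 0, 0; 0, 1, 0, 0, 0, 0, 0; 0, 0, 1, 0, 0, 0, 0;
      0, 0, 0, 1, 0, 0, 0; 0, 0, 0, 0, 1, 0, 0; 0, 0, 0, 0, 0, 1, 0; 0, 0, 0, 0, 0, 0, 1] := by
    simp [lMat]
  rw [h]
  ext i j
  fin_cases i <;> fin_cases j <;> rfl

/-- The embedding `m` of `GL₂` as the Levi factor `M` of the Heisenberg parabolic subgroup. -/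
def mGL : GL (Fin 2) ℚ_[p] →* GL (Fin 7) ℚ_[p] :=
  Units.map { toFun := mMat p, map_one' := mMat_one p, map_mul' := mMat_mul p }

/-- The embedding `ℓ` of `GL₂` as the Levi factor `L` of the other maximal parabolic subgroup. -/
def lGL : GL (Fin 2) ℚ_[p] →* GL (Fin 7) ℚ_[p] :=
  Units.map { toFun := lMat p, map_one' := lMat_one p, map_mul' := lMat_mul p }

/-- The group `G₂(ℚ_p)`, generated by its root subgroups and the two standard Levi subgroups
(which are in turn contained in the group generated by the root subgroups). -/
def G2 : Subgroup (GL (Fin 7) ℚ_[p]) :=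
  Subgroup.closure ({g | ∃ (γ : Root) (u : ℚ_[p]), g = rootGL p γ u} ∪
    (Set.range (mGL p) ∪ Set.range (lGL p)))

/-- The one-parameter root subgroups `x_γ`. -/
def xr (γ : Root) (u : ℚ_[p]) : G2 p :=
  ⟨rootGL p γ u, Subgroup.subset_closure (Or.inl ⟨γ, u, rfl⟩)⟩

/-- The Levi embedding `m` with values in `G₂`. -/
def mG (A : GL (Fin 2) ℚ_[p]) : G2 p :=
  ⟨mGL p A, Subgroup.subset_closure (Or.inr (Or.inl ⟨A, rfl⟩))⟩

/-- The Levi embedding `ℓ` with values in `G₂`. -/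
def lG (A : GL (Fin 2) ℚ_[p]) : G2 p :=
  ⟨lGL p A, Subgroup.subset_closure (Or.inr (Or.inr ⟨A, rfl⟩))⟩

/-- The unipotent radical of the Heisenberg parabolic subgroup, in the coordinates
`n(a₁, a₂, a₃, a₄, t)`. -/
def nG (a : Fin 5 → ℚ_[p]) : G2 p :=
  xr p .b (a 0) * xr p .ab (a 1) * xr p .a2b (a 2) * xr p .a3b (a 3) * xr p .a3b2 (a 4)

/-- The elements `v(x, y, z)`, representing the Heisenberg group `V = U / Z_U` in the coordinates
in which its law is `(x, y, z)(x', y', z') = (x + x', y + y', z + z' + y x' - x y')`. -/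
def vG (x y z : ℚ_[p]) : G2 p := xr p .a x * xr p .ab y * xr p .a2b (z + x * y)

/-- The centre `Z_U` of `U`. -/
def zU (z₁ z₂ : ℚ_[p]) : G2 p := xr p .a3b z₁ * xr p .a3b2 z₂

/-- The matrix in `SL₂` whose image under `m` is the Weyl element `w_α`. -/
def wαMat : Matrix.SpecialLinearGroup (Fin 2) ℚ_[p] := ⟨!![0, -1; 1, 0], by simp⟩

/-- The matrix in `SL₂` whose image under `ℓ` is the Weyl element `w_β`. -/
def wβMat : Matrix.SpecialLinearGroup (Fin 2) ℚ_[p] := ⟨!![0, 1; -1, 0], by simp⟩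

/-- The matrix in `SL₂` whose image under `ℓ` is `x_β(b)`. -/
def xβMat (b : ℚ_[p]) : Matrix.SpecialLinearGroup (Fin 2) ℚ_[p] := ⟨!![1, -b; 0, 1], by simp⟩

/-- The Weyl element `w_α`. -/
def wα : G2 p := mG p (wαMat p)

/-- The Weyl element `w_β`. -/
def wβ : G2 p := lG p (wβMat p)

/-- The Weyl element `ι`. -/
def iota : G2 p := wβ p * wα p * wβ p * wα p * (wβ p)⁻¹

/-- The function `g = n m(A) k ↦ |det A|` for the Iwasawa decomposition. The last two rows of
`n m(A)` have only their last two columns non-zero, with determinant `(det A)⁻¹`, and right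
multiplication by `k ∈ G₂(ℤ_p)` preserves the maximum norm of the two by two minors of these rows. -/
def height (g : G2 p) : ℝ :=
  ‖fun ij : Fin 7 × Fin 7 => (g : GL (Fin 7) ℚ_[p]).val 5 ij.1 * (g : GL (Fin 7) ℚ_[p]).val 6 ij.2
    - (g : GL (Fin 7) ℚ_[p]).val 5 ij.2 * (g : GL (Fin 7) ℚ_[p]).val 6 ij.1‖⁻¹

/-! ### Binary cubic forms -/

/-- The binary cubic form `f_w(u, v) = a₁u³ + 3a₂u²v + 3a₃uv² + a₄v³`. -/
def cubic (w : Fin 4 → ℚ_[p]) (u v : ℚ_[p]) : ℚ_[p] :=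
  w 0 * u ^ 3 + 3 * w 1 * u ^ 2 * v + 3 * w 2 * u * v ^ 2 + w 3 * v ^ 3

/-- The action `ρ₃` of two by two matrices on (coefficients of) binary cubic forms. -/
def rho (A : Matrix (Fin 2) (Fin 2) ℚ_[p]) (w : Fin 4 → ℚ_[p]) : Fin 4 → ℚ_[p] :=
  let a := A 0 0
  let b := A 0 1
  let c := A 1 0
  let d := A 1 1
  ![w 0 * d ^ 3 + 3 * w 1 * d ^ 2 * c + 3 * w 2 * d * c ^ 2 + w 3 * c ^ 3,
    w 0 * d ^ 2 * b + w 1 * (d ^ 2 * a + 2 * d * b * c) + w 2 * (2 * d * c * a + b * c ^ 2)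
      + w 3 * c ^ 2 * a,
    w 0 * d * b ^ 2 + w 1 * (2 * d * b * a + b ^ 2 * c) + w 2 * (d * a ^ 2 + 2 * b * c * a)
      + w 3 * c * a ^ 2,
    w 0 * b ^ 3 + 3 * w 1 * b ^ 2 * a + 3 * w 2 * b * a ^ 2 + w 3 * a ^ 3]

theorem cubic_rho (A : Matrix (Fin 2) (Fin 2) ℚ_[p]) (w : Fin 4 → ℚ_[p]) (u v : ℚ_[p]) :
    cubic p (rho p A w) u v = cubic p w (A 1 1 * u + A 0 1 * v) (A 1 0 * u + A 0 0 * v) := by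
  simp [cubic, rho]
  ring

/-- The adjoint action of `m(A)` on `W = N / Z_N`. -/
def AdM (A : GL (Fin 2) ℚ_[p]) (w : Fin 4 → ℚ_[p]) : Fin 4 → ℚ_[p] :=
  A.val.det⁻¹ • rho p A.val w

/-- The quartic form `q` on `W`. -/
def quartic (w : Fin 4 → ℚ_[p]) : ℚ_[p] :=
  -3 * w 1 ^ 2 * w 2 ^ 2 + 4 * w 0 * w 2 ^ 3 + 4 * w 1 ^ 3 * w 3 - 6 * w 0 * w 1 * w 2 * w 3
    + w 0 ^ 2 * w 3 ^ 2

/-- The symplectic form on `W`. -/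
def pairing (w v : Fin 4 → ℚ_[p]) : ℚ_[p] :=
  w 0 * v 3 - 3 * w 1 * v 2 + 3 * w 2 * v 1 - w 3 * v 0

/-- The character `ψ_w` of `N`, in the coordinates of `nG`. -/
def psiW (w : Fin 4 → ℚ_[p]) (a : Fin 5 → ℚ_[p]) : ℂ :=
  psi p (pairing p w ![a 0, a 1, a 2, a 3])

/-! ### Local L-factors -/

/-- A character of `ℚ_pˣ` (given as a function) is unramified if it is trivial on units. -/
def Unram (δ : ℚ_[p]ˣ → ℂ) : Prop := ∀ u : ℚ_[p]ˣ, ‖(u : ℚ_[p])‖ = 1 → δ u = 1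

/-- The prime `p` as a uniformizer. -/
def unif : ℚ_[p]ˣ := Units.mk0 (p : ℚ_[p]) (by exact_mod_cast (Fact.out : p.Prime).ne_zero)

open Classical in
/-- The local factor `L(s, δ)`, equal to one for ramified `δ`. -/
def Lfac (δ : ℚ_[p]ˣ → ℂ) (s : ℂ) : ℂ :=
  if Unram p δ then (1 - δ (unif p) * (p : ℂ) ^ (-s))⁻¹ else 1

/-- `s` is a pole of `L(·, δ)`. -/
def LPole (δ : ℚ_[p]ˣ → ℂ) (s : ℂ) : Prop := Unram p δ ∧ δ (unif p) * (p : ℂ) ^ (-s) = 1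

/-- The norm map on units of an algebra. -/
def unitNorm (K : Type) [CommRing K] [Algebra ℚ_[p] K] : Kˣ →* ℚ_[p]ˣ :=
  Units.map (Algebra.norm ℚ_[p])

/-- A uniformizer of a finite field extension `K` of `ℚ_p`: an element whose norm has the largest
absolute value below one. -/
def unifK (K : Type) [CommRing K] [Algebra ℚ_[p] K] : Kˣ :=
  Classical.epsilon fun x => ‖(unitNorm p K x : ℚ_[p])‖ < 1 ∧
    ∀ y, ‖(unitNorm p K y : ℚ_[p])‖ < 1 → ‖(unitNorm p K y : ℚ_[p])‖ ≤ ‖(unitNorm p K x : ℚ_[p])‖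

open Classical in
/-- The local factor at `s` of the base change `δ ∘ N` to a finite field extension `K` of `ℚ_p`. The
units of the ring of integers of `K` are the elements whose norm has absolute value one. -/
def LfacK (K : Type) [CommRing K] [Algebra ℚ_[p] K] (δ : ℚ_[p]ˣ → ℂ) (s : ℂ) : ℂ :=
  if ∀ u : Kˣ, ‖(unitNorm p K u : ℚ_[p])‖ = 1 → δ (unitNorm p K u) = 1 then
    (1 - δ (unitNorm p K (unifK p K)) * (‖(unitNorm p K (unifK p K) : ℚ_[p])‖ : ℂ) ^ s)⁻¹
  else 1

/-- The local factor of the base change to a finite étale algebra: the product over its field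
factors. -/
def LfacEt (E : Type) [CommRing E] [Algebra ℚ_[p] E] (δ : ℚ_[p]ˣ → ℂ) (s : ℂ) : ℂ :=
  ∏ᶠ m : MaximalSpectrum E, LfacK p (E ⧸ m.asIdeal) δ s

/-- The polynomial `f_w(x, 1)`. -/
def cubicPoly (w : Fin 4 → ℚ_[p]) : Polynomial ℚ_[p] :=
  Polynomial.C (w 0) * Polynomial.X ^ 3 + Polynomial.C (3 * w 1) * Polynomial.X ^ 2
    + Polynomial.C (3 * w 2) * Polynomial.X + Polynomial.C (w 3)

open Classical in
/-- The factor `L(s, δ_{E_w})` of the base change to the cubic algebra `E_w`, which is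
`ℚ_p[x]/(f_w(x, 1))` if this polynomial has degree three and `ℚ_p[x]/(f_w(x, 1)) × ℚ_p` if it has
degree two. -/
def LfacE (w : Fin 4 → ℚ_[p]) (δ : ℚ_[p]ˣ → ℂ) (s : ℂ) : ℂ :=
  if (cubicPoly p w).natDegree = 3 then LfacEt p (AdjoinRoot (cubicPoly p w)) δ s
  else LfacEt p (AdjoinRoot (cubicPoly p w) × ℚ_[p]) δ s

open Classical in
/-- The quadratic Hilbert symbol. -/
def hilb (a b : ℚ_[p]) : ℂ :=
  if ∃ x y z : ℚ_[p], (x ≠ 0 ∨ y ≠ 0 ∨ z ≠ 0) ∧ z ^ 2 = a * x ^ 2 + b * y ^ 2 then 1 else -1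

/-- The quadratic character `χ_S(a) = ⟨-S, a⟩`. -/
def chi (S : ℚ_[p]) (a : ℚ_[p]ˣ) : ℂ := hilb p (-S) a

/-! ### Values of integrals by continuation in an auxiliary parameter -/

/-- `c` is the value at `z = 0` of `∫ F z`, in the following sense: for `Re z` large the integral
converges absolutely and equals a rational function of `p ^ (-z)`; this rational function is regular
at `z = 0` with value `c`. -/
def IsRegVal {X : Type} [MeasurableSpace X] (ν : Measure X) (F : ℂ → X → ℂ) (c : ℂ) : Prop :=
  ∃ P Q : Polynomial ℂ, Q.eval 1 ≠ 0 ∧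
    (∃ B : ℝ, ∀ z : ℂ, B < z.re → Integrable (F z) ν ∧
      Q.eval ((p : ℂ) ^ (-z)) * ∫ x, F z x ∂ν = P.eval ((p : ℂ) ^ (-z))) ∧
    c = P.eval 1 / Q.eval 1

/-- The continued integral is defined at `z = 0`. -/
def RegExists {X : Type} [MeasurableSpace X] (ν : Measure X) (F : ℂ → X → ℂ) : Prop :=
  ∃ c, IsRegVal p ν F c

open Classical in
/-- The value of the continued integral at `z = 0`. -/
def regVal {X : Type} [MeasurableSpace X] (ν : Measure X) (F : ℂ → X → ℂ) : ℂ :=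
  if h : RegExists p ν F then h.choose else 0

/-! ### The degenerate principal series and its Whittaker functionals -/

/-- The degenerate principal series `I(s, μ)`: the functions on `G₂(ℚ_p)` that are right invariant
under some open subgroup and transform on the left under the Heisenberg parabolic subgroup by
`δ_P^{1/2} μ(det)|det|^s`, where `δ_P^{1/2} = |det|^{3/2}`. -/
def degPS (μ : ℚ_[p]ˣ →* Circle) (s : ℂ) : Set (G2 p → ℂ) :=
  {φ | (∃ K : Subgroup (G2 p), IsOpen (K : Set (G2 p)) ∧ ∀ g, ∀ k ∈ K, φ (g * k) = φ g) ∧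
    ∀ (a : Fin 5 → ℚ_[p]) (A : GL (Fin 2) ℚ_[p]) (g : G2 p),
      φ (nG p a * mG p A * g) = (‖A.val.det‖ : ℂ) ^ ((3 : ℂ) / 2) *
        μ (Matrix.GeneralLinearGroup.det A) * (‖A.val.det‖ : ℂ) ^ s * φ g}

/-- Right translation. -/
def translate (v : G2 p) (φ : G2 p → ℂ) : G2 p → ℂ := fun g => φ (g * v)

/-- The integrand of the Jacquet integral, twisted by the `z`-th power of the height. -/
def jacquetIntegrand (w : Fin 4 → ℚ_[p]) (φ : G2 p → ℂ) (z : ℂ) (a : Fin 5 → ℚ_[p]) : ℂ :=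
  φ (iota p * nG p a) * (height p (iota p * nG p a) : ℂ) ^ z * (starRingEnd ℂ) (psiW p w a)

/-- The product of local factors common to the normalizations below. -/
def normG2 (μ : ℚ_[p]ˣ →* Circle) (s : ℂ) (w : Fin 4 → ℚ_[p]) : ℂ :=
  Lfac p (fun a => μ a) (s + 1 / 2) * Lfac p (fun a => μ a) (s + 3 / 2) *
    Lfac p (fun a => μ a) (2 * s + 1) * Lfac p (fun a => μ a) (3 * s + 3 / 2) /
    LfacE p w (fun a => μ a) (s + 1 / 2)

/-- The normalized degenerate Whittaker functional on `I(s, μ)`. -/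
def whitG2 (μ : ℚ_[p]ˣ →* Circle) (s : ℂ) (w : Fin 4 → ℚ_[p]) (φ : G2 p → ℂ) : ℂ :=
  ((‖quartic p w‖ ^ ((3 : ℝ) / 4) : ℝ) : ℂ) * normG2 p μ s w *
    regVal p (Measure.pi fun _ : Fin 5 => haar p) (jacquetIntegrand p w φ)

/-! ### The Weil representation -/

/-- Schwartz functions on the p-adic line: locally constant and compactly supported. -/
def IsSchwartz (Φ : ℚ_[p] → ℂ) : Prop := IsLocallyConstant Φ ∧ HasCompactSupport Φ

/-- The Weil constant of the character of second degree `x ↦ ψ(a x²)`. -/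
def weilConst (a : ℚ_[p]) : ℂ :=
  ((‖2 * a‖ ^ ((1 : ℝ) / 2) : ℝ) : ℂ) *
    limUnder atTop fun k : ℕ =>
      ∫ x in Metric.closedBall (0 : ℚ_[p]) ((p : ℝ) ^ k), psi p (a * x ^ 2) ∂(haar p)

/-- The Haar measure that is self-dual for the Fourier transform with kernel `ψ(-2Stx)`, by which
`w_β` acts in the Weil representation. -/
def selfDual (S : ℚ_[p]) : Measure ℚ_[p] :=
  ENNReal.ofReal (‖2 * S‖ ^ ((1 : ℝ) / 2)) • haar p

/-- The Schrödinger model of the representation of the Heisenberg group `V` with central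
character `ψ(Sz)`. -/
def weilV (S x y z : ℚ_[p]) (Φ : ℚ_[p] → ℂ) : ℚ_[p] → ℂ :=
  fun t => Φ (t + x) * psi p (S * (z - 2 * t * y - x * y))

/-- The double cover of `SL₂` as a set; only the operators of the Weil representation matter, and
they are given for every pair below. -/
abbrev Mp : Type := Matrix.SpecialLinearGroup (Fin 2) ℚ_[p] × ℤˣ

open Classical in
/-- The operators `ω_S(h, ε)` of the Weil representation of the double cover of `SL₂`, determined by
`ω_S(diag(a, a⁻¹), ε)Φ(t) = ε γ(S)/γ(aS) |a|^{1/2} Φ(at)`, `ω_S((1 b; 0 1), ε)Φ(t) = ε ψ(-Sbt²)Φ(t)`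
and `ω_S(w_β, ε) = ε γ(-S) F_S`, where `F_S` is the Fourier transform with kernel `ψ(-2Stx)` and the
self-dual measure. An element `(a b; c d)` is written as `(1 ab; 0 1) diag(a, a⁻¹)` for `c = 0` and
as `(1 a/c; 0 1) w_β diag(-c, -c⁻¹) (1 d/c; 0 1)` for `c ≠ 0`. -/
def weilSL (S : ℚ_[p]) (h : Mp p) (Φ : ℚ_[p] → ℂ) : ℚ_[p] → ℂ :=
  let a := h.1.val 0 0
  let b := h.1.val 0 1
  let c := h.1.val 1 0
  let d := h.1.val 1 1
  let ε : ℂ := ((h.2 : ℤ) : ℂ)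
  fun t =>
    if c = 0 then
      ε * (weilConst p S / weilConst p (a * S)) * ((‖a‖ ^ ((1 : ℝ) / 2) : ℝ) : ℂ) *
        psi p (S * (-(a * b) * t ^ 2)) * Φ (a * t)
    else
      ε * weilConst p (S / c) * ((‖c‖ ^ (-(1 : ℝ) / 2) : ℝ) : ℂ) *
        psi p (S * (-(a / c) * t ^ 2)) *
        ∫ x, psi p (S * (2 / c * t * x - d / c * x ^ 2)) * Φ x ∂(selfDual p S)

/-! ### The local Fourier–Jacobi map -/

/-- The integrand of the Fourier–Jacobi map at `h`, in the coordinates `(z₁, z₂, y, z)` of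
`z_U(z₁, z₂) v(y, 0, z)`, twisted by the power `ζ` of the height. -/
def betaIntegrand (S : ℚ_[p]) (φ : G2 p → ℂ) (Φ : ℚ_[p] → ℂ) (h : Mp p) (ζ : ℂ)
    (u : Fin 4 → ℚ_[p]) : ℂ :=
  φ (iota p * wβ p * zU p (u 0) (u 1) * vG p (u 2) 0 (u 3) * lG p h.1) *
    (height p (iota p * wβ p * zU p (u 0) (u 1) * vG p (u 2) 0 (u 3) * lG p h.1) : ℂ) ^ ζ *
    (starRingEnd ℂ) (weilV p S (u 2) 0 (u 3) (weilSL p S h Φ) 0)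

/-- The Fourier–Jacobi map `h ↦ β_S(h; φ ⊗ conj Φ)`, normalized with the cubic algebra `E_w`. -/
def beta (μ : ℚ_[p]ˣ →* Circle) (s : ℂ) (S : ℚ_[p]) (w : Fin 4 → ℚ_[p]) (φ : G2 p → ℂ)
    (Φ : ℚ_[p] → ℂ) (h : Mp p) : ℂ :=
  normG2 p μ s w * Lfac p (fun a => μ a * chi p S a) (s + 1 / 2) /
    Lfac p (fun a => (μ a : ℂ) ^ 2) (2 * s + 1) *
    regVal p (Measure.pi fun _ : Fin 4 => haar p) (betaIntegrand p S φ Φ h)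

/-! ### Whittaker functionals on the double cover of `SL₂` -/

/-- The function `(a b; 0 a⁻¹) k ↦ |a|` on `SL₂` for the Iwasawa decomposition. -/
def heightSL (h : Matrix.SpecialLinearGroup (Fin 2) ℚ_[p]) : ℝ :=
  (max ‖h.val 1 0‖ ‖h.val 1 1‖)⁻¹

/-- The integrand of the Whittaker functional, twisted by the `z`-th power of the height. -/
def whitSLIntegrand (t : ℚ_[p]) (f : Mp p → ℂ) (z : ℂ) (b : ℚ_[p]) : ℂ :=
  f (wβMat p * xβMat p b, 1) * (heightSL p (wβMat p * xβMat p b) : ℂ) ^ z *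
    (starRingEnd ℂ) (psi p (t * b))

/-- The normalized Whittaker functional on the principal series of the double cover of `SL₂` with
parameters `δ` and `s`. -/
def whitSL (δ : ℚ_[p]ˣ → ℂ) (s : ℂ) (t : ℚ_[p]) (f : Mp p → ℂ) : ℂ :=
  ((‖t‖ ^ ((1 : ℝ) / 2) : ℝ) : ℂ) * (Lfac p (fun a => δ a ^ 2) (2 * s + 1) /
    Lfac p δ (s + 1 / 2)) * regVal p (haar p) (whitSLIntegrand p t f)

end FJ
end

noncomputable section

set_option linter.unusedSectionVars false

namespace FJ

open MeasureTheory Filter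
open scoped ENNReal

/-! ### Haar measure on balls of ℚ_p and orthogonality to the additive character. -/

section PadicMeasure

variable {p : ℕ} [Fact p.Prime]

/-! Let `IB f` be ∫ f(w_β x_β(u) ·) du, let `IA S f` be ∫ f(w_α x_α(v) ·) ψ(Sv) dv, and let T = `IT
S f` be `IB (IA S (IB f))`. Cutting ι w_β = w_β w_α w_β w_α into simple reflections turns the
integral defining β_S at h into ∫ conj(Ψ(y)) T(w_α x_α(y) ℓ(h)) dy with Ψ = ω_S(h)Φ
(`integral_four`). In the same way the integral over N becomes μ(-1) ∫∫ ψ(-tb) T(w_α x_α(y) w_β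
x_β(b)) dy db (`integral_five`); the sign comes from w_β². Translating φ by v(x,0,0) = x_α(x)
multiplies the inner integrand, after a shift of y, by ψ(S(2xy - x²b)) (`jac_eq`). Integrated
against conj(Φ(x)), this kernel is the conjugate of `chirp`, which is ω_S(w_β x_β(b))Φ up to the
factor γ(-S)|2S|^{1/2}. So where everything converges absolutely, the identity is Fubini's theorem
(`integral_conj_mul_jac`).

It remains to continue to z = 0. Only the innermost `IB` has a genuine tail: a geometric series with
the denominator of L(s + 1/2, μ) (`isRat_tail`). Every later integral collapses to a ball that does
not depend on z, on which it is a finite sum and creates no pole: the integral over v because ψ(Sv)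
oscillates (`IA_eq_ball`), the next one over the long root because `IA` vanishes there
(`IB_IA_eq_ball`), the one over y by the compact support of Ψ, the one over b because ψ(tb)
oscillates (`integral_tail_eq_zero`).

The left side is continued twice, first β_S in the height of G₂ and then the Whittaker integral in
the height of SL₂; the right side is continued once, in the height of G₂. Both lead to the same
integral V over a ball of the values at z = 0 (`rat_whittaker`). On the right the height is taken at
ιn and not at ιn x_α(x); this is harmless because the continued Jacquet integral depends only on the
value of the family at z = 0 (`rat_jac_one`). What is left is to compare normalizing factors. -/

theorem p_pos : (0 : ℝ) < p := by exact_mod_cast (Fact.out : p.Prime).pos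

theorem one_lt_p : (1 : ℝ) < p := by exact_mod_cast (Fact.out : p.Prime).one_lt

theorem p_ne_zero : (p : ℚ_[p]) ≠ 0 := by exact_mod_cast (Fact.out : p.Prime).ne_zero

instance : (haar p).IsAddHaarMeasure := by unfold haar; infer_instance

instance : SigmaFinite (haar p) := by unfold haar; infer_instance

/-- The ball `p ^ (-n) ℤ_p` of radius `p ^ n`. -/
def ball (p : ℕ) [Fact p.Prime] (n : ℤ) : Set ℚ_[p] := {x | ‖x‖ ≤ (p : ℝ) ^ n}

theorem ball_eq (n : ℤ) : ball p n = Metric.closedBall 0 ((p : ℝ) ^ n) := by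
  ext x; simp [ball]

theorem mem_ball {n : ℤ} {x : ℚ_[p]} : x ∈ ball p n ↔ ‖x‖ ≤ (p : ℝ) ^ n := Iff.rfl

theorem measurableSet_ball (n : ℤ) : MeasurableSet (ball p n) := by
  rw [ball_eq]; exact measurableSet_closedBall

theorem isOpen_ball (n : ℤ) : IsOpen (ball p n) := by
  rw [ball_eq]
  exact IsUltrametricDist.isOpen_closedBall _ (zpow_pos p_pos n).ne'

theorem isCompact_ball (n : ℤ) : IsCompact (ball p n) := by
  rw [ball_eq]; exact isCompact_closedBall _ _

theorem ball_mono {m n : ℤ} (h : m ≤ n) : ball p m ⊆ ball p n := fun _ hx =>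
  le_trans hx (zpow_le_zpow_right₀ one_lt_p.le h)

theorem add_mem_ball {n : ℤ} {x y : ℚ_[p]} (hx : x ∈ ball p n) (hy : y ∈ ball p n) :
    x + y ∈ ball p n :=
  (IsUltrametricDist.norm_add_le_max x y).trans (max_le hx hy)

theorem neg_mem_ball {n : ℤ} {x : ℚ_[p]} (hx : x ∈ ball p n) : -x ∈ ball p n := by
  simpa [ball] using hx

theorem zero_mem_ball (n : ℤ) : (0 : ℚ_[p]) ∈ ball p n := by
  simpa [ball] using (zpow_pos p_pos n).le

theorem mul_mem_ball {m n : ℤ} {x y : ℚ_[p]} (hx : x ∈ ball p m) (hy : y ∈ ball p n) :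
    x * y ∈ ball p (m + n) := by
  simp only [mem_ball, norm_mul, zpow_add₀ p_pos.ne'] at *
  gcongr

theorem exists_mem_ball (x : ℚ_[p]) : ∃ n : ℕ, x ∈ ball p n := by
  obtain ⟨n, hn⟩ := pow_unbounded_of_one_lt ‖x‖ (one_lt_p (p := p))
  exact ⟨n, by simpa [mem_ball] using hn.le⟩

theorem exists_norm_eq_zpow {x : ℚ_[p]} (hx : x ≠ 0) : ∃ n : ℤ, ‖x‖ = (p : ℝ) ^ n :=
  ⟨_, Padic.norm_eq_zpow_neg_valuation hx⟩

theorem norm_p_zpow (n : ℤ) : ‖(p : ℚ_[p]) ^ n‖ = (p : ℝ) ^ (-n) := by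
  rw [norm_zpow, Padic.norm_p, inv_zpow, zpow_neg]

theorem norm_le_one_iff_ball {x : ℚ_[p]} : ‖x‖ ≤ 1 ↔ x ∈ ball p 0 := by simp [mem_ball]

theorem exists_unique_rep (N k : ℕ) {x : ℚ_[p]} (hx : x ∈ ball p N) :
    ∃ a < p ^ (N + k), x - (a : ℚ_[p]) / (p : ℚ_[p]) ^ N ∈ ball p (-k) := by
  have hy : ‖(p : ℚ_[p]) ^ N * x‖ ≤ 1 := by
    rw [mem_ball, zpow_natCast] at hx
    rw [norm_mul, norm_pow, Padic.norm_p, inv_pow, inv_mul_le_iff₀ (pow_pos p_pos N)]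
    simpa using hx
  obtain ⟨y, hydef⟩ : ∃ y : ℤ_[p], (y : ℚ_[p]) = (p : ℚ_[p]) ^ N * x := ⟨⟨_, hy⟩, rfl⟩
  -- The representative is the residue of p^N x modulo p^(N+k), divided by p^N.
  refine ⟨y.appr (N + k), PadicInt.appr_lt _ _, ?_⟩
  have h := (PadicInt.norm_le_pow_iff_mem_span_pow _ (N + k)).mpr (PadicInt.appr_spec (N + k) y)
  have h2 : ‖(p : ℚ_[p]) ^ N * x - (y.appr (N + k) : ℚ_[p])‖ ≤ (p : ℝ) ^ (-(N + k : ℕ) : ℤ) := by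
    rw [← hydef]
    simpa [PadicInt.norm_def] using h
  have h3 : x - (y.appr (N + k) : ℚ_[p]) / (p : ℚ_[p]) ^ N =
      (p : ℚ_[p]) ^ (-N : ℤ) * ((p : ℚ_[p]) ^ N * x - (y.appr (N + k) : ℚ_[p])) := by
    have := p_ne_zero (p := p)
    rw [zpow_neg, zpow_natCast]
    field_simp
  rw [h3, mem_ball, norm_mul, norm_p_zpow]
  calc _ ≤ (p : ℝ) ^ (- -(N : ℤ)) * (p : ℝ) ^ (-(N + k : ℕ) : ℤ) := by gcongr
    _ = _ := by rw [← zpow_add₀ p_pos.ne']; congr 1; push_cast; ring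

theorem rep_unique (N k : ℕ) {a b : ℕ} (ha : a < p ^ (N + k)) (hb : b < p ^ (N + k))
    (h : (a : ℚ_[p]) / (p : ℚ_[p]) ^ N - (b : ℚ_[p]) / (p : ℚ_[p]) ^ N ∈ ball p (-k)) : a = b := by
  have h1 : ‖((a - b : ℤ) : ℚ_[p])‖ ≤ (p : ℝ) ^ (-(N + k : ℕ) : ℤ) := by
    have : ((a - b : ℤ) : ℚ_[p]) = (p : ℚ_[p]) ^ (N : ℤ) *
        ((a : ℚ_[p]) / (p : ℚ_[p]) ^ N - (b : ℚ_[p]) / (p : ℚ_[p]) ^ N) := by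
      have := p_ne_zero (p := p)
      push_cast
      rw [zpow_natCast]
      field_simp
    rw [this, norm_mul, norm_p_zpow]
    calc _ ≤ (p : ℝ) ^ (-(N : ℤ)) * (p : ℝ) ^ (-k : ℤ) := by gcongr; exact h
      _ = _ := by rw [← zpow_add₀ p_pos.ne']; congr 1; push_cast; ring
  rw [Padic.norm_int_le_pow_iff_dvd] at h1
  have h2 : (a : ℤ) ≡ b [ZMOD (p ^ (N + k) : ℕ)] := by
    refine (Int.modEq_iff_dvd.mpr ?_).symm
    exact_mod_cast h1
  rw [Int.natCast_modEq_iff] at h2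
  exact Nat.ModEq.eq_of_lt_of_lt h2 ha hb

/-- The coset `x + p ^ k ℤ_p`. -/
def coset (x : ℚ_[p]) (k : ℕ) : Set ℚ_[p] := {y | y - x ∈ ball p (-k)}

theorem measurableSet_coset (x : ℚ_[p]) (k : ℕ) : MeasurableSet (coset x k) := by
  have : coset x k = (fun y => y + -x) ⁻¹' ball p (-k) := by
    ext y; simp [coset, sub_eq_add_neg]
  rw [this]
  exact (measurable_add_const _) (measurableSet_ball _)

theorem haar_coset (x : ℚ_[p]) (k : ℕ) : haar p (coset x k) = haar p (ball p (-k)) := by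
  have : coset x k = (fun y => y + -x) ⁻¹' ball p (-k) := by
    ext y; simp [coset, sub_eq_add_neg]
  rw [this, measure_preimage_add_right]

/-- This finite decomposition into cosets of p^k ℤ_p both determines the volumes of all balls and
turns integrals of periodic functions into finite sums. -/
theorem ball_eq_iUnion (N k : ℕ) : ball p N = ⋃ a ∈ Finset.range (p ^ (N + k)),
    coset ((a : ℚ_[p]) / (p : ℚ_[p]) ^ N) k := by
  ext x
  simp only [Finset.mem_range, Set.mem_iUnion, exists_prop]
  constructor
  · exact exists_unique_rep N k
  · rintro ⟨a, -, ha⟩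
    have h1 : (a : ℚ_[p]) / (p : ℚ_[p]) ^ N ∈ ball p N := by
      rw [mem_ball, norm_div, norm_pow, Padic.norm_p, inv_pow, div_inv_eq_mul, zpow_natCast]
      exact mul_le_of_le_one_left (pow_pos p_pos N).le (by simpa using Padic.norm_int_le_one (p := p) a)
    have h2 : x - (a : ℚ_[p]) / (p : ℚ_[p]) ^ N ∈ ball p N := ball_mono (by omega) ha
    simpa using add_mem_ball h2 h1

theorem coset_disjoint (N k : ℕ) : (↑(Finset.range (p ^ (N + k))) : Set ℕ).Pairwise
    (Function.onFun Disjoint fun a : ℕ => coset ((a : ℚ_[p]) / (p : ℚ_[p]) ^ N) k) := by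
  intro a ha b hb hab
  rw [Function.onFun, Set.disjoint_left]
  intro x hxa hxb
  refine hab (rep_unique N k (by simpa using ha) (by simpa using hb) ?_)
  have := add_mem_ball hxb (neg_mem_ball hxa)
  convert this using 1
  ring

theorem haar_ball_zero : haar p (ball p 0) = 1 := by
  have h := Measure.addHaarMeasure_self (K₀ := unitBall p)
  have h2 : (unitBall p : Set ℚ_[p]) = ball p 0 := by
    rw [ball_eq]; simp [unitBall]
  rwa [h2] at h

/-- For k = 0 this gives the volumes of the large balls, for N = 0 those of the small ones, because
ℤ_p has volume one. -/
theorem haar_ball_nat (N k : ℕ) :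
    haar p (ball p N) = (p : ENNReal) ^ (N + k) * haar p (ball p (-k)) := by
  rw [ball_eq_iUnion N k, measure_biUnion_finset (coset_disjoint N k)
    (fun _ _ => measurableSet_coset _ _)]
  simp [haar_coset]

theorem haar_ball (n : ℤ) : haar p (ball p n) = ENNReal.ofReal ((p : ℝ) ^ n) := by
  have hp : (p : ENNReal) = ENNReal.ofReal p := by simp
  obtain ⟨k, rfl | rfl⟩ := n.eq_nat_or_neg
  · have := haar_ball_nat (p := p) k 0
    simp only [add_zero, Nat.cast_zero, neg_zero, haar_ball_zero, mul_one] at this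
    rw [this, zpow_natCast, ENNReal.ofReal_pow p_pos.le, hp]
  · have := haar_ball_nat (p := p) 0 k
    simp only [zero_add, Nat.cast_zero, haar_ball_zero] at this
    rw [zpow_neg, zpow_natCast, ENNReal.ofReal_inv_of_pos (pow_pos p_pos k),
      ENNReal.ofReal_pow p_pos.le, ← hp]
    exact (ENNReal.eq_inv_of_mul_eq_one_left (by rw [mul_comm]; exact this.symm))

theorem haar_ball_real (n : ℤ) : (haar p).real (ball p n) = (p : ℝ) ^ n := by
  rw [Measure.real, haar_ball, ENNReal.toReal_ofReal (zpow_pos p_pos n).le]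

theorem haar_ball_lt_top (n : ℤ) : haar p (ball p n) < ⊤ := by
  rw [haar_ball]; exact ENNReal.ofReal_lt_top

/-- Integrals of periodic functions over balls are finite sums. -/
theorem integral_ball_of_periodic {E : Type*} [NormedAddCommGroup E] [NormedSpace ℝ E] [CompleteSpace E]
    (N k : ℕ) {H : ℚ_[p] → E}
    (hH : ∀ x, ∀ e ∈ ball p (-k), H (x + e) = H x) :
    ∫ x in ball p N, H x ∂haar p = ∑ a ∈ Finset.range (p ^ (N + k)),
      ((p : ℝ) ^ (-k : ℤ)) • H ((a : ℚ_[p]) / (p : ℚ_[p]) ^ N) := by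
  have hc : ∀ x, Set.EqOn H (fun _ => H x) (coset x k) := fun x y hy => by
    have := hH x _ hy
    simpa using this
  have hfin : ∀ x : ℚ_[p], haar p (coset x k) ≠ ⊤ := fun x => by
    rw [haar_coset]; exact (haar_ball_lt_top _).ne
  rw [ball_eq_iUnion N k, integral_biUnion_finset _ (fun _ _ => measurableSet_coset _ _)
    (coset_disjoint N k)]
  · refine Finset.sum_congr rfl fun a _ => ?_
    rw [setIntegral_congr_fun (measurableSet_coset _ _) (hc _), setIntegral_const, Measure.real,
      haar_coset, haar_ball, ENNReal.toReal_ofReal (zpow_pos p_pos _).le]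
  · intro a _
    exact (integrableOn_const (hfin _)).congr_fun (hc _).symm (measurableSet_coset _ _)

/-- By uniqueness of Haar measure the image is a multiple of `haar`; the factor is the volume of the
preimage of ℤ_p, a ball of radius |a|⁻¹. -/
theorem map_mul_haar {a : ℚ_[p]} (ha : a ≠ 0) :
    Measure.map (fun x => a * x) (haar p) = ENNReal.ofReal ‖a‖⁻¹ • haar p := by
  have hinst : (Measure.map (fun x => a * x) (haar p)).IsAddHaarMeasure := by
    have := Measure.isAddHaarMeasure_map (haar p) (AddMonoidHom.mulLeft a)
      (by simpa using continuous_const_mul a) (fun y => ⟨a⁻¹ * y, by simp [ha]⟩)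
      (by simpa using (Homeomorph.mulLeft₀ a ha).isClosedEmbedding.tendsto_cocompact)
    simpa using this
  have h := Measure.addHaarMeasure_unique (Measure.map (fun x => a * x) (haar p)) (unitBall p)
  rw [h]
  congr 1
  have h2 : (unitBall p : Set ℚ_[p]) = ball p 0 := by rw [ball_eq]; simp [unitBall]
  obtain ⟨n, hn⟩ := exists_norm_eq_zpow ha
  rw [h2, Measure.map_apply (measurable_const_mul a) (measurableSet_ball _)]
  have : (fun x => a * x) ⁻¹' ball p 0 = ball p (-n) := by
    ext x
    simp only [Set.mem_preimage, mem_ball, norm_mul, hn, zpow_zero, zpow_neg]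
    rw [← one_div, le_div_iff₀' (zpow_pos p_pos n)]
  rw [this, haar_ball, hn, zpow_neg]

theorem lintegral_comp_mul {a : ℚ_[p]} (ha : a ≠ 0) (f : ℚ_[p] → ENNReal) :
    ∫⁻ x, f (a * x) ∂haar p = ENNReal.ofReal ‖a‖⁻¹ * ∫⁻ x, f x ∂haar p := by
  have h := (Homeomorph.mulLeft₀ a ha).measurableEmbedding.lintegral_map (μ := haar p) f
  rw [← smul_eq_mul, ← lintegral_smul_measure, ← map_mul_haar ha]
  exact h.symm

theorem integral_comp_mul {E : Type*} [NormedAddCommGroup E] [NormedSpace ℝ E] {a : ℚ_[p]}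
    (ha : a ≠ 0) (f : ℚ_[p] → E) :
    ∫ x, f (a * x) ∂haar p = ‖a‖⁻¹ • ∫ x, f x ∂haar p := by
  have h := (Homeomorph.mulLeft₀ a ha).measurableEmbedding.integral_map (μ := haar p) f
  have h2 : ∫ x, f x ∂(ENNReal.ofReal ‖a‖⁻¹ • haar p) = ‖a‖⁻¹ • ∫ x, f x ∂haar p := by
    rw [integral_smul_measure, ENNReal.toReal_ofReal (by positivity)]
  rw [← h2, ← map_mul_haar ha]
  exact h.symm

theorem integral_comp_mul_of_norm_one {E : Type*} [NormedAddCommGroup E] [NormedSpace ℝ E]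
    {a : ℚ_[p]} (ha : ‖a‖ = 1) (f : ℚ_[p] → E) :
    ∫ x, f (a * x) ∂haar p = ∫ x, f x ∂haar p := by
  rw [integral_comp_mul (by rintro rfl; simp at ha), ha]; simp

theorem integral_comp_mul_add {E : Type*} [NormedAddCommGroup E] [NormedSpace ℝ E] {a : ℚ_[p]}
    (ha : ‖a‖ = 1) (c : ℚ_[p]) (f : ℚ_[p] → E) :
    ∫ x, f (a * x + c) ∂haar p = ∫ x, f x ∂haar p := by
  rw [integral_comp_mul_of_norm_one ha (fun x => f (x + c)), integral_add_right_eq_self]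

theorem lintegral_comp_mul_add {a : ℚ_[p]} (ha : ‖a‖ = 1) (c : ℚ_[p]) (f : ℚ_[p] → ENNReal) :
    ∫⁻ x, f (a * x + c) ∂haar p = ∫⁻ x, f x ∂haar p := by
  rw [lintegral_comp_mul (by rintro rfl; simp at ha) (fun x => f (x + c)), ha,
    lintegral_add_right_eq_self]
  simp

/-! ### The additive character -/

theorem psi_add (x y : ℚ_[p]) : psi p (x + y) = psi p x * psi p y := by
  obtain ⟨a, n, ha⟩ := exists_frac p x
  obtain ⟨b, m, hb⟩ := exists_frac p y
  have hp0 := p_ne_zero (p := p)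
  have hpc : (p : ℂ) ≠ 0 := by exact_mod_cast (Fact.out : p.Prime).ne_zero
  rw [psi_eq p x a n ha, psi_eq p y b m hb, psi_eq p (x + y) (a * p ^ m + b * p ^ n) (n + m),
    ← Complex.exp_add]
  · congr 1
    push_cast
    rw [pow_add]
    field_simp
    ring
  · have : x + y - ((a * p ^ m + b * p ^ n : ℤ) : ℚ_[p]) / (p : ℚ_[p]) ^ (n + m) =
        (x - a / (p : ℚ_[p]) ^ n) + (y - b / (p : ℚ_[p]) ^ m) := by
      push_cast
      rw [pow_add]
      field_simp
      ring
    rw [this]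
    exact (IsUltrametricDist.norm_add_le_max _ _).trans (max_le ha hb)

theorem psi_of_norm_le_one {x : ℚ_[p]} (hx : ‖x‖ ≤ 1) : psi p x = 1 := by
  rw [psi_eq p x 0 0 (by simpa using hx)]
  simp

theorem psi_zero : psi p 0 = 1 := psi_of_norm_le_one (by simp)

theorem norm_psi (x : ℚ_[p]) : ‖psi p x‖ = 1 := by
  unfold psi
  rw [Complex.norm_exp]
  have : (-2 * (Real.pi : ℂ) * Complex.I * ((exists_frac p x).choose /
      (p : ℂ) ^ (exists_frac p x).choose_spec.choose)).re = 0 := by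
    have : (-2 * (Real.pi : ℂ) * Complex.I * ((exists_frac p x).choose /
      (p : ℂ) ^ (exists_frac p x).choose_spec.choose)) = ((-2 * Real.pi * ((exists_frac p x).choose /
      (p : ℝ) ^ (exists_frac p x).choose_spec.choose) : ℝ) : ℂ) * Complex.I := by
      push_cast; ring
    rw [this, Complex.re_ofReal_mul]
    simp
  rw [this, Real.exp_zero]

theorem psi_neg_mul (x : ℚ_[p]) : psi p (-x) * psi p x = 1 := by
  rw [← psi_add]; simp [psi_zero]

theorem conj_psi (x : ℚ_[p]) : (starRingEnd ℂ) (psi p x) = psi p (-x) := by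
  have h1 := psi_neg_mul x
  have h2 : (starRingEnd ℂ) (psi p x) * psi p x = 1 := by
    rw [mul_comm, Complex.mul_conj, Complex.normSq_eq_norm_sq, norm_psi]; simp
  have h3 : psi p x ≠ 0 := fun h => by simpa [h] using norm_psi x
  exact mul_right_cancel₀ h3 (h2.trans h1.symm)

theorem psi_add_of_norm_le_one {x y : ℚ_[p]} (hy : ‖y‖ ≤ 1) : psi p (x + y) = psi p x := by
  rw [psi_add, psi_of_norm_le_one hy, mul_one]

theorem psi_inv_p_ne_one : psi p (p : ℚ_[p])⁻¹ ≠ 1 := by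
  rw [psi_eq p _ 1 1 (by simp)]
  intro h
  rw [Complex.exp_eq_one_iff] at h
  obtain ⟨n, hn⟩ := h
  have hpc : (p : ℂ) ≠ 0 := by exact_mod_cast (Fact.out : p.Prime).ne_zero
  have h2 : (-1 : ℂ) = n * p := by
    have h3 : (2 * Real.pi * Complex.I : ℂ) ≠ 0 := Complex.two_pi_I_ne_zero
    apply mul_right_cancel₀ h3
    push_cast at hn
    field_simp at hn ⊢
    linear_combination hn
  have h4 : (-1 : ℤ) = n * p := by exact_mod_cast h2
  have h5 : (p : ℤ) ∣ 1 := ⟨-n, by linarith⟩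
  have := Int.eq_one_of_dvd_one (by positivity) h5
  have := one_lt_p (p := p)
  have h6 : (p : ℝ) = 1 := by exact_mod_cast ‹(p : ℤ) = 1›
  linarith

theorem continuous_psi : Continuous (psi p) := by
  refine IsLocallyConstant.continuous ?_
  rw [IsLocallyConstant.iff_eventually_eq]
  intro x
  have : ∀ᶠ y in nhds x, y - x ∈ ball p 0 := by
    have : Continuous fun y => y - x := by fun_prop
    exact this.continuousAt.eventually ((isOpen_ball 0).mem_nhds (by simpa using zero_mem_ball 0))
  filter_upwards [this] with y hy
  have : y = x + (y - x) := by ring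
  rw [this, psi_add_of_norm_le_one (norm_le_one_iff_ball.mpr hy)]

/-- The character is non-trivial on `a • ball` as soon as `a • ball` is not in `ℤ_p`. -/
theorem exists_psi_ne_one {a : ℚ_[p]} {n : ℤ} (h : 1 < ‖a‖ * (p : ℝ) ^ n) :
    ∃ e ∈ ball p n, psi p (a * e) ≠ 1 := by
  have ha : a ≠ 0 := by rintro rfl; simp at h; linarith
  -- At this point the argument of the character is 1/p, the simplest element outside its kernel.
  refine ⟨a⁻¹ * (p : ℚ_[p])⁻¹, ?_, ?_⟩
  · obtain ⟨m, hm⟩ := exists_norm_eq_zpow ha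
    rw [hm, ← zpow_add₀ p_pos.ne'] at h
    have h2 : 0 < m + n := by
      by_contra hc
      have := zpow_le_one_of_nonpos₀ (one_lt_p (p := p)).le (by omega : m + n ≤ 0)
      linarith
    rw [mem_ball, norm_mul, norm_inv, norm_inv, hm, Padic.norm_p, inv_inv, ← zpow_neg,
      ← zpow_add_one₀ p_pos.ne']
    exact zpow_le_zpow_right₀ one_lt_p.le (by omega)
  · rw [mul_inv_cancel_left₀ ha]; exact psi_inv_p_ne_one

/-- Translation by an element of the ball multiplies the integral by a value of the character
different from one. -/
theorem integral_ball_psi {a : ℚ_[p]} {n : ℤ} (h : 1 < ‖a‖ * (p : ℝ) ^ n) :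
    ∫ x in ball p n, psi p (a * x) ∂haar p = 0 := by
  obtain ⟨e, he, hne⟩ := exists_psi_ne_one h
  rw [← integral_indicator (measurableSet_ball n)]
  set f := (ball p n).indicator fun x => psi p (a * x)
  have h1 : ∀ x, f (x + e) = psi p (a * e) * f x := by
    intro x
    by_cases hx : x ∈ ball p n
    · simp only [f, Set.indicator_of_mem hx, Set.indicator_of_mem (add_mem_ball hx he)]
      rw [mul_add, psi_add, mul_comm]
    · have : x + e ∉ ball p n := fun hc => hx (by simpa using add_mem_ball hc (neg_mem_ball he))
      simp [f, Set.indicator_of_notMem hx, Set.indicator_of_notMem this]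
  have h2 := integral_add_right_eq_self (μ := haar p) f e
  simp only [h1] at h2
  rw [integral_const_mul] at h2
  have h3 : (psi p (a * e) - 1) * ∫ x, f x ∂haar p = 0 := by rw [sub_mul, h2]; ring
  exact (mul_eq_zero.mp h3).resolve_left (sub_ne_zero.mpr hne)

/-- A function on a set stable under `1 + p ^ k ℤ_p` that is invariant under this group is
orthogonal to the additive character if the character oscillates along all the orbits. -/
theorem integral_mul_psi_eq_zero {h : ℚ_[p] → ℂ} {D : Set ℚ_[p]} (hD : MeasurableSet D)
    (hh : IntegrableOn h D (haar p)) {k : ℕ} (hk : 1 ≤ k) {a : ℚ_[p]}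
    (hDm : ∀ x, ∀ e ∈ ball p (-k), (x * (1 + e) ∈ D ↔ x ∈ D))
    (hinv : ∀ x ∈ D, ∀ e ∈ ball p (-k), h (x * (1 + e)) = h x)
    (hosc : ∀ x ∈ D, 1 < ‖a * x‖ * (p : ℝ) ^ (-k : ℤ)) :
    ∫ x in D, h x * psi p (a * x) ∂haar p = 0 := by
  rw [← integral_indicator hD]
  set f := D.indicator fun x => h x * psi p (a * x)
  have hn1 : ∀ e ∈ ball p (-k : ℤ), ‖1 + e‖ = 1 := by
    intro e he
    have h1 : ‖e‖ < 1 := lt_of_le_of_lt he (zpow_lt_one_of_neg₀ one_lt_p (by omega))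
    have := IsUltrametricDist.norm_add_eq_max_of_norm_ne_norm (x := (1 : ℚ_[p])) (y := e)
      (by rw [norm_one]; exact h1.ne')
    rw [this, norm_one, max_eq_left h1.le]
  -- The substitution x ↦ x(1 + e) preserves the measure, the domain and h, and only adds the factor
  -- ψ(axe).
  have h1 : ∀ e ∈ ball p (-k : ℤ), ∫ x, f x ∂haar p =
      ∫ x in D, h x * psi p (a * x) * psi p (a * x * e) ∂haar p := by
    intro e he
    rw [← integral_comp_mul_of_norm_one (hn1 e he) f, ← integral_indicator hD]
    congr 1 with x
    rw [mul_comm]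
    by_cases hx : x ∈ D
    · simp only [f]
      rw [Set.indicator_of_mem ((hDm x e he).mpr hx), Set.indicator_of_mem hx, hinv x hx e he,
        mul_add, mul_add, mul_one, psi_add, mul_assoc, mul_assoc]
    · simp only [f]
      rw [Set.indicator_of_notMem (fun hc => hx ((hDm x e he).mp hc)), Set.indicator_of_notMem hx]
  -- Average over e and exchange the integrals: for fixed x the inner integral is that of a
  -- non-trivial character of the ball.
  have h2 : ∫ e in ball p (-k : ℤ), (∫ x, f x ∂haar p) ∂haar p = ∫ e in ball p (-k : ℤ),
      ∫ x in D, h x * psi p (a * x) * psi p (a * x * e) ∂haar p ∂haar p :=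
    setIntegral_congr_fun (measurableSet_ball _) h1
  have h3 : ∫ e in ball p (-k : ℤ), ∫ x in D, h x * psi p (a * x) * psi p (a * x * e) ∂haar p ∂haar p
      = 0 := by
    have : IsFiniteMeasure ((haar p).restrict (ball p (-k : ℤ))) :=
      ⟨by rw [Measure.restrict_apply_univ]; exact haar_ball_lt_top _⟩
    rw [integral_integral_swap]
    · rw [setIntegral_congr_fun (g := fun _ => (0 : ℂ)) hD, integral_zero]
      intro x hx
      simp only
      rw [integral_const_mul, integral_ball_psi (hosc x hx), mul_zero]
    · have h4 : Integrable (fun z : ℚ_[p] × ℚ_[p] => h z.2)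
          (((haar p).restrict (ball p (-k : ℤ))).prod ((haar p).restrict D)) :=
        hh.comp_snd _
      refine (h4.mul_bdd (c := 1) (g := fun z => psi p (a * z.2) * psi p (a * z.2 * z.1)) ?_ ?_).congr
        (ae_of_all _ fun z => ?_)
      · exact (Continuous.mul (continuous_psi.comp (by fun_prop))
          (continuous_psi.comp (by fun_prop))).aestronglyMeasurable
      · exact ae_of_all _ fun z => by simp [norm_psi]
      · simp [Function.uncurry, mul_assoc]
  rw [h3, setIntegral_const, haar_ball_real] at h2
  exact (smul_eq_zero.mp h2).resolve_left (zpow_pos p_pos _).ne'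

end PadicMeasure

/-! ### Rational functions of p^(-z) and their values at z = 0. -/

section RationalFunctions

variable {p : ℕ} [Fact p.Prime]

/-- For `Re z` large, `f z` is a rational function of `p ^ (-z)`, regular at `z = 0` with
value `c`. -/
def IsRat (p : ℕ) (f : ℂ → ℂ) (c : ℂ) : Prop :=
  ∃ P Q : Polynomial ℂ, Q.eval 1 ≠ 0 ∧
    (∃ B : ℝ, ∀ z : ℂ, B < z.re → Q.eval ((p : ℂ) ^ (-z)) * f z = P.eval ((p : ℂ) ^ (-z))) ∧
    c = P.eval 1 / Q.eval 1

theorem p_ne_zero_complex : (p : ℂ) ≠ 0 := by exact_mod_cast (Fact.out : p.Prime).ne_zero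

namespace IsRat

theorem const (c : ℂ) : IsRat p (fun _ => c) c :=
  ⟨Polynomial.C c, 1, by simp, ⟨0, by simp⟩, by simp⟩

theorem add {f g : ℂ → ℂ} {c d : ℂ} (hf : IsRat p f c) (hg : IsRat p g d) :
    IsRat p (fun z => f z + g z) (c + d) := by
  obtain ⟨P, Q, hQ, ⟨B, hB⟩, rfl⟩ := hf
  obtain ⟨P', Q', hQ', ⟨B', hB'⟩, rfl⟩ := hg
  refine ⟨P * Q' + P' * Q, Q * Q', by simp [hQ, hQ'], ⟨max B B', fun z hz => ?_⟩, ?_⟩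
  · have h1 := hB z (lt_of_le_of_lt (le_max_left _ _) hz)
    have h2 := hB' z (lt_of_le_of_lt (le_max_right _ _) hz)
    simp only [Polynomial.eval_add, Polynomial.eval_mul, ← h1, ← h2]
    ring
  · simp only [Polynomial.eval_add, Polynomial.eval_mul]
    field_simp

theorem mul {f g : ℂ → ℂ} {c d : ℂ} (hf : IsRat p f c) (hg : IsRat p g d) :
    IsRat p (fun z => f z * g z) (c * d) := by
  obtain ⟨P, Q, hQ, ⟨B, hB⟩, rfl⟩ := hf
  obtain ⟨P', Q', hQ', ⟨B', hB'⟩, rfl⟩ := hg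
  refine ⟨P * P', Q * Q', by simp [hQ, hQ'], ⟨max B B', fun z hz => ?_⟩, ?_⟩
  · have h1 := hB z (lt_of_le_of_lt (le_max_left _ _) hz)
    have h2 := hB' z (lt_of_le_of_lt (le_max_right _ _) hz)
    simp only [Polynomial.eval_mul, ← h1, ← h2]
    ring
  · simp only [Polynomial.eval_mul]
    field_simp

theorem congr {f g : ℂ → ℂ} {c : ℂ} (hf : IsRat p f c) (B : ℝ)
    (h : ∀ z : ℂ, B < z.re → f z = g z) : IsRat p g c := by
  obtain ⟨P, Q, hQ, ⟨B', hB'⟩, hc⟩ := hf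
  refine ⟨P, Q, hQ, ⟨max B B', fun z hz => ?_⟩, hc⟩
  rw [← h z (lt_of_le_of_lt (le_max_left _ _) hz)]
  exact hB' z (lt_of_le_of_lt (le_max_right _ _) hz)

theorem sum {ι : Type*} (s : Finset ι) {f : ι → ℂ → ℂ} {c : ι → ℂ}
    (h : ∀ i ∈ s, IsRat p (f i) (c i)) :
    IsRat p (fun z => ∑ i ∈ s, f i z) (∑ i ∈ s, c i) := by
  classical
  induction s using Finset.induction_on with
  | empty => simpa using const (p := p) 0
  | insert a s ha ih =>
    simp only [Finset.sum_insert ha]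
    exact (h a (by simp)).add (ih fun i hi => h i (by simp [hi]))

theorem cpow (n : ℤ) : IsRat p (fun z => (p : ℂ) ^ ((n : ℂ) * z)) 1 := by
  have hp := p_ne_zero_complex (p := p)
  obtain ⟨k, rfl | rfl⟩ := n.eq_nat_or_neg
  · refine ⟨1, Polynomial.X ^ k, by simp, ⟨0, fun z _ => ?_⟩, by simp⟩
    simp only [Polynomial.eval_pow, Polynomial.eval_X, Polynomial.eval_one, Int.cast_natCast]
    rw [← Complex.cpow_nat_mul, ← Complex.cpow_add _ _ hp]
    simp
  · refine ⟨Polynomial.X ^ k, 1, by simp, ⟨0, fun z _ => ?_⟩, by simp⟩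
    simp only [Polynomial.eval_pow, Polynomial.eval_X, Polynomial.eval_one, Int.cast_neg,
      Int.cast_natCast, one_mul]
    rw [← Complex.cpow_nat_mul]
    congr 1; ring

/-- Both fractions agree at p^(-n) for all large n. These are infinitely many points, so
cross-multiplication gives an identity of polynomials, which may be evaluated at 1. -/
theorem unique {f : ℂ → ℂ} {c d : ℂ} (hf : IsRat p f c) (hg : IsRat p f d) :
    c = d := by
  obtain ⟨P, Q, hQ, ⟨B, hB⟩, rfl⟩ := hf
  obtain ⟨P', Q', hQ', ⟨B', hB'⟩, rfl⟩ := hg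
  have hp := one_lt_p (p := p)
  suffices h : P * Q' = P' * Q by
    have := congrArg (Polynomial.eval 1) h
    simp only [Polynomial.eval_mul] at this
    rw [div_eq_div_iff hQ hQ', this]
  apply Polynomial.eq_of_infinite_eval_eq
  obtain ⟨M, hM⟩ := exists_nat_gt (max B B')
  refine Set.infinite_of_injective_forall_mem (f := fun n : ℕ => (p : ℂ) ^ (-((M + n : ℕ) : ℂ))) ?_ ?_
  · intro a b hab
    simp only [Complex.cpow_neg, Complex.cpow_natCast, inv_inj] at hab
    have h2 : (p : ℝ) ^ (M + a) = (p : ℝ) ^ (M + b) := by exact_mod_cast hab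
    have := pow_right_injective₀ p_pos hp.ne' h2
    omega
  · intro n
    have hz : max B B' < ((M + n : ℕ) : ℂ).re := by
      rw [Complex.natCast_re]
      refine hM.trans_le ?_
      push_cast
      have : (0 : ℝ) ≤ n := by positivity
      linarith
    have h1 := hB _ (lt_of_le_of_lt (le_max_left _ _) hz)
    have h2 := hB' _ (lt_of_le_of_lt (le_max_right _ _) hz)
    simp only [Set.mem_ofPred_eq, Polynomial.eval_mul, ← h1, ← h2]
    ring

/-- The integral of periodic functions over a ball preserves rationality. -/
theorem ballIntegral {H : ℂ → ℚ_[p] → ℂ} {H₀ : ℚ_[p] → ℂ} (N k : ℕ) (B : ℝ)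
    (hper : ∀ z : ℂ, B < z.re → ∀ x, ∀ e ∈ ball p (-k), H z (x + e) = H z x)
    (hH : ∀ x, IsRat p (fun z => H z x) (H₀ x)) :
    IsRat p (fun z => ∫ x in ball p N, H z x ∂haar p) (∫ x in ball p N, H₀ x ∂haar p) := by
  -- The values at z = 0 inherit the periods because continuation is unique.
  have h₀ : ∀ x, ∀ e ∈ ball p (-k), H₀ (x + e) = H₀ x := fun x e he =>
    ((hH (x + e)).congr B fun z hz => hper z hz x e he).unique (hH x)
  rw [integral_ball_of_periodic N k h₀]
  simp only [Complex.real_smul]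
  refine IsRat.congr (IsRat.sum _ fun a _ => (IsRat.const _).mul (hH _)) B fun z hz => ?_
  rw [integral_ball_of_periodic N k (hper z hz)]
  simp only [Complex.real_smul]

end IsRat

/-- Separates absolute convergence from rationality, so that the latter can be proved for iterated
integrals by the calculus of `IsRat`. -/
theorem isRegVal_iff {X : Type} [MeasurableSpace X] {ν : Measure X} {F : ℂ → X → ℂ} {c : ℂ} :
    IsRegVal p ν F c ↔ IsRat p (fun z => ∫ x, F z x ∂ν) c ∧
      ∃ B : ℝ, ∀ z : ℂ, B < z.re → Integrable (F z) ν := by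
  constructor
  · rintro ⟨P, Q, hQ, ⟨B, hB⟩, hc⟩
    exact ⟨⟨P, Q, hQ, ⟨B, fun z hz => (hB z hz).2⟩, hc⟩, B, fun z hz => (hB z hz).1⟩
  · rintro ⟨⟨P, Q, hQ, ⟨B, hB⟩, hc⟩, B', hB'⟩
    exact ⟨P, Q, hQ, ⟨max B B', fun z hz => ⟨hB' z (lt_of_le_of_lt (le_max_right _ _) hz),
      hB z (lt_of_le_of_lt (le_max_left _ _) hz)⟩⟩, hc⟩

/-- Uniqueness of continuation makes the choice in `regVal` immaterial. -/
theorem regVal_eq {X : Type} [MeasurableSpace X] {ν : Measure X} {F : ℂ → X → ℂ} {c : ℂ}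
    (h : IsRegVal p ν F c) : regVal p ν F = c := by
  have hex : RegExists p ν F := ⟨c, h⟩
  rw [regVal, dif_pos hex]
  exact (isRegVal_iff.mp hex.choose_spec).1.unique (isRegVal_iff.mp h).1

end RationalFunctions

/-! ### Continuous characters of ℚ_pˣ, extended by zero. -/

section Characters

variable {p : ℕ} [Fact p.Prime]

open Classical in
/-- A character of `ℚ_pˣ`, extended by zero. -/
def chr (μ : ℚ_[p]ˣ →* Circle) (x : ℚ_[p]) : ℂ := if h : x = 0 then 0 else μ (Units.mk0 x h)

variable (μ : ℚ_[p]ˣ →* Circle)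

theorem chr_of_ne {x : ℚ_[p]} (h : x ≠ 0) : chr μ x = μ (Units.mk0 x h) := by simp [chr, h]

theorem chr_units (u : ℚ_[p]ˣ) : chr μ u = μ u := by
  rw [chr_of_ne μ u.ne_zero]; simp

theorem chr_mul (x y : ℚ_[p]) : chr μ (x * y) = chr μ x * chr μ y := by
  by_cases hx : x = 0
  · simp [chr, hx]
  by_cases hy : y = 0
  · simp [chr, hy]
  rw [chr_of_ne μ hx, chr_of_ne μ hy, chr_of_ne μ (mul_ne_zero hx hy), ← Circle.coe_mul, ← map_mul]
  congr 2
  ext; simp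

theorem chr_one : chr μ 1 = 1 := by
  have := chr_units μ 1; simpa using this

theorem norm_chr {x : ℚ_[p]} (h : x ≠ 0) : ‖chr μ x‖ = 1 := by
  rw [chr_of_ne μ h]; exact Circle.norm_coe _

theorem chr_ne_zero {x : ℚ_[p]} (h : x ≠ 0) : chr μ x ≠ 0 := fun h0 => by
  simpa [h0] using norm_chr μ h

/-- The circle has no small subgroups: while all powers stay close to 1, the factor w^(2^n) + 1 has
absolute value at least 3/2, so repeated squaring would move w away from 1 geometrically. -/
theorem norm_sub_one_small {w : ℂ} (h : ∀ n : ℕ, ‖w ^ n - 1‖ < 1 / 2) : w = 1 := by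
  by_contra hw
  have hpos : 0 < ‖w - 1‖ := norm_pos_iff.mpr (sub_ne_zero.mpr hw)
  have key : ∀ n : ℕ, (3 / 2 : ℝ) ^ n * ‖w - 1‖ ≤ ‖w ^ 2 ^ n - 1‖ := by
    intro n
    induction n with
    | zero => simp
    | succ n ih =>
      have h1 : w ^ 2 ^ (n + 1) - 1 = (w ^ 2 ^ n - 1) * (w ^ 2 ^ n + 1) := by ring
      have h2 : (3 / 2 : ℝ) ≤ ‖w ^ 2 ^ n + 1‖ := by
        have h3 := norm_sub_norm_le (2 : ℂ) (-(w ^ 2 ^ n - 1))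
        have h4 : (2 : ℂ) - -(w ^ 2 ^ n - 1) = w ^ 2 ^ n + 1 := by ring
        rw [h4, norm_neg] at h3
        have := h (2 ^ n)
        have h5 : ‖(2 : ℂ)‖ = 2 := by simp
        linarith
      rw [h1, norm_mul, pow_succ]
      nlinarith [norm_nonneg (w ^ 2 ^ n - 1)]
  obtain ⟨n, hn⟩ := pow_unbounded_of_one_lt (1 / ‖w - 1‖) (by norm_num : (1 : ℝ) < 3 / 2)
  rw [div_lt_iff₀ hpos] at hn
  linarith [key n, h (2 ^ n)]

theorem continuousOn_chr (hμ : Continuous μ) : ContinuousOn (chr μ) {0}ᶜ := by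
  rw [continuousOn_iff_continuous_domRestrict]
  have h : Continuous fun x : {x : ℚ_[p] // x ≠ 0} => ((μ (unitsHomeomorphNeZero.symm x) : Circle) : ℂ) :=
    continuous_subtype_val.comp (hμ.comp unitsHomeomorphNeZero.symm.continuous)
  refine (h.comp (continuous_id' : Continuous fun x : ({0}ᶜ : Set ℚ_[p]) => x)).congr fun x => ?_
  refine Eq.trans ?_ (chr_of_ne μ x.2).symm
  have : unitsHomeomorphNeZero.symm x = Units.mk0 (x : ℚ_[p]) x.2 :=
    unitsHomeomorphNeZero.symm_apply_apply (Units.mk0 (x : ℚ_[p]) x.2)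
  exact congrArg (fun u => ((μ u : Circle) : ℂ)) this

theorem norm_one_add {k : ℕ} (hk : 1 ≤ k) {e : ℚ_[p]} (he : e ∈ ball p (-k)) : ‖1 + e‖ = 1 := by
  have h1 : ‖e‖ < 1 := lt_of_le_of_lt he (zpow_lt_one_of_neg₀ one_lt_p (by omega))
  rw [IsUltrametricDist.norm_add_eq_max_of_norm_ne_norm (x := (1 : ℚ_[p])) (y := e)
    (by rw [norm_one]; exact h1.ne'), norm_one, max_eq_left h1.le]

theorem exists_ball_subset {s : Set ℚ_[p]} (hs : s ∈ nhds (0 : ℚ_[p])) :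
    ∃ k : ℕ, 1 ≤ k ∧ ball p (-k) ⊆ s := by
  obtain ⟨ε, hε, h⟩ := Metric.mem_nhds_iff.mp hs
  obtain ⟨k, hk⟩ := exists_pow_lt_of_lt_one hε (inv_lt_one_of_one_lt₀ (one_lt_p (p := p)))
  refine ⟨k + 1, by omega, fun x hx => h ?_⟩
  rw [mem_ball_zero_iff]
  refine lt_of_le_of_lt (ball_mono (by omega : (-((k + 1 : ℕ) : ℤ)) ≤ -(k : ℤ)) hx) ?_
  rwa [zpow_neg, zpow_natCast, ← inv_pow]

/-- A continuous character is trivial near one. -/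
theorem exists_conductor (hμ : Continuous μ) :
    ∃ k : ℕ, 1 ≤ k ∧ ∀ e ∈ ball p (-k), chr μ (1 + e) = 1 := by
  have hc : ContinuousAt (fun e : ℚ_[p] => chr μ (1 + e)) 0 := by
    have h1 : ContinuousAt (chr μ) (1 + 0) :=
      (continuousOn_chr μ hμ).continuousAt (isOpen_compl_singleton.mem_nhds (by simp))
    exact ContinuousAt.comp (f := fun e : ℚ_[p] => 1 + e) h1 (by fun_prop)
  have h2 : ∀ᶠ e in nhds (0 : ℚ_[p]), ‖chr μ (1 + e) - 1‖ < 1 / 2 := by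
    have h3 := (hc.sub_const 1).norm
    refine h3.eventually_lt_const ?_
    simp [chr_one]
  obtain ⟨k, hk, hsub⟩ := exists_ball_subset h2
  refine ⟨k, hk, fun e he => norm_sub_one_small fun n => ?_⟩
  -- The powers of 1 + e stay in 1 + p^k ℤ_p, hence all powers of the value of the character stay
  -- close to 1.
  have h4 : ∃ e' ∈ ball p (-k : ℤ), (1 + e) ^ n = 1 + e' := by
    induction n with
    | zero => exact ⟨0, zero_mem_ball _, by simp⟩
    | succ n ih =>
      obtain ⟨e', he', h⟩ := ih
      refine ⟨e' + (1 + e') * e, add_mem_ball he' ?_, by rw [pow_succ, h]; ring⟩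
      rw [mem_ball, norm_mul, norm_one_add hk he', one_mul]
      exact he
  obtain ⟨e', he', h⟩ := h4
  have h5 : chr μ (1 + e) ^ n = chr μ ((1 + e) ^ n) := by
    induction n with
    | zero => simp [chr_one]
    | succ n ih =>
      clear h
      have : ∀ m : ℕ, chr μ ((1 + e) ^ m) = chr μ (1 + e) ^ m := fun m => by
        induction m with
        | zero => simp [chr_one]
        | succ m ih => rw [pow_succ, chr_mul, ih, pow_succ]
      rw [this]
  rw [h5, h]
  exact hsub he'

/-- The quasi-character `μ |·| ^ τ`, extended by zero. -/
def qchr (τ : ℂ) (x : ℚ_[p]) : ℂ := chr μ x * (‖x‖ : ℂ) ^ τ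

theorem qchr_mul (τ : ℂ) (x y : ℚ_[p]) : qchr μ τ (x * y) = qchr μ τ x * qchr μ τ y := by
  unfold qchr
  rw [chr_mul, norm_mul, Complex.ofReal_mul, Complex.mul_cpow_ofReal_nonneg (norm_nonneg _)
    (norm_nonneg _)]
  ring

theorem qchr_one (τ : ℂ) : qchr μ τ 1 = 1 := by simp [qchr, chr_one]

theorem qchr_ne_zero (τ : ℂ) {x : ℚ_[p]} (h : x ≠ 0) : qchr μ τ x ≠ 0 := by
  have : (‖x‖ : ℂ) ≠ 0 := by simpa using h
  exact mul_ne_zero (chr_ne_zero μ h) (by simp [Complex.cpow_eq_zero_iff, this])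

theorem qchr_inv (τ : ℂ) {x : ℚ_[p]} (h : x ≠ 0) : qchr μ τ x⁻¹ = (qchr μ τ x)⁻¹ := by
  refine eq_inv_of_mul_eq_one_left ?_
  rw [← qchr_mul, inv_mul_cancel₀ h, qchr_one]

theorem norm_qchr (τ : ℂ) {x : ℚ_[p]} (h : x ≠ 0) : ‖qchr μ τ x‖ = ‖x‖ ^ τ.re := by
  rw [qchr, norm_mul, norm_chr μ h, one_mul, Complex.norm_cpow_eq_rpow_re_of_pos (by simpa using h)]

theorem qchr_one_add {k : ℕ} (hk : 1 ≤ k) (h : ∀ e ∈ ball p (-k), chr μ (1 + e) = 1) (τ : ℂ)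
    {e : ℚ_[p]} (he : e ∈ ball p (-k)) : qchr μ τ (1 + e) = 1 := by
  simp [qchr, h e he, norm_one_add hk he]

theorem continuousOn_qchr (hμ : Continuous μ) (τ : ℂ) : ContinuousOn (qchr μ τ) {0}ᶜ := by
  refine (continuousOn_chr μ hμ).mul ?_
  intro x hx
  refine ContinuousAt.continuousWithinAt ?_
  have h1 : ContinuousAt (fun x : ℚ_[p] => (‖x‖ : ℂ)) x := by fun_prop
  refine h1.cpow continuousAt_const (Complex.ofReal_mem_slitPlane.mpr ?_)
  simpa using hx

end Characters

/-! ### Commutation relations of root subgroups and Weyl elements, checked in GL₇. -/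

section Relations

variable {p : ℕ} [Fact p.Prime]

theorem G2_ext {g h : G2 p} (H : g.1.val = h.1.val) : g = h := Subtype.ext (Units.ext H)

theorem G2_mul_val (g h : G2 p) : (g * h).1.val = g.1.val * h.1.val := rfl

theorem xr_val (γ : Root) (u : ℚ_[p]) : (xr p γ u).1.val =
    1 + u • rootVec p γ + (u ^ 2 / 2) • rootVec p γ ^ 2 := rootGL_val p γ u

theorem rootVec_sq (γ : Root) :
    rootVec p γ ^ 2 = (rootVecZ γ ^ 2).map (Int.castRingHom ℚ_[p]) := by
  rw [rootVec, ← RingHom.mapMatrix_apply, ← map_pow, RingHom.mapMatrix_apply]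

theorem one_eq_lit : (1 : Matrix (Fin 7) (Fin 7) ℚ_[p]) =
    !![1, 0, 0, 0, 0, 0, 0; 0, 1, 0, 0, 0, 0, 0; 0, 0, 1, 0, 0, 0, 0;
      0, 0, 0, 1, 0, 0, 0; 0, 0, 0, 0, 1, 0, 0; 0, 0, 0, 0, 0, 1, 0; 0, 0, 0, 0, 0, 0, 1] := by
  ext i j
  fin_cases i <;> fin_cases j <;> rfl

theorem rootVecZ_sq_a : rootVecZ .a ^ 2 = !![0, 0, 0, 0, 0, 0, 0; 0, 0, 0, 0, 0, 0, 0;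
    0, 0, 0, 0, 0, 0, 0; 0, 0, 0, 0, 0, 0, 0; 0, 0, 2, 0, 0, 0, 0; 0, 0, 0, 0, 0, 0, 0;
    0, 0, 0, 0, 0, 0, 0] := by decide

theorem rootVecZ_sq_ab : rootVecZ .ab ^ 2 = !![0, 0, 0, 0, 0, 2, 0; 0, 0, 0, 0, 0, 0, 0;
    0, 0, 0, 0, 0, 0, 0; 0, 0, 0, 0, 0, 0, 0; 0, 0, 0, 0, 0, 0, 0; 0, 0, 0, 0, 0, 0, 0;
    0, 0, 0, 0, 0, 0, 0] := by decide

theorem rootVecZ_sq_a2b : rootVecZ .a2b ^ 2 = !![0, 0, 0, 0, 0, 0, 0; 0, 0, 0, 0, 0, 0, 2;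
    0, 0, 0, 0, 0, 0, 0; 0, 0, 0, 0, 0, 0, 0; 0, 0, 0, 0, 0, 0, 0; 0, 0, 0, 0, 0, 0, 0;
    0, 0, 0, 0, 0, 0, 0] := by decide

theorem rootVecZ_sq_long : rootVecZ .b ^ 2 = 0 ∧ rootVecZ .a3b ^ 2 = 0 ∧ rootVecZ .a3b2 ^ 2 = 0 := by
  refine ⟨?_, ?_, ?_⟩ <;> decide

theorem xr_a_val (u : ℚ_[p]) : (xr p .a u).1.val =
    !![1, 0, 0, 0, 0, 0, 0; -u, 1, 0, 0, 0, 0, 0; 0, 0, 1, 0, 0, 0, 0;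
      0, 0, -u, 1, 0, 0, 0; 0, 0, u ^ 2, -2 * u, 1, 0, 0; 0, 0, 0, 0, 0, 1, u;
      0, 0, 0, 0, 0, 0, 1] := by
  rw [xr_val, rootVec_sq, rootVecZ_sq_a, rootVec, rootVecZ, one_eq_lit]
  ext i j
  fin_cases i <;> fin_cases j <;> simp <;> ring

theorem xr_b_val (u : ℚ_[p]) : (xr p .b u).1.val =
    !![1, 0, 0, 0, -u, 0, 0; 0, 1, 0, 0, 0, 0, 0; 0, 0, 1, 0, 0, u, 0;
      0, 0, 0, 1, 0, 0, 0; 0, 0, 0, 0, 1, 0, 0; 0, 0, 0, 0, 0, 1, 0; 0, 0, 0, 0, 0, 0, 1] := by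
  rw [xr_val, rootVec_sq, rootVecZ_sq_long.1, rootVec, rootVecZ, one_eq_lit]
  ext i j
  fin_cases i <;> fin_cases j <;> simp

theorem xr_ab_val (u : ℚ_[p]) : (xr p .ab u).1.val =
    !![1, 0, 0, 2 * u, 0, u ^ 2, 0; 0, 1, 0, 0, -u, 0, 0; 0, 0, 1, 0, 0, 0, u;
      0, 0, 0, 1, 0, u, 0; 0, 0, 0, 0, 1, 0, 0; 0, 0, 0, 0, 0, 1, 0; 0, 0, 0, 0, 0, 0, 1] := by
  rw [xr_val, rootVec_sq, rootVecZ_sq_ab, rootVec, rootVecZ, one_eq_lit]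
  ext i j
  fin_cases i <;> fin_cases j <;> simp <;> ring

theorem xr_a2b_val (u : ℚ_[p]) : (xr p .a2b u).1.val =
    !![1, 0, -u, 0, 0, 0, 0; 0, 1, 0, 2 * u, 0, 0, u ^ 2; 0, 0, 1, 0, 0, 0, 0;
      0, 0, 0, 1, 0, 0, u; 0, 0, 0, 0, 1, u, 0; 0, 0, 0, 0, 0, 1, 0; 0, 0, 0, 0, 0, 0, 1] := by
  rw [xr_val, rootVec_sq, rootVecZ_sq_a2b, rootVec, rootVecZ, one_eq_lit]
  ext i j
  fin_cases i <;> fin_cases j <;> simp <;> ring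

theorem xr_a3b_val (u : ℚ_[p]) : (xr p .a3b u).1.val =
    !![1, 0, 0, 0, 0, 0, 0; 0, 1, -u, 0, 0, 0, 0; 0, 0, 1, 0, 0, 0, 0;
      0, 0, 0, 1, 0, 0, 0; 0, 0, 0, 0, 1, 0, u; 0, 0, 0, 0, 0, 1, 0; 0, 0, 0, 0, 0, 0, 1] := by
  rw [xr_val, rootVec_sq, rootVecZ_sq_long.2.1, rootVec, rootVecZ, one_eq_lit]
  ext i j
  fin_cases i <;> fin_cases j <;> simp

theorem xr_a3b2_val (u : ℚ_[p]) : (xr p .a3b2 u).1.val =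
    !![1, 0, 0, 0, 0, 0, -u; 0, 1, 0, 0, 0, u, 0; 0, 0, 1, 0, 0, 0, 0;
      0, 0, 0, 1, 0, 0, 0; 0, 0, 0, 0, 1, 0, 0; 0, 0, 0, 0, 0, 1, 0; 0, 0, 0, 0, 0, 0, 1] := by
  rw [xr_val, rootVec_sq, rootVecZ_sq_long.2.2, rootVec, rootVecZ, one_eq_lit]
  ext i j
  fin_cases i <;> fin_cases j <;> simp

theorem wα_val : (wα p).1.val =
    !![0, 1, 0, 0, 0, 0, 0; -1, 0, 0, 0, 0, 0, 0; 0, 0, 0, 0, 1, 0, 0;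
      0, 0, 0, -1, 0, 0, 0; 0, 0, 1, 0, 0, 0, 0; 0, 0, 0, 0, 0, 0, 1; 0, 0, 0, 0, 0, -1, 0] := by
  have : (wα p).1.val = mMat p !![0, -1; 1, 0] := rfl
  rw [this]
  simp [mMat]

theorem wβ_val : (wβ p).1.val =
    !![0, 0, 0, 0, 1, 0, 0; 0, 1, 0, 0, 0, 0, 0; 0, 0, 0, 0, 0, -1, 0;
      0, 0, 0, 1, 0, 0, 0; -1, 0, 0, 0, 0, 0, 0; 0, 0, 1, 0, 0, 0, 0; 0, 0, 0, 0, 0, 0, 1] := by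
  have : (wβ p).1.val = lMat p !![0, 1; -1, 0] := rfl
  rw [this]
  simp [lMat]

/-- Each commutator is written with the second factor moved to the left: the later arguments push
positive root subgroups to the far left, where sections of the principal series are invariant. All
are identities of 7 × 7 matrices with polynomial entries. -/
theorem root_relations (u c : ℚ_[p]) :
    (xr p .a u * xr p .a c = xr p .a (u + c)) ∧
    (xr p .b u * xr p .b c = xr p .b (u + c)) ∧
    (xr p .ab u * xr p .ab c = xr p .ab (u + c)) ∧
    (xr p .a2b u * xr p .a2b c = xr p .a2b (u + c)) ∧
    (xr p .a3b u * xr p .a3b c = xr p .a3b (u + c)) ∧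
    (xr p .a3b2 u * xr p .a3b2 c = xr p .a3b2 (u + c)) ∧
    (xr p .b u * xr p .a c = xr p .a c * (xr p .ab (c * u) * (xr p .a2b (c ^ 2 * u) *
      (xr p .a3b (c ^ 3 * u) * (xr p .a3b2 (2 * c ^ 3 * u ^ 2) * xr p .b u))))) ∧
    (xr p .b u * xr p .ab c = xr p .ab c * xr p .b u) ∧
    (xr p .b u * xr p .a2b c = xr p .a2b c * xr p .b u) ∧
    (xr p .b u * xr p .a3b c = xr p .a3b c * (xr p .a3b2 (c * u) * xr p .b u)) ∧
    (xr p .b u * xr p .a3b2 c = xr p .a3b2 c * xr p .b u) ∧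
    (xr p .a u * xr p .b c = xr p .b c * (xr p .ab (-(c * u)) * (xr p .a2b (c * u ^ 2) *
      (xr p .a3b (-(c * u ^ 3)) * (xr p .a3b2 (-(c ^ 2 * u ^ 3)) * xr p .a u))))) ∧
    (xr p .a u * xr p .ab c = xr p .ab c * (xr p .a2b (-(2 * c * u)) *
      (xr p .a3b (3 * c * u ^ 2) * (xr p .a3b2 (-(3 * c ^ 2 * u)) * xr p .a u)))) ∧
    (xr p .a u * xr p .a2b c = xr p .a2b c * (xr p .a3b (-(3 * c * u)) * xr p .a u)) ∧
    (xr p .a u * xr p .a3b c = xr p .a3b c * xr p .a u) ∧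
    (xr p .a u * xr p .a3b2 c = xr p .a3b2 c * xr p .a u) ∧
    (xr p .a2b u * xr p .ab c = xr p .ab c * (xr p .a2b u * xr p .a3b2 (3 * u * c))) := by
  refine ⟨?_, ?_, ?_, ?_, ?_, ?_, ?_, ?_, ?_, ?_, ?_, ?_, ?_, ?_, ?_, ?_, ?_⟩ <;>
  · apply G2_ext
    simp only [G2_mul_val, xr_a_val, xr_b_val, xr_ab_val, xr_a2b_val, xr_a3b_val, xr_a3b2_val,
      Matrix.cons_mul, Matrix.vecMul_cons, Matrix.head_cons, Matrix.tail_cons, zero_smul, one_smul,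
      zero_add, add_zero, Matrix.empty_mul, Matrix.smul_cons, smul_eq_mul, mul_zero, mul_one,
      Matrix.smul_empty, Matrix.empty_add_empty, Equiv.symm_apply_apply, Matrix.empty_vecMul,
      Matrix.cons_add_cons, EmbeddingLike.apply_eq_iff_eq, Matrix.vecCons_inj, and_true, true_and]
    try (and_intros <;> ring)

theorem weyl_relations (c : ℚ_[p]) :
    (wα p * xr p .b c = xr p .a3b (-c) * wα p) ∧
    (wα p * xr p .ab c = xr p .a2b c * wα p) ∧
    (wα p * xr p .a2b c = xr p .ab (-c) * wα p) ∧
    (wα p * xr p .a3b c = xr p .b c * wα p) ∧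
    (wα p * xr p .a3b2 c = xr p .a3b2 c * wα p) ∧
    (wβ p * xr p .a c = xr p .ab (-c) * wβ p) ∧
    (wβ p * xr p .ab c = xr p .a c * wβ p) ∧
    (wβ p * xr p .a2b c = xr p .a2b c * wβ p) ∧
    (wβ p * xr p .a3b c = xr p .a3b2 (-c) * wβ p) ∧
    (wβ p * xr p .a3b2 c = xr p .a3b c * wβ p) := by
  refine ⟨?_, ?_, ?_, ?_, ?_, ?_, ?_, ?_, ?_, ?_⟩ <;>
  · apply G2_ext
    simp only [G2_mul_val, xr_a_val, xr_b_val, xr_ab_val, xr_a2b_val, xr_a3b_val, xr_a3b2_val,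
      wα_val, wβ_val,
      Matrix.cons_mul, Matrix.vecMul_cons, Matrix.head_cons, Matrix.tail_cons, zero_smul, one_smul,
      zero_add, add_zero, Matrix.empty_mul, Matrix.smul_cons, smul_eq_mul, mul_zero, mul_one,
      Matrix.smul_empty, Matrix.empty_add_empty, Equiv.symm_apply_apply, Matrix.empty_vecMul,
      Matrix.cons_add_cons, EmbeddingLike.apply_eq_iff_eq, Matrix.vecCons_inj, and_true, true_and]
    try (and_intros <;> ring)

end Relations

/-! ### The two Levi subgroups, their common torus, and words in simple reflections. -/

section Levi

variable {p : ℕ} [Fact p.Prime]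

theorem mG_mul (A B : GL (Fin 2) ℚ_[p]) : mG p (A * B) = mG p A * mG p B :=
  Subtype.ext (map_mul (mGL p) A B)

theorem lG_mul (A B : GL (Fin 2) ℚ_[p]) : lG p (A * B) = lG p A * lG p B :=
  Subtype.ext (map_mul (lGL p) A B)

theorem mG_one : mG p 1 = 1 := Subtype.ext (map_one (mGL p))

theorem lG_one : lG p 1 = 1 := Subtype.ext (map_one (lGL p))

theorem mG_val (A : GL (Fin 2) ℚ_[p]) : (mG p A).1.val = mMat p A.val := rfl

theorem lG_val (A : GL (Fin 2) ℚ_[p]) : (lG p A).1.val = lMat p A.val := rfl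

/-- Diagonal matrices. -/
def diagGL (a d : ℚ_[p]ˣ) : GL (Fin 2) ℚ_[p] where
  val := !![(a : ℚ_[p]), 0; 0, (d : ℚ_[p])]
  inv := !![((a⁻¹ : ℚ_[p]ˣ) : ℚ_[p]), 0; 0, ((d⁻¹ : ℚ_[p]ˣ) : ℚ_[p])]
  val_inv := by simp [Matrix.one_fin_two]
  inv_val := by simp [Matrix.one_fin_two]

/-- Upper triangular unipotent matrices. -/
def upGL (c : ℚ_[p]) : GL (Fin 2) ℚ_[p] where
  val := !![1, c; 0, 1]
  inv := !![1, -c; 0, 1]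
  val_inv := by simp [Matrix.one_fin_two]
  inv_val := by simp [Matrix.one_fin_two]

/-- Lower triangular unipotent matrices. -/
def lowGL (c : ℚ_[p]) : GL (Fin 2) ℚ_[p] where
  val := !![1, 0; c, 1]
  inv := !![1, 0; -c, 1]
  val_inv := by simp [Matrix.one_fin_two]
  inv_val := by simp [Matrix.one_fin_two]

theorem xr_a_eq (u : ℚ_[p]) : xr p .a u = mG p (upGL (-u)) := by
  apply G2_ext
  rw [xr_a_val, mG_val]
  simp [mMat, upGL]

theorem xr_b_eq (u : ℚ_[p]) : xr p .b u = lG p (upGL (-u)) := by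
  apply G2_ext
  rw [xr_b_val, lG_val]
  simp [lMat, upGL]

theorem wαMat_val : ((wαMat p : Matrix.SpecialLinearGroup (Fin 2) ℚ_[p]) : Matrix (Fin 2) (Fin 2) ℚ_[p]) =
    !![0, -1; 1, 0] := rfl

theorem wβMat_val : ((wβMat p : Matrix.SpecialLinearGroup (Fin 2) ℚ_[p]) : Matrix (Fin 2) (Fin 2) ℚ_[p]) =
    !![0, 1; -1, 0] := rfl

/-- The torus of `G₂`. -/
def hT (a d : ℚ_[p]ˣ) : G2 p := mG p (diagGL a d)

/-- The two Levi subgroups share the maximal torus; with this all torus elements can be written as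
`hT`. -/
theorem lG_diag (a d : ℚ_[p]ˣ) : lG p (diagGL a d) = hT (a * d) a := by
  apply G2_ext
  rw [hT, lG_val, mG_val]
  have ha := a.ne_zero
  have hd := d.ne_zero
  simp [lMat, mMat, diagGL]
  and_intros <;> field_simp

theorem hT_eq_lG (a d : ℚ_[p]ˣ) : hT a d = lG p (diagGL d (a * d⁻¹)) := by
  rw [lG_diag]
  congr 1
  rw [mul_comm a, mul_inv_cancel_left]

/-- The lower triangular one-parameter group of the Levi factor `M`. -/
def lowA (c : ℚ_[p]) : G2 p := mG p (lowGL c)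

/-- The lower triangular one-parameter group of the Levi factor `L`. -/
def lowB (c : ℚ_[p]) : G2 p := lG p (lowGL c)

theorem wα_eq : wα p = mG p (wαMat p) := rfl

theorem wβ_eq : wβ p = lG p (wβMat p) := rfl

theorem xr_a_mul_hT (v : ℚ_[p]) (a d : ℚ_[p]ˣ) :
    xr p .a v * hT a d = hT a d * xr p .a (v * d * (a : ℚ_[p])⁻¹) := by
  have ha := a.ne_zero
  rw [xr_a_eq, xr_a_eq, hT, ← mG_mul, ← mG_mul]
  congr 1
  ext i j
  fin_cases i <;> fin_cases j <;> simp [diagGL, upGL]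
  field_simp

theorem xr_b_mul_hT (v : ℚ_[p]) (a d : ℚ_[p]ˣ) :
    xr p .b v * hT a d = hT a d * xr p .b (v * a * ((d : ℚ_[p]) ^ 2)⁻¹) := by
  have hd := d.ne_zero
  rw [xr_b_eq, xr_b_eq, hT_eq_lG, ← lG_mul, ← lG_mul]
  congr 1
  ext i j
  fin_cases i <;> fin_cases j <;> simp [diagGL, upGL]
  field_simp

theorem wα_mul_hT (a d : ℚ_[p]ˣ) : wα p * hT a d = hT d a * wα p := by
  rw [wα_eq, hT, hT, ← mG_mul, ← mG_mul]
  congr 1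
  ext i j
  fin_cases i <;> fin_cases j <;> simp [diagGL, wαMat_val]

theorem wβ_mul_hT (a d : ℚ_[p]ˣ) : wβ p * hT a d = hT a (a * d⁻¹) * wβ p := by
  rw [wβ_eq, hT_eq_lG, hT_eq_lG, ← lG_mul, ← lG_mul]
  congr 1
  have ha := a.ne_zero
  have hd := d.ne_zero
  ext i j
  fin_cases i <;> fin_cases j <;> simp [diagGL, wβMat_val]

/-- The Bruhat relation in GL₂. As v tends to infinity the lower triangular factor tends to one and
is absorbed by right smoothness, which leaves the torus factor as the asymptotics of the rank one
integrand. -/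
theorem wα_mul_xr (v : ℚ_[p]ˣ) : wα p * xr p .a v =
    xr p .a (-(v : ℚ_[p])⁻¹) * (hT (-v⁻¹) (-v) * lowA (-(v : ℚ_[p])⁻¹)) := by
  rw [wα_eq, xr_a_eq, xr_a_eq, hT, lowA, ← mG_mul, ← mG_mul, ← mG_mul]
  congr 1
  have hv := v.ne_zero
  ext i j
  fin_cases i <;> fin_cases j <;> simp [diagGL, upGL, lowGL, wαMat_val, hv]

theorem wβ_mul_xr (u : ℚ_[p]ˣ) : wβ p * xr p .b u =
    xr p .b (-(u : ℚ_[p])⁻¹) * (hT 1 u⁻¹ * lowB (-(u : ℚ_[p])⁻¹)) := by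
  rw [wβ_eq, xr_b_eq, xr_b_eq, hT_eq_lG, lowB, ← lG_mul, ← lG_mul, ← lG_mul]
  congr 1
  have hu := u.ne_zero
  ext i j
  fin_cases i <;> fin_cases j <;> simp [diagGL, upGL, lowGL, wβMat_val, hu]

/-! ### Commutation relations under further multiplication on the right -/

theorem mul_of_eq {G : Type*} [Group G] {a b c : G} (h : a * b = c) (g : G) : a * (b * g) = c * g := by
  rw [← mul_assoc, h]

/-- Left invariance under the positive root subgroups. -/
structure UInv {E : Type*} (f : G2 p → E) : Prop where
  a : ∀ c g, f (xr p .a c * g) = f g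
  b : ∀ c g, f (xr p .b c * g) = f g
  ab : ∀ c g, f (xr p .ab c * g) = f g
  a2b : ∀ c g, f (xr p .a2b c * g) = f g
  a3b : ∀ c g, f (xr p .a3b c * g) = f g
  a3b2 : ∀ c g, f (xr p .a3b2 c * g) = f g

section

variable (u c : ℚ_[p]) (g : G2 p)

theorem aa : xr p .a u * (xr p .a c * g) = xr p .a (u + c) * g :=
  mul_of_eq (root_relations u c).1 g

theorem bb : xr p .b u * (xr p .b c * g) = xr p .b (u + c) * g :=
  mul_of_eq (root_relations u c).2.1 g

theorem b_a : xr p .b u * (xr p .a c * g) = xr p .a c * (xr p .ab (c * u) * (xr p .a2b (c ^ 2 * u) *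
      (xr p .a3b (c ^ 3 * u) * (xr p .a3b2 (2 * c ^ 3 * u ^ 2) * (xr p .b u * g))))) := by
  simpa only [mul_assoc] using mul_of_eq (root_relations u c).2.2.2.2.2.2.1 g

theorem b_ab : xr p .b u * (xr p .ab c * g) = xr p .ab c * (xr p .b u * g) := by
  simpa only [mul_assoc] using mul_of_eq (root_relations u c).2.2.2.2.2.2.2.1 g

theorem b_a2b : xr p .b u * (xr p .a2b c * g) = xr p .a2b c * (xr p .b u * g) := by
  simpa only [mul_assoc] using mul_of_eq (root_relations u c).2.2.2.2.2.2.2.2.1 g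

theorem b_a3b : xr p .b u * (xr p .a3b c * g) =
    xr p .a3b c * (xr p .a3b2 (c * u) * (xr p .b u * g)) := by
  simpa only [mul_assoc] using mul_of_eq (root_relations u c).2.2.2.2.2.2.2.2.2.1 g

theorem b_a3b2 : xr p .b u * (xr p .a3b2 c * g) = xr p .a3b2 c * (xr p .b u * g) := by
  simpa only [mul_assoc] using mul_of_eq (root_relations u c).2.2.2.2.2.2.2.2.2.2.1 g

theorem a_b : xr p .a u * (xr p .b c * g) = xr p .b c * (xr p .ab (-(c * u)) *
    (xr p .a2b (c * u ^ 2) * (xr p .a3b (-(c * u ^ 3)) * (xr p .a3b2 (-(c ^ 2 * u ^ 3)) *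
      (xr p .a u * g))))) := by
  simpa only [mul_assoc] using mul_of_eq (root_relations u c).2.2.2.2.2.2.2.2.2.2.2.1 g

theorem a_ab : xr p .a u * (xr p .ab c * g) = xr p .ab c * (xr p .a2b (-(2 * c * u)) *
      (xr p .a3b (3 * c * u ^ 2) * (xr p .a3b2 (-(3 * c ^ 2 * u)) * (xr p .a u * g)))) := by
  simpa only [mul_assoc] using mul_of_eq (root_relations u c).2.2.2.2.2.2.2.2.2.2.2.2.1 g

theorem a_a2b : xr p .a u * (xr p .a2b c * g) =
    xr p .a2b c * (xr p .a3b (-(3 * c * u)) * (xr p .a u * g)) := by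
  simpa only [mul_assoc] using mul_of_eq (root_relations u c).2.2.2.2.2.2.2.2.2.2.2.2.2.1 g

theorem a_a3b : xr p .a u * (xr p .a3b c * g) = xr p .a3b c * (xr p .a u * g) := by
  simpa only [mul_assoc] using mul_of_eq (root_relations u c).2.2.2.2.2.2.2.2.2.2.2.2.2.2.1 g

theorem a_a3b2 : xr p .a u * (xr p .a3b2 c * g) = xr p .a3b2 c * (xr p .a u * g) := by
  simpa only [mul_assoc] using mul_of_eq (root_relations u c).2.2.2.2.2.2.2.2.2.2.2.2.2.2.2.1 g

theorem wα_b : wα p * (xr p .b c * g) = xr p .a3b (-c) * (wα p * g) := by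
  simpa only [mul_assoc] using mul_of_eq (weyl_relations c).1 g

theorem wα_ab : wα p * (xr p .ab c * g) = xr p .a2b c * (wα p * g) := by
  simpa only [mul_assoc] using mul_of_eq (weyl_relations c).2.1 g

theorem wα_a2b : wα p * (xr p .a2b c * g) = xr p .ab (-c) * (wα p * g) := by
  simpa only [mul_assoc] using mul_of_eq (weyl_relations c).2.2.1 g

theorem wα_a3b : wα p * (xr p .a3b c * g) = xr p .b c * (wα p * g) := by
  simpa only [mul_assoc] using mul_of_eq (weyl_relations c).2.2.2.1 g

theorem wα_a3b2 : wα p * (xr p .a3b2 c * g) = xr p .a3b2 c * (wα p * g) := by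
  simpa only [mul_assoc] using mul_of_eq (weyl_relations c).2.2.2.2.1 g

theorem wβ_a : wβ p * (xr p .a c * g) = xr p .ab (-c) * (wβ p * g) := by
  simpa only [mul_assoc] using mul_of_eq (weyl_relations c).2.2.2.2.2.1 g

theorem wβ_ab : wβ p * (xr p .ab c * g) = xr p .a c * (wβ p * g) := by
  simpa only [mul_assoc] using mul_of_eq (weyl_relations c).2.2.2.2.2.2.1 g

theorem wβ_a2b : wβ p * (xr p .a2b c * g) = xr p .a2b c * (wβ p * g) := by
  simpa only [mul_assoc] using mul_of_eq (weyl_relations c).2.2.2.2.2.2.2.1 g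

theorem wβ_a3b : wβ p * (xr p .a3b c * g) = xr p .a3b2 (-c) * (wβ p * g) := by
  simpa only [mul_assoc] using mul_of_eq (weyl_relations c).2.2.2.2.2.2.2.2.1 g

theorem wβ_a3b2 : wβ p * (xr p .a3b2 c * g) = xr p .a3b c * (wβ p * g) := by
  simpa only [mul_assoc] using mul_of_eq (weyl_relations c).2.2.2.2.2.2.2.2.2 g

theorem wα_xa_hT (a d : ℚ_[p]ˣ) : wα p * (xr p .a u * (hT a d * g)) =
    hT d a * (wα p * (xr p .a (u * d * (a : ℚ_[p])⁻¹) * g)) := by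
  rw [mul_of_eq (xr_a_mul_hT u a d), mul_assoc, mul_of_eq (wα_mul_hT a d), mul_assoc]

theorem wβ_xb_hT (a d : ℚ_[p]ˣ) : wβ p * (xr p .b u * (hT a d * g)) =
    hT a (a * d⁻¹) * (wβ p * (xr p .b (u * a * ((d : ℚ_[p]) ^ 2)⁻¹) * g)) := by
  rw [mul_of_eq (xr_b_mul_hT u a d), mul_assoc, mul_of_eq (wβ_mul_hT a d), mul_assoc]

end

/-- These root subgroups generate the unipotent radical of the maximal parabolic subgroup with Levi
factor L; it is normalized by w_β x_β(u), so a factor from it can be moved to the left. Hence rank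
one integrals stay left invariant. -/
theorem UInv.wβ_xb {E : Type*} {f : G2 p → E} (hf : UInv f) (u c : ℚ_[p]) (g : G2 p) :
    f (wβ p * (xr p .b u * (xr p .a c * g))) = f (wβ p * (xr p .b u * g)) ∧
    f (wβ p * (xr p .b u * (xr p .ab c * g))) = f (wβ p * (xr p .b u * g)) ∧
    f (wβ p * (xr p .b u * (xr p .a2b c * g))) = f (wβ p * (xr p .b u * g)) ∧
    f (wβ p * (xr p .b u * (xr p .a3b c * g))) = f (wβ p * (xr p .b u * g)) ∧
    f (wβ p * (xr p .b u * (xr p .a3b2 c * g))) = f (wβ p * (xr p .b u * g)) := by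
  simp only [b_a, b_ab, b_a2b, b_a3b, b_a3b2, wβ_a, wβ_ab, wβ_a2b, wβ_a3b, wβ_a3b2, hf.a, hf.ab,
    hf.a2b, hf.a3b, hf.a3b2, and_self]

theorem UInv.wα_xa {E : Type*} {f : G2 p → E} (hf : UInv f) (u c : ℚ_[p]) (g : G2 p) :
    f (wα p * (xr p .a u * (xr p .b c * g))) = f (wα p * (xr p .a u * g)) ∧
    f (wα p * (xr p .a u * (xr p .ab c * g))) = f (wα p * (xr p .a u * g)) ∧
    f (wα p * (xr p .a u * (xr p .a2b c * g))) = f (wα p * (xr p .a u * g)) ∧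
    f (wα p * (xr p .a u * (xr p .a3b c * g))) = f (wα p * (xr p .a u * g)) ∧
    f (wα p * (xr p .a u * (xr p .a3b2 c * g))) = f (wα p * (xr p .a u * g)) := by
  simp only [a_b, a_ab, a_a2b, a_a3b, a_a3b2, wα_b, wα_ab, wα_a2b, wα_a3b, wα_a3b2, hf.b, hf.ab,
    hf.a2b, hf.a3b, hf.a3b2, and_self]

/-- Conjugation by w_α carries this to the commutation of the root subgroups of β and α + β. -/
theorem a3b_a2b (u c : ℚ_[p]) (g : G2 p) :
    xr p .a3b u * (xr p .a2b c * g) = xr p .a2b c * (xr p .a3b u * g) := by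
  obtain ⟨h, rfl⟩ : ∃ h, g = wα p * h := ⟨_, (mul_inv_cancel_left _ _).symm⟩
  rw [← wα_ab, ← neg_neg u, ← wα_b, b_ab, wα_ab, wα_b]

theorem a3b_a3b2 (u c : ℚ_[p]) (g : G2 p) :
    xr p .a3b u * (xr p .a3b2 c * g) = xr p .a3b2 c * (xr p .a3b u * g) := by
  obtain ⟨h, rfl⟩ : ∃ h, g = wα p * h := ⟨_, (mul_inv_cancel_left _ _).symm⟩
  rw [← wα_a3b2, ← neg_neg u, ← wα_b, b_a3b2, wα_a3b2, wα_b]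

/-- The longest of the words met below, in terms of the coordinates of its root factors. -/
def word (c₁ c₂ c₃ c₄ : ℚ_[p]) (g : G2 p) : G2 p :=
  wβ p * (xr p .b c₁ * (wα p * (xr p .a c₂ * (wβ p * (xr p .b c₃ * (wα p * (xr p .a c₄ * g)))))))

theorem xr_zero (γ : Root) : xr p γ 0 = 1 := by
  apply G2_ext
  rw [xr_val]
  simp

/-- The last letter of ι cancels w_β. Each root factor then moves left through the word to the place
where its root has become simple; this parametrizes the domain of β_S by four rank one variables. -/
theorem iota_wβ_zU_vG (z₁ z₂ y z : ℚ_[p]) (g : G2 p) :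
    iota p * wβ p * zU p z₁ z₂ * vG p y 0 z * g = word z₂ (-z) (z₁ - 3 * y * z) y g := by
  -- Moving x_α(y) past x_{2α+β}(z) is the source of the quadratic shift -3yz in the third
  -- coordinate.
  have h1 : xr p .a y * (xr p .a2b z * g) =
      xr p .a2b z * (xr p .a3b (-(3 * z * y)) * (xr p .a y * g)) := a_a2b _ _ _
  simp only [iota, zU, vG, mul_assoc, xr_zero, one_mul, inv_mul_cancel_left, mul_zero, add_zero, word]
  rw [h1]
  have h33 : ∀ γ : G2 p, xr p .a3b z₁ * (xr p .a3b (-(3 * z * y)) * γ) =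
      xr p .a3b (z₁ - 3 * y * z) * γ := fun γ => by
    rw [mul_of_eq (root_relations _ _).2.2.2.2.1]; congr 2; ring
  rw [a3b_a3b2, a3b_a2b, h33, wα_a3b2, wα_a2b, wα_a3b, wβ_a3b2, wβ_ab, wα_a3b, mul_assoc]

end Levi

/-! ### The five-letter word as coordinates on the open cell ιN. -/

section BigCell

variable {p : ℕ} [Fact p.Prime]

theorem nG_reorder (c₁ c₂ c₃ c₄ c₅ : ℚ_[p]) :
    xr p .a3b2 (c₃ - 3 * c₂ * c₄) * xr p .a3b (-c₁) * xr p .ab c₄ * xr p .a2b (-c₂) * xr p .b c₅ =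
      nG p ![c₅, c₄, -c₂, -c₁, -3 * c₂ * c₄ + c₃ + c₁ * c₅] := by
  rw [nG]
  apply G2_ext
  simp only [G2_mul_val, xr_b_val, xr_ab_val, xr_a2b_val, xr_a3b_val, xr_a3b2_val,
    Matrix.cons_mul, Matrix.vecMul_cons, Matrix.head_cons, Matrix.tail_cons, zero_smul, one_smul,
    zero_add, add_zero, Matrix.empty_mul, Matrix.smul_cons, smul_eq_mul, mul_zero, mul_one,
    Matrix.smul_empty, Matrix.empty_add_empty, Equiv.symm_apply_apply, Matrix.empty_vecMul,
    Matrix.cons_add_cons, EmbeddingLike.apply_eq_iff_eq, Matrix.vecCons_inj, and_true, true_and,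
    Matrix.cons_val]
  and_intros <;> ring

theorem wβ_sq : wβ p * wβ p = hT 1 (-1) := by
  rw [wβ_eq, hT_eq_lG, ← lG_mul]
  congr 1
  ext i j
  fin_cases i <;> fin_cases j <;> simp [diagGL, wβMat_val]

/-- Carried through ι, the involution w_β² becomes a torus element of M of determinant -1. This is
where μ(-1) arises. -/
theorem iota_wβ_sq : iota p * (wβ p * wβ p) = hT (-1) 1 * iota p := by
  have h : ∀ g : G2 p, iota p * g = wβ p * (wα p * (wβ p * (wα p * ((wβ p)⁻¹ * g)))) := fun g => by
    simp [iota, mul_assoc]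
  have h2 : (wβ p)⁻¹ * (hT 1 (-1)) = hT 1 (-1) * (wβ p)⁻¹ := by
    rw [inv_mul_eq_iff_eq_mul, ← mul_assoc, wβ_mul_hT, mul_assoc, mul_inv_cancel, mul_one]
    simp
  rw [h, wβ_sq, h2, mul_of_eq (wα_mul_hT _ _), mul_assoc, mul_of_eq (wβ_mul_hT _ _), mul_assoc,
    mul_of_eq (wα_mul_hT _ _), mul_assoc, mul_of_eq (wβ_mul_hT _ _), mul_assoc]
  simp [iota, mul_assoc]

/-- Evaluating the four-letter word at w_β x_β(c₅) fills out the open cell: the Whittaker variable b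
of SL₂ becomes the fifth coordinate on N. This links β_S to the Jacquet integral. -/
theorem word_wβ (c₁ c₂ c₃ c₄ c₅ : ℚ_[p]) (g : G2 p) :
    word c₁ c₂ c₃ c₄ (wβ p * (xr p .b c₅ * g)) = hT (-1) 1 * (iota p *
      (nG p ![c₅, c₄, -c₂, -c₁, -3 * c₂ * c₄ + c₃ + c₁ * c₅] * g)) := by
  have h := iota_wβ_zU_vG (c₃ - 3 * c₂ * c₄) c₁ c₄ (-c₂) (wβ p * (xr p .b c₅ * g))
  rw [show c₃ - 3 * c₂ * c₄ - 3 * c₄ * -c₂ = c₃ by ring, neg_neg] at h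
  rw [← h, ← nG_reorder]
  have e1 : ∀ c h, xr p .a c * (wβ p * h) = wβ p * (xr p .ab c * h) := fun c h => (wβ_ab c h).symm
  have e2 : ∀ c h, xr p .a2b c * (wβ p * h) = wβ p * (xr p .a2b c * h) := fun c h => (wβ_a2b c h).symm
  have e3 : ∀ c h, xr p .a3b c * (wβ p * h) = wβ p * (xr p .a3b2 c * h) := fun c h =>
    (wβ_a3b2 c h).symm
  have e4 : ∀ c h, xr p .a3b2 c * (wβ p * h) = wβ p * (xr p .a3b (-c) * h) := fun c h => by
    rw [wβ_a3b, neg_neg]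
  simp only [zU, vG, xr_zero, mul_one, mul_zero, add_zero, mul_assoc, e1, e2, e3, e4]
  have h2 : ∀ k : G2 p, iota p * (wβ p * (wβ p * k)) = hT (-1) 1 * (iota p * k) := fun k => by
    rw [← mul_assoc (wβ p), ← mul_assoc, iota_wβ_sq, mul_assoc]
  rw [h2]

end BigCell

/-! ### Continuity of the one-parameter groups and smoothness radii. -/

section Topology

variable {p : ℕ} [Fact p.Prime]

theorem continuous_xr (γ : Root) : Continuous (xr p γ) := by
  refine Continuous.subtype_mk (Units.continuous_iff.mpr ⟨?_, ?_⟩) _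
  · have : (Units.val ∘ fun u => rootGL p γ u) =
        fun u => 1 + u • rootVec p γ + (u ^ 2 / 2) • rootVec p γ ^ 2 := funext fun u => rootGL_val p γ u
    rw [this]
    fun_prop
  · have : (fun u => ((rootGL p γ u)⁻¹).val) =
        fun u => 1 + (-u) • rootVec p γ + ((-u) ^ 2 / 2) • rootVec p γ ^ 2 := funext fun u => by
      rw [← rootGL_val]
      change IsNilpotent.exp (-(u • rootVec p γ)) = IsNilpotent.exp ((-u) • rootVec p γ)
      rw [neg_smul]
    change Continuous (fun u => ((rootGL p γ u)⁻¹).val)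
    rw [this]
    fun_prop

theorem continuous_det_inv :
    Continuous fun A : GL (Fin 2) ℚ_[p] => ((A : Matrix (Fin 2) (Fin 2) ℚ_[p]).det)⁻¹ := by
  refine Continuous.inv₀ (Units.continuous_val.matrix_det) fun A => ?_
  exact (Matrix.GeneralLinearGroup.det A).ne_zero

theorem continuous_entry (i j : Fin 2) :
    Continuous fun A : GL (Fin 2) ℚ_[p] => (A : Matrix (Fin 2) (Fin 2) ℚ_[p]) i j :=
  Units.continuous_val.matrix_elem i j

theorem continuous_mGL : Continuous (mGL p) := by
  have h0 : Continuous fun A : GL (Fin 2) ℚ_[p] => mMat p A.val := by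
    have hd := continuous_det_inv (p := p)
    have h00 := continuous_entry (p := p) 0 0
    have h01 := continuous_entry (p := p) 0 1
    have h10 := continuous_entry (p := p) 1 0
    have h11 := continuous_entry (p := p) 1 1
    refine continuous_matrix fun i j => ?_
    fin_cases i <;> fin_cases j <;> simp [mMat] <;> fun_prop
  refine Units.continuous_iff.mpr ⟨h0, ?_⟩
  have h1 : (fun A => ((mGL p A)⁻¹).val) = (fun A => mMat p A.val) ∘ fun A : GL (Fin 2) ℚ_[p] => A⁻¹ :=
    funext fun A => by rw [← map_inv]; rfl
  change Continuous (fun A => ((mGL p A)⁻¹).val)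
  rw [h1]
  exact h0.comp continuous_inv

theorem continuous_lGL : Continuous (lGL p) := by
  have h0 : Continuous fun A : GL (Fin 2) ℚ_[p] => lMat p A.val := by
    have hd := continuous_det_inv (p := p)
    have hd' : Continuous fun A : GL (Fin 2) ℚ_[p] => (A : Matrix (Fin 2) (Fin 2) ℚ_[p]).det :=
      Units.continuous_val.matrix_det
    have h00 := continuous_entry (p := p) 0 0
    have h01 := continuous_entry (p := p) 0 1
    have h10 := continuous_entry (p := p) 1 0
    have h11 := continuous_entry (p := p) 1 1
    refine continuous_matrix fun i j => ?_
    fin_cases i <;> fin_cases j <;> simp [lMat] <;> fun_prop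
  refine Units.continuous_iff.mpr ⟨h0, ?_⟩
  have h1 : (fun A => ((lGL p A)⁻¹).val) = (fun A => lMat p A.val) ∘ fun A : GL (Fin 2) ℚ_[p] => A⁻¹ :=
    funext fun A => by rw [← map_inv]; rfl
  change Continuous (fun A => ((lGL p A)⁻¹).val)
  rw [h1]
  exact h0.comp continuous_inv

theorem continuous_mG : Continuous (mG p) := Continuous.subtype_mk continuous_mGL _

theorem continuous_lG : Continuous (lG p) := Continuous.subtype_mk continuous_lGL _

theorem continuous_lowGL : Continuous (lowGL (p := p)) := by
  refine Units.continuous_iff.mpr ⟨?_, ?_⟩ <;> refine continuous_matrix fun i j => ?_ <;>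
    fin_cases i <;> fin_cases j <;> simp [lowGL] <;> fun_prop

theorem continuous_lowA : Continuous (lowA (p := p)) := continuous_mG.comp continuous_lowGL

theorem continuous_lowB : Continuous (lowB (p := p)) := continuous_lG.comp continuous_lowGL

theorem lowA_zero : lowA (0 : ℚ_[p]) = 1 := by
  have : lowGL (0 : ℚ_[p]) = 1 := by ext i j; fin_cases i <;> fin_cases j <;> simp [lowGL]
  rw [lowA, this, mG_one]

theorem lowB_zero : lowB (0 : ℚ_[p]) = 1 := by
  have : lowGL (0 : ℚ_[p]) = 1 := by ext i j; fin_cases i <;> fin_cases j <;> simp [lowGL]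
  rw [lowB, this, lG_one]

theorem continuous_hT_one : Continuous fun u : ℚ_[p]ˣ => hT 1 u := by
  refine continuous_mG.comp ?_
  have h1 : Continuous fun u : ℚ_[p]ˣ => (u : ℚ_[p]) := Units.continuous_val
  have h2 : Continuous fun u : ℚ_[p]ˣ => ((u⁻¹ : ℚ_[p]ˣ) : ℚ_[p]) := Units.continuous_val.comp continuous_inv
  refine Units.continuous_iff.mpr ⟨?_, ?_⟩ <;> refine continuous_matrix fun i j => ?_ <;>
    fin_cases i <;> fin_cases j <;> simp [diagGL] <;> first | exact continuous_const | exact h1 | simpa using h2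

/-- A factor κ(e) standing to the left of g equals g times its conjugate, which lies in K for small
e. This is how right invariance makes the integrands locally constant; see `right_absorb`. -/
theorem exists_conj_mem {κ : ℚ_[p] → G2 p} (hκ : Continuous κ) (h0 : κ 0 = 1)
    {K : Subgroup (G2 p)} (hK : IsOpen (K : Set (G2 p))) (g : G2 p) :
    ∃ k : ℕ, 1 ≤ k ∧ ∀ e ∈ ball p (-k), g⁻¹ * κ e * g ∈ K := by
  have h1 : Continuous fun e => g⁻¹ * κ e * g := (continuous_const.mul hκ).mul continuous_const
  have h2 : (fun e => g⁻¹ * κ e * g) ⁻¹' (K : Set (G2 p)) ∈ nhds (0 : ℚ_[p]) :=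
    h1.continuousAt.preimage_mem_nhds (hK.mem_nhds (by simp [h0, one_mem]))
  obtain ⟨k, hk, hsub⟩ := exists_ball_subset h2
  exact ⟨k, hk, fun e he => hsub he⟩

theorem exists_conj_hT_mem {K : Subgroup (G2 p)} (hK : IsOpen (K : Set (G2 p))) (g : G2 p) :
    ∃ k : ℕ, 1 ≤ k ∧ ∀ u : ℚ_[p]ˣ, (u : ℚ_[p]) - 1 ∈ ball p (-k) → g⁻¹ * hT 1 u * g ∈ K := by
  have h1 : Continuous fun u : ℚ_[p]ˣ => g⁻¹ * hT 1 u * g :=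
    (continuous_const.mul continuous_hT_one).mul continuous_const
  have hone : hT (1 : ℚ_[p]ˣ) 1 = 1 := by
    have : diagGL (1 : ℚ_[p]ˣ) 1 = 1 := by ext i j; fin_cases i <;> fin_cases j <;> simp [diagGL]
    rw [hT, this, mG_one]
  have h2 : (fun u : ℚ_[p]ˣ => g⁻¹ * hT 1 u * g) ⁻¹' (K : Set (G2 p)) ∈ nhds (1 : ℚ_[p]ˣ) :=
    h1.continuousAt.preimage_mem_nhds (hK.mem_nhds (by simp [hone, one_mem]))
  -- The topology of ℚ_pˣ is induced from ℚ_p, so a neighbourhood of one contains some 1 + p^k ℤ_p.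
  rw [Units.isEmbedding_val₀.nhds_eq_comap] at h2
  obtain ⟨s, hs, hsub⟩ := h2
  have h3 : (fun e : ℚ_[p] => 1 + e) ⁻¹' s ∈ nhds (0 : ℚ_[p]) := by
    have : Continuous fun e : ℚ_[p] => 1 + e := by fun_prop
    exact this.continuousAt.preimage_mem_nhds (by simpa using hs)
  obtain ⟨k, hk, hsub2⟩ := exists_ball_subset h3
  refine ⟨k, hk, fun u hu => hsub ?_⟩
  have := hsub2 hu
  simpa using this

end Topology

/-! ### The height: invariance under G₂(ℤ_p) and behaviour under the Heisenberg parabolic. -/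

section Height

variable {p : ℕ} [Fact p.Prime]

/-- The two by two minors of the last two rows. -/
def minor (g : G2 p) (ij : Fin 7 × Fin 7) : ℚ_[p] :=
  g.1.val 5 ij.1 * g.1.val 6 ij.2 - g.1.val 5 ij.2 * g.1.val 6 ij.1

theorem height_eq (g : G2 p) : height p g = ‖minor g‖⁻¹ := rfl

/-- The Cauchy–Binet expansion, summed over all ordered pairs of columns. -/
theorem minor_mul (g k : G2 p) (ij : Fin 7 × Fin 7) :
    minor (g * k) ij = ∑ a, ∑ b, minor g (a, b) * (k.1.val a ij.1 * k.1.val b ij.2) := by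
  obtain ⟨i, j⟩ := ij
  have h1 : ∑ a, ∑ b, g.1.val 5 b * g.1.val 6 a * (k.1.val a i * k.1.val b j) =
      ∑ a, ∑ b, g.1.val 5 a * g.1.val 6 b * (k.1.val b i * k.1.val a j) := Finset.sum_comm
  simp only [minor, sub_mul, Finset.sum_sub_distrib, h1, G2_mul_val, Matrix.mul_apply,
    Finset.sum_mul_sum]
  congr 1 <;> refine Finset.sum_congr rfl fun a _ => Finset.sum_congr rfl fun b _ => ?_ <;> ring

theorem minor_ne_zero (g : G2 p) : minor g ≠ 0 := by
  intro h
  have h1 := minor_mul g g⁻¹ (5, 6)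
  rw [mul_inv_cancel] at h1
  simp only [h, Pi.zero_apply, zero_mul, Finset.sum_const_zero] at h1
  simp [minor] at h1

/-- By the ultrametric inequality integral matrices do not increase the maximum norm of the minors;
applied also to the inverse, this gives invariance of the height. -/
theorem norm_minor_mul_le {g k : G2 p} (hk : ∀ i j, ‖k.1.val i j‖ ≤ 1) :
    ‖minor (g * k)‖ ≤ ‖minor g‖ := by
  refine (pi_norm_le_iff_of_nonneg (norm_nonneg _)).mpr fun ij => ?_
  rw [minor_mul]
  refine IsUltrametricDist.norm_sum_le_of_forall_le_of_nonneg (norm_nonneg _) fun a _ =>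
    IsUltrametricDist.norm_sum_le_of_forall_le_of_nonneg (norm_nonneg _) fun b _ => ?_
  rw [norm_mul, norm_mul]
  have h1 := norm_le_pi_norm (minor g) (a, b)
  have h2 := mul_le_one₀ (hk a ij.1) (norm_nonneg _) (hk b ij.2)
  calc _ ≤ ‖minor g‖ * 1 := by gcongr
    _ = _ := mul_one _

/-- The subgroup `G₂(ℤ_p)`. -/
def integralG2 (p : ℕ) [Fact p.Prime] : Subgroup (G2 p) where
  carrier := {k | (∀ i j, ‖k.1.val i j‖ ≤ 1) ∧ ∀ i j, ‖(k⁻¹).1.val i j‖ ≤ 1}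
  one_mem' := by
    have h : ∀ i j, ‖((1 : G2 p)).1.val i j‖ ≤ 1 := fun i j => by
      change ‖(1 : Matrix (Fin 7) (Fin 7) ℚ_[p]) i j‖ ≤ 1
      rw [Matrix.one_apply]; split_ifs <;> simp
    exact ⟨h, by rw [inv_one]; exact h⟩
  mul_mem' {a b} ha hb := by
    have key : ∀ g h : G2 p, (∀ i j, ‖g.1.val i j‖ ≤ 1) → (∀ i j, ‖h.1.val i j‖ ≤ 1) →
        ∀ i j, ‖(g * h).1.val i j‖ ≤ 1 := fun g h hg hh i j => by
      rw [G2_mul_val, Matrix.mul_apply]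
      refine IsUltrametricDist.norm_sum_le_of_forall_le_of_nonneg zero_le_one fun k _ => ?_
      rw [norm_mul]
      exact mul_le_one₀ (hg _ _) (norm_nonneg _) (hh _ _)
    exact ⟨key a b ha.1 hb.1, by rw [mul_inv_rev]; exact key _ _ hb.2 ha.2⟩
  inv_mem' {a} ha := ⟨ha.2, by rw [inv_inv]; exact ha.1⟩

theorem isOpen_integralG2 : IsOpen (integralG2 p : Set (G2 p)) := by
  have h : ∀ i j, IsOpen {k : G2 p | ‖k.1.val i j‖ ≤ 1} := fun i j => by
    have h1 : Continuous fun k : G2 p => k.1.val i j :=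
      (Units.continuous_val.comp continuous_subtype_val).matrix_elem i j
    have h2 := (isOpen_ball (p := p) 0).preimage h1
    convert h2 using 1
    ext k
    simp [mem_ball]
  have h3 : (integralG2 p : Set (G2 p)) = (⋂ i, ⋂ j, {k : G2 p | ‖k.1.val i j‖ ≤ 1}) ∩
      ⋂ i, ⋂ j, (fun k => k⁻¹) ⁻¹' {k : G2 p | ‖k.1.val i j‖ ≤ 1} := by
    ext k
    simp only [Set.mem_inter_iff, Set.mem_iInter, Set.mem_preimage]
    rfl
  rw [h3]
  exact (isOpen_iInter_of_finite fun i => isOpen_iInter_of_finite fun j => h i j).inter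
    (isOpen_iInter_of_finite fun i => isOpen_iInter_of_finite fun j => (h i j).preimage continuous_inv)

theorem height_mul_integral (g : G2 p) {k : G2 p} (hk : k ∈ integralG2 p) :
    height p (g * k) = height p g := by
  rw [height_eq, height_eq]
  congr 1
  refine le_antisymm (norm_minor_mul_le hk.1) ?_
  have := norm_minor_mul_le (g := g * k) hk.2
  rwa [mul_inv_cancel_right] at this

/-- The last two rows of n are those of the identity, so n m(A) acts on the last two rows of g
through a 2 × 2 block of determinant (det A)⁻¹, and all minors are scaled by it. -/
theorem height_left (a : Fin 5 → ℚ_[p]) (A : GL (Fin 2) ℚ_[p]) (g : G2 p) :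
    height p (nG p a * mG p A * g) = ‖A.val.det‖ * height p g := by
  have hmul : ∀ {g h : G2 p}, (∀ j, g.1.val 5 j = (1 : Matrix (Fin 7) (Fin 7) ℚ_[p]) 5 j ∧
      g.1.val 6 j = (1 : Matrix (Fin 7) (Fin 7) ℚ_[p]) 6 j) →
      (∀ j, h.1.val 5 j = (1 : Matrix (Fin 7) (Fin 7) ℚ_[p]) 5 j ∧
      h.1.val 6 j = (1 : Matrix (Fin 7) (Fin 7) ℚ_[p]) 6 j) →
      ∀ j, (g * h).1.val 5 j = (1 : Matrix (Fin 7) (Fin 7) ℚ_[p]) 5 j ∧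
      (g * h).1.val 6 j = (1 : Matrix (Fin 7) (Fin 7) ℚ_[p]) 6 j := fun {g h} hg hh j => by
    simp only [G2_mul_val, Matrix.mul_apply, hg, Matrix.one_apply, ite_mul, one_mul, zero_mul,
      Finset.sum_ite_eq, Finset.mem_univ, if_true]
    simpa only [Matrix.one_apply] using hh j
  have hn : ∀ j, (nG p a).1.val 5 j = (1 : Matrix (Fin 7) (Fin 7) ℚ_[p]) 5 j ∧
      (nG p a).1.val 6 j = (1 : Matrix (Fin 7) (Fin 7) ℚ_[p]) 6 j := by
    refine hmul (hmul (hmul (hmul ?_ ?_) ?_) ?_) ?_ <;> intro j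
    · rw [xr_b_val, one_eq_lit]; fin_cases j <;> simp
    · rw [xr_ab_val, one_eq_lit]; fin_cases j <;> simp
    · rw [xr_a2b_val, one_eq_lit]; fin_cases j <;> simp
    · rw [xr_a3b_val, one_eq_lit]; fin_cases j <;> simp
    · rw [xr_a3b2_val, one_eq_lit]; fin_cases j <;> simp
  have h5 : ∀ j, (nG p a * mG p A * g).1.val 5 j =
      A.val.det⁻¹ * (A.val 0 0 * g.1.val 5 j - A.val 0 1 * g.1.val 6 j) ∧
      (nG p a * mG p A * g).1.val 6 j =
      A.val.det⁻¹ * (-A.val 1 0 * g.1.val 5 j + A.val 1 1 * g.1.val 6 j) := by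
    intro j
    have e1 : ∀ k, (nG p a * mG p A).1.val 5 k = mMat p A.val 5 k ∧
        (nG p a * mG p A).1.val 6 k = mMat p A.val 6 k := fun k => by
      simp only [G2_mul_val, Matrix.mul_apply, hn, Matrix.one_apply]
      simp [mG_val]
    rw [G2_mul_val, Matrix.mul_apply, Matrix.mul_apply]
    simp only [e1]
    simp [mMat, Fin.sum_univ_succ]
    constructor <;> ring
  have hdet := (Matrix.GeneralLinearGroup.det A).ne_zero
  rw [Matrix.GeneralLinearGroup.val_det_apply] at hdet
  have hm : minor (nG p a * mG p A * g) = A.val.det⁻¹ • minor g := by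
    funext ij
    simp only [minor, h5, Pi.smul_apply, smul_eq_mul]
    have hd2 : A.val.det = A.val 0 0 * A.val 1 1 - A.val 0 1 * A.val 1 0 := Matrix.det_fin_two _
    have : A.val.det⁻¹ * (A.val 0 0 * A.val 1 1 - A.val 0 1 * A.val 1 0) = 1 := by
      rw [← hd2, inv_mul_cancel₀ hdet]
    linear_combination (A.val.det⁻¹ * (g.1.val 5 ij.1 * g.1.val 6 ij.2 - g.1.val 5 ij.2 * g.1.val 6 ij.1)) * this
  rw [height_eq, height_eq, hm, norm_smul, mul_inv, norm_inv, inv_inv]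

theorem exists_height_eq (g : G2 p) : ∃ n : ℤ, height p g = (p : ℝ) ^ n := by
  obtain ⟨ij, -, hij⟩ := Finset.exists_mem_eq_sup Finset.univ Finset.univ_nonempty
    (fun b => ‖minor g b‖₊)
  have h : ‖minor g‖ = ‖minor g ij‖ := by rw [Pi.norm_def, hij]; rfl
  have h0 : minor g ij ≠ 0 := fun hc => minor_ne_zero g (norm_eq_zero.mp (by rw [h, hc, norm_zero]))
  obtain ⟨n, hn⟩ := exists_norm_eq_zpow h0
  exact ⟨-n, by rw [height_eq, h, hn, zpow_neg]⟩

end Height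

/-! ### Integrals of quasi-characters near infinity. -/

section Tails

variable {p : ℕ} [Fact p.Prime]

theorem notMem_ball {n : ℤ} {x : ℚ_[p]} : x ∈ (ball p n)ᶜ ↔ (p : ℝ) ^ n < ‖x‖ := by
  rw [Set.mem_compl_iff, mem_ball, not_le]

theorem ne_zero_of_notMem_ball {n : ℤ} {x : ℚ_[p]} (h : x ∈ (ball p n)ᶜ) : x ≠ 0 := by
  rintro rfl; exact h (zero_mem_ball n)

theorem norm_eq_of_mem_shell {n : ℤ} {x : ℚ_[p]} (h : x ∈ ball p (n + 1) \ ball p n) :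
    ‖x‖ = (p : ℝ) ^ (n + 1) := by
  have h2 := notMem_ball.mp h.2
  obtain ⟨m, hm⟩ := exists_norm_eq_zpow (ne_zero_of_notMem_ball h.2)
  have h1 := h.1
  rw [mem_ball, hm] at h1
  rw [hm] at h2 ⊢
  have a1 := (zpow_le_zpow_iff_right₀ one_lt_p).mp h1
  have a2 := (zpow_lt_zpow_iff_right₀ one_lt_p).mp h2
  congr 1; omega

theorem inv_mem_ball {k : ℕ} {x : ℚ_[p]} (h : x ∈ (ball p k)ᶜ) : x⁻¹ ∈ ball p (-k) := by
  have h1 := notMem_ball.mp h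
  rw [mem_ball, norm_inv, zpow_neg]
  exact inv_anti₀ (zpow_pos p_pos _) h1.le

theorem compl_ball_eq_iUnion (N : ℕ) : (ball p N)ᶜ =
    ⋃ j : ℕ, ball p ((N + j : ℕ) + 1 : ℤ) \ ball p (N + j : ℕ) := by
  ext x
  simp only [Set.mem_iUnion]
  constructor
  · intro hx
    obtain ⟨m, hm⟩ := exists_norm_eq_zpow (ne_zero_of_notMem_ball hx)
    have h1 := notMem_ball.mp hx
    rw [hm] at h1
    have a1 := (zpow_lt_zpow_iff_right₀ one_lt_p).mp h1
    refine ⟨(m - 1 - N).toNat, ?_, ?_⟩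
    · rw [mem_ball, hm]
      exact zpow_le_zpow_right₀ one_lt_p.le (by push_cast; omega)
    · rw [mem_ball, hm, not_le]
      exact zpow_lt_zpow_right₀ one_lt_p (by push_cast; omega)
  · rintro ⟨j, -, hj⟩ hx
    exact hj (ball_mono (by push_cast; omega) hx)

/-- On the shell |x| = p^(N+j+1) the integrand times the volume is at most q^(N+1+j) with q =
p^(1-κ) < 1, so a geometric series dominates. -/
theorem lintegral_tail_lt_top (N : ℕ) {κ : ℝ} (hκ : 1 < κ) :
    ∫⁻ x in (ball p N)ᶜ, ENNReal.ofReal (‖x‖⁻¹ ^ κ) ∂haar p < ⊤ := by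
  have hp := p_pos (p := p)
  rw [compl_ball_eq_iUnion N]
  refine lt_of_le_of_lt (lintegral_iUnion_le _ _) ?_
  set q : ℝ := (p : ℝ) ^ (1 - κ) with hq
  have hq0 : 0 ≤ q := by positivity
  have hq1 : q < 1 := Real.rpow_lt_one_of_one_lt_of_neg one_lt_p (by linarith)
  have hle : ∀ j : ℕ, ∫⁻ x in ball p ((N + j : ℕ) + 1 : ℤ) \ ball p (N + j : ℕ),
      ENNReal.ofReal (‖x‖⁻¹ ^ κ) ∂haar p ≤ ENNReal.ofReal (q ^ (N + 1) * q ^ j) := by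
    intro j
    have hm : MeasurableSet (ball p ((N + j : ℕ) + 1 : ℤ) \ ball p (N + j : ℕ)) :=
      (measurableSet_ball _).diff (measurableSet_ball _)
    rw [setLIntegral_congr_fun (g := fun _ => ENNReal.ofReal ((((p : ℝ) ^ ((N + j : ℕ) + 1 : ℤ))⁻¹) ^ κ)) hm
      (fun x hx => by simp only [norm_eq_of_mem_shell hx]), setLIntegral_const]
    refine (mul_le_mul_right (measure_mono Set.sdiff_subset) _).trans ?_
    rw [haar_ball, ← ENNReal.ofReal_mul (by positivity)]
    refine ENNReal.ofReal_le_ofReal (le_of_eq ?_)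
    have e1 : (p : ℝ) ^ ((N + j : ℕ) + 1 : ℤ) = (p : ℝ) ^ (N + j + 1 : ℕ) := by
      rw [← zpow_natCast]; push_cast; rfl
    rw [e1, ← pow_add, hq, ← Real.rpow_natCast, ← Real.rpow_natCast, ← Real.rpow_neg hp.le,
      ← Real.rpow_mul hp.le, ← Real.rpow_mul hp.le, ← Real.rpow_add hp]
    congr 1; push_cast; ring
  refine lt_of_le_of_lt (ENNReal.tsum_le_tsum hle) ?_
  rw [← ENNReal.ofReal_tsum_of_nonneg (fun j => by positivity)
    ((summable_geometric_of_lt_one hq0 hq1).mul_left _)]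
  exact ENNReal.ofReal_lt_top

theorem integrableOn_tail (μ : ℚ_[p]ˣ →* Circle) (hμ : Continuous μ) (N : ℕ) {τ : ℂ} (hτ : 1 < τ.re) :
    IntegrableOn (fun u => qchr μ τ u⁻¹) (ball p N)ᶜ (haar p) := by
  have hm : MeasurableSet (ball p N)ᶜ := (measurableSet_ball _).compl
  have hc : ContinuousOn (fun u => qchr μ τ u⁻¹) (ball p N)ᶜ := by
    refine (continuousOn_qchr μ hμ τ).comp (continuousOn_inv₀.mono ?_) ?_
    · intro x hx; exact ne_zero_of_notMem_ball hx
    · intro x hx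
      simpa using ne_zero_of_notMem_ball (p := p) hx
  refine ⟨hc.aestronglyMeasurable hm, ?_⟩
  rw [hasFiniteIntegral_iff_enorm]
  refine lt_of_le_of_lt (le_of_eq ?_) (lintegral_tail_lt_top (p := p) N hτ)
  refine setLIntegral_congr_fun hm fun x hx => ?_
  rw [← ofReal_norm, norm_qchr _ _ (inv_ne_zero (ne_zero_of_notMem_ball hx)), norm_inv]

/-- The substitution u ↦ pu shrinks the tail by one shell. Together with the splitting off of that
shell this is a linear equation for the tail, hence a closed formula. -/
theorem tail_succ (μ : ℚ_[p]ˣ →* Circle) (N : ℕ) (τ : ℂ) :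
    ∫ u in (ball p ((N : ℤ) + 1))ᶜ, qchr μ τ u⁻¹ ∂haar p =
      p * qchr μ τ p * ∫ u in (ball p N)ᶜ, qchr μ τ u⁻¹ ∂haar p := by
  have hp := p_ne_zero (p := p)
  rw [← integral_indicator (measurableSet_ball _).compl, ← integral_indicator (measurableSet_ball _).compl]
  set f := (ball p N)ᶜ.indicator fun u => qchr μ τ u⁻¹
  have h1 := integral_comp_mul hp f
  have h2 : ∀ x, f (p * x) = (qchr μ τ p)⁻¹ *
      (ball p ((N : ℤ) + 1))ᶜ.indicator (fun u => qchr μ τ u⁻¹) x := by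
    intro x
    have hiff : (p : ℚ_[p]) * x ∈ (ball p N)ᶜ ↔ x ∈ (ball p ((N : ℤ) + 1))ᶜ := by
      rw [notMem_ball, notMem_ball, norm_mul, Padic.norm_p, zpow_add_one₀ p_pos.ne',
        ← div_eq_inv_mul, lt_div_iff₀ p_pos]
    by_cases hx : x ∈ (ball p ((N : ℤ) + 1))ᶜ
    · simp only [f]
      rw [Set.indicator_of_mem (hiff.mpr hx), Set.indicator_of_mem hx, mul_inv, qchr_mul, qchr_inv _ _ hp]
    · simp only [f]
      rw [Set.indicator_of_notMem (fun hc => hx (hiff.mp hc)), Set.indicator_of_notMem hx, mul_zero]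
  simp only [h2] at h1
  rw [integral_const_mul, Padic.norm_p, inv_inv, inv_mul_eq_iff_eq_mul₀ (qchr_ne_zero μ τ hp)] at h1
  rw [h1, Complex.real_smul]
  push_cast
  ring

theorem qchr_p (μ : ℚ_[p]ˣ →* Circle) (τ : ℂ) :
    qchr μ τ p = μ (unif p) * (p : ℂ) ^ (-τ) := by
  have h1 : chr μ p = μ (unif p) := chr_units μ (unif p)
  have hp : (p : ℝ) ≠ 0 := p_pos.ne'
  rw [qchr, h1, Padic.norm_p, Complex.ofReal_inv, Complex.inv_cpow, Complex.cpow_neg]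
  · simp
  · rw [Complex.ofReal_natCast, Complex.natCast_arg]
    exact Real.pi_pos.ne

/-- The tail of the rank one intertwining integral is rational and regular away from the poles
of the local factor. -/
theorem isRat_tail (μ : ℚ_[p]ˣ →* Circle) (hμ : Continuous μ) {s : ℂ}
    (hL : ¬ LPole p (fun a => μ a) (s + 1 / 2)) (N : ℕ) :
    ∃ c, IsRat p (fun z => ∫ u in (ball p N)ᶜ, qchr μ (s + z + 3 / 2) u⁻¹ ∂haar p) c := by
  have hpc := p_ne_zero_complex (p := p)
  -- If the would-be Euler factor is singular at s, the absence of a pole forces μ to be ramified.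
  by_cases hl : (μ (unif p) : ℂ) * (p : ℂ) ^ (-(s + 1 / 2)) = 1
  · have hr : ¬ Unram p (fun a => (μ a : ℂ)) := fun h => hL ⟨h, hl⟩
    unfold Unram at hr
    push Not at hr
    obtain ⟨u₀, hu₀, hne⟩ := hr
    refine ⟨0, (IsRat.const 0).congr 0 fun z _ => ?_⟩
    -- For ramified μ, multiplying u by a unit on which μ is non-trivial shows that the tail is
    -- zero.
    have h1 := integral_comp_mul_of_norm_one hu₀
      ((ball p N)ᶜ.indicator fun u => qchr μ (s + z + 3 / 2) u⁻¹)
    have h2 : ∀ x, (ball p N)ᶜ.indicator (fun u => qchr μ (s + z + 3 / 2) u⁻¹) (u₀ * x) =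
        (μ u₀ : ℂ)⁻¹ * (ball p N)ᶜ.indicator (fun u => qchr μ (s + z + 3 / 2) u⁻¹) x := by
      intro x
      have hiff : (u₀ : ℚ_[p]) * x ∈ (ball p N)ᶜ ↔ x ∈ (ball p N)ᶜ := by
        rw [notMem_ball, notMem_ball, norm_mul, hu₀, one_mul]
      by_cases hx : x ∈ (ball p N)ᶜ
      · rw [Set.indicator_of_mem (hiff.mpr hx), Set.indicator_of_mem hx, mul_inv, qchr_mul,
          qchr_inv _ _ u₀.ne_zero]
        congr 1
        rw [qchr, chr_units, hu₀]; simp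
      · rw [Set.indicator_of_notMem (fun hc => hx (hiff.mp hc)), Set.indicator_of_notMem hx, mul_zero]
    simp only [h2] at h1
    rw [integral_const_mul, integral_indicator (measurableSet_ball _).compl] at h1
    have h3 : ((μ u₀ : ℂ)⁻¹ - 1) * ∫ u in (ball p N)ᶜ, qchr μ (s + z + 3 / 2) u⁻¹ ∂haar p = 0 := by
      rw [sub_mul, h1]; ring
    refine ((mul_eq_zero.mp h3).resolve_left (sub_ne_zero.mpr fun hc => hne ?_)).symm
    rwa [inv_eq_one] at hc
  -- The recursion reads (1 - l p^(-z)) · tail = shell, and the denominator does not vanish at z = 0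
  -- because l ≠ 1.
  · set l := (μ (unif p) : ℂ) * (p : ℂ) ^ (-(s + 1 / 2)) with hldef
    set c := ∫ u in ball p ((N : ℤ) + 1) \ ball p N, chr μ u⁻¹ ∂haar p
    set P : Polynomial ℂ := Polynomial.C (((p : ℂ) ^ (-(s + 3 / 2))) ^ (N + 1) * c) *
      Polynomial.X ^ (N + 1)
    set Q : Polynomial ℂ := 1 - Polynomial.C l * Polynomial.X
    refine ⟨P.eval 1 / Q.eval 1, P, Q, ?_, ⟨-s.re, fun z hz => ?_⟩, rfl⟩
    · simp only [Q, Polynomial.eval_sub, Polynomial.eval_one, Polynomial.eval_mul, Polynomial.eval_C,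
        Polynomial.eval_X, mul_one]
      exact sub_ne_zero.mpr (Ne.symm hl)
    · have hτ : 1 < (s + z + 3 / 2).re := by
        simp only [Complex.add_re, Complex.div_ofNat_re, Complex.re_ofNat]; linarith
      have hint := integrableOn_tail μ hμ N hτ
      have hsub : (ball p ((N : ℤ) + 1))ᶜ ⊆ (ball p N)ᶜ :=
        Set.compl_subset_compl.mpr (ball_mono (by omega))
      have hun : (ball p N)ᶜ = (ball p ((N : ℤ) + 1) \ ball p N) ∪ (ball p ((N : ℤ) + 1))ᶜ := by
        ext x
        simp only [Set.mem_compl_iff, Set.mem_union, Set.mem_sdiff]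
        have : x ∈ ball p N → x ∈ ball p ((N : ℤ) + 1) := fun h => ball_mono (by omega) h
        tauto
      have hsplit : ∫ u in (ball p N)ᶜ, qchr μ (s + z + 3 / 2) u⁻¹ ∂haar p =
          (∫ u in ball p ((N : ℤ) + 1) \ ball p N, qchr μ (s + z + 3 / 2) u⁻¹ ∂haar p) +
          ∫ u in (ball p ((N : ℤ) + 1))ᶜ, qchr μ (s + z + 3 / 2) u⁻¹ ∂haar p := by
        rw [← setIntegral_union ?_ (measurableSet_ball _).compl (hint.mono_set ?_) (hint.mono_set hsub),
          ← hun]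
        · rw [Set.disjoint_compl_right_iff_subset]; exact Set.sdiff_subset
        · intro x hx; exact hx.2
      have hshell : ∫ u in ball p ((N : ℤ) + 1) \ ball p N, qchr μ (s + z + 3 / 2) u⁻¹ ∂haar p =
          c * ((p : ℂ) ^ (-(s + z + 3 / 2))) ^ (N + 1) := by
        rw [← integral_mul_const]
        refine setIntegral_congr_fun ((measurableSet_ball _).diff (measurableSet_ball _)) fun u hu => ?_
        rw [qchr, norm_inv, norm_eq_of_mem_shell hu]
        congr 1
        have e1 : (p : ℝ) ^ ((N : ℤ) + 1) = (p : ℝ) ^ (N + 1 : ℕ) := by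
          rw [← zpow_natCast]; push_cast; rfl
        rw [e1, Complex.ofReal_inv, Complex.inv_cpow, ← Complex.cpow_neg]
        · push_cast
          rw [← Complex.natCast_cpow_natCast_mul, Complex.cpow_nat_mul]
        · rw [Complex.arg_ofReal_of_nonneg
            (by positivity)]
          exact Real.pi_pos.ne
      rw [tail_succ, hshell, qchr_p] at hsplit
      have hpl : (p : ℂ) * (μ (unif p) * (p : ℂ) ^ (-(s + z + 3 / 2))) = l * (p : ℂ) ^ (-z) := by
        have : (p : ℂ) * (p : ℂ) ^ (-(s + z + 3 / 2)) = (p : ℂ) ^ (-(s + 1 / 2)) * (p : ℂ) ^ (-z) := by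
          rw [← Complex.cpow_add _ _ hpc]
          nth_rewrite 1 [← Complex.cpow_one (p : ℂ)]
          rw [← Complex.cpow_add _ _ hpc]
          congr 1; ring
        rw [hldef]
        linear_combination (μ (unif p) : ℂ) * this
      rw [hpl] at hsplit
      have hpz : (p : ℂ) ^ (-(s + z + 3 / 2)) = (p : ℂ) ^ (-(s + 3 / 2)) * (p : ℂ) ^ (-z) := by
        rw [← Complex.cpow_add _ _ hpc]; congr 1; ring
      rw [hpz] at hsplit
      simp only [P, Q, Polynomial.eval_sub, Polynomial.eval_one, Polynomial.eval_mul, Polynomial.eval_C,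
        Polynomial.eval_X, Polynomial.eval_pow]
      rw [sub_mul, one_mul, sub_eq_iff_eq_add]
      linear_combination hsplit

end Tails

/-! ### Absolute convergence of iterated rank one integrals. -/

section Convergence

variable {p : ℕ} [Fact p.Prime]

theorem continuous_of_right_inv {E : Type*} [TopologicalSpace E] {f : G2 p → E} {K : Subgroup (G2 p)}
    (hK : IsOpen (K : Set (G2 p))) (hf : ∀ g, ∀ k ∈ K, f (g * k) = f g) : Continuous f := by
  refine IsLocallyConstant.continuous ?_
  rw [IsLocallyConstant.iff_eventually_eq]
  intro g
  have h1 : (fun h => g⁻¹ * h) ⁻¹' (K : Set (G2 p)) ∈ nhds g :=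
    (continuous_const.mul continuous_id).continuousAt.preimage_mem_nhds
      (hK.mem_nhds (by simp [one_mem]))
  filter_upwards [h1] with h hh
  have := hf g _ hh
  rwa [mul_inv_cancel_left] at this

theorem right_absorb {E : Type*} {f : G2 p → E} {K : Subgroup (G2 p)}
    (hf : ∀ g, ∀ k ∈ K, f (g * k) = f g) {g h : G2 p} (x : G2 p) (hk : g⁻¹ * h * g ∈ K) :
    f (x * (h * g)) = f (x * g) := by
  rw [← hf (x * g) _ hk]
  congr 1
  simp only [mul_assoc, mul_inv_cancel_left]

/-- Non-negative functions in a principal series for a character of the torus with positive values. -/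
structure EFam (K : Subgroup (G2 p)) (x y : ℝ) (f : G2 p → ℝ≥0∞) : Prop where
  inv : ∀ g, ∀ k ∈ K, f (g * k) = f g
  uinv : UInv f
  torus : ∀ a d g, f (hT a d * g) = ENNReal.ofReal (‖(a : ℚ_[p])‖ ^ x * ‖(d : ℚ_[p])‖ ^ y) * f g
  fin : ∀ g, f g ≠ ⊤

/-- The rank one intertwining integral for the long simple root, for non-negative functions. -/
def eB (f : G2 p → ℝ≥0∞) (g : G2 p) : ℝ≥0∞ := ∫⁻ u, f (wβ p * (xr p .b u * g)) ∂haar p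

/-- The rank one intertwining integral for the short simple root, for non-negative functions. -/
def eA (f : G2 p → ℝ≥0∞) (g : G2 p) : ℝ≥0∞ := ∫⁻ u, f (wα p * (xr p .a u * g)) ∂haar p

theorem lintegral_ball_lt_top {H : ℚ_[p] → ℝ≥0∞} (N k : ℕ)
    (hH : ∀ x, ∀ e ∈ ball p (-k), H (x + e) = H x) (hfin : ∀ x, H x ≠ ⊤) :
    ∫⁻ x in ball p N, H x ∂haar p < ⊤ := by
  rw [ball_eq_iUnion N k]
  rw [lintegral_biUnion_finset (coset_disjoint N k) (fun _ _ => measurableSet_coset _ _)]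
  refine ENNReal.sum_lt_top.mpr fun a _ => ?_
  rw [setLIntegral_congr_fun (measurableSet_coset _ _)
    (g := fun _ => H ((a : ℚ_[p]) / (p : ℚ_[p]) ^ N)), setLIntegral_const, haar_coset]
  · exact ENNReal.mul_lt_top (hfin _).lt_top (haar_ball_lt_top _)
  · intro y hy
    have := hH ((a : ℚ_[p]) / (p : ℚ_[p]) ^ N) _ hy
    simpa using this

/-- Local constancy bounds the part over the ball; the decay exponent κ > 1 handles the rest. -/
theorem lintegral_lt_top_of_tail {H : ℚ_[p] → ℝ≥0∞} (N k : ℕ)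
    (hH : ∀ x, ∀ e ∈ ball p (-k), H (x + e) = H x) (hfin : ∀ x, H x ≠ ⊤) {κ : ℝ} (hκ : 1 < κ) {c : ℝ≥0∞}
    (hc : c ≠ ⊤) (htail : ∀ x ∈ (ball p N)ᶜ, H x = ENNReal.ofReal (‖x‖⁻¹ ^ κ) * c) :
    ∫⁻ x, H x ∂haar p ≠ ⊤ := by
  rw [← lintegral_add_compl _ (measurableSet_ball N)]
  refine ENNReal.add_ne_top.mpr ⟨(lintegral_ball_lt_top N k hH hfin).ne, ?_⟩
  rw [setLIntegral_congr_fun (measurableSet_ball N).compl htail, lintegral_mul_const' _ _ hc]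
  exact ENNReal.mul_ne_top (lintegral_tail_lt_top N hκ).ne hc

variable {K : Subgroup (G2 p)}

/-- Uniform data of smoothness at a point for the rank one integrals over the long root. -/
theorem exists_radius_b (hK : IsOpen (K : Set (G2 p))) (g : G2 p) : ∃ k : ℕ, 1 ≤ k ∧
    (∀ e ∈ ball p (-k), g⁻¹ * xr p .b e * g ∈ K) ∧ (∀ e ∈ ball p (-k), g⁻¹ * lowB e * g ∈ K) := by
  obtain ⟨k₁, h₁, h₁'⟩ := exists_conj_mem (continuous_xr .b) (xr_zero .b) hK g
  obtain ⟨k₂, h₂, h₂'⟩ := exists_conj_mem continuous_lowB lowB_zero hK g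
  refine ⟨max k₁ k₂, by omega, fun e he => h₁' e (ball_mono (by push_cast; omega) he),
    fun e he => h₂' e (ball_mono (by push_cast; omega) he)⟩

theorem exists_radius_a (hK : IsOpen (K : Set (G2 p))) (g : G2 p) : ∃ k : ℕ, 1 ≤ k ∧
    (∀ e ∈ ball p (-k), g⁻¹ * xr p .a e * g ∈ K) ∧ (∀ e ∈ ball p (-k), g⁻¹ * lowA e * g ∈ K) := by
  obtain ⟨k₁, h₁, h₁'⟩ := exists_conj_mem (continuous_xr .a) (xr_zero .a) hK g
  obtain ⟨k₂, h₂, h₂'⟩ := exists_conj_mem continuous_lowA lowA_zero hK g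
  refine ⟨max k₁ k₂, by omega, fun e he => h₁' e (ball_mono (by push_cast; omega) he),
    fun e he => h₂' e (ball_mono (by push_cast; omega) he)⟩

theorem periodic_b {E : Type*} {f : G2 p → E} (hf : ∀ g, ∀ k ∈ K, f (g * k) = f g) {g : G2 p} {k : ℕ}
    (hk : ∀ e ∈ ball p (-k), g⁻¹ * xr p .b e * g ∈ K) (x : G2 p) (u : ℚ_[p]) {e : ℚ_[p]}
    (he : e ∈ ball p (-k)) : f (x * (xr p .b (u + e) * g)) = f (x * (xr p .b u * g)) := by
  rw [← bb, ← mul_assoc, right_absorb hf _ (hk e he), mul_assoc]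

theorem periodic_a {E : Type*} {f : G2 p → E} (hf : ∀ g, ∀ k ∈ K, f (g * k) = f g) {g : G2 p} {k : ℕ}
    (hk : ∀ e ∈ ball p (-k), g⁻¹ * xr p .a e * g ∈ K) (x : G2 p) (u : ℚ_[p]) {e : ℚ_[p]}
    (he : e ∈ ball p (-k)) : f (x * (xr p .a (u + e) * g)) = f (x * (xr p .a u * g)) := by
  rw [← aa, ← mul_assoc, right_absorb hf _ (hk e he), mul_assoc]

/-- The behaviour at infinity along the long root. -/
theorem wβ_large {E : Type*} {f : G2 p → E} (hf : ∀ g, ∀ k ∈ K, f (g * k) = f g) {g : G2 p} {k : ℕ}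
    (hk : ∀ e ∈ ball p (-k), g⁻¹ * lowB e * g ∈ K) (u : ℚ_[p]ˣ) (hu : (u : ℚ_[p]) ∈ (ball p k)ᶜ)
    (x : G2 p) :
    f (x * (wβ p * (xr p .b u * g))) = f (x * (xr p .b (-(u : ℚ_[p])⁻¹) * (hT 1 u⁻¹ * g))) := by
  rw [mul_of_eq (wβ_mul_xr u)]
  have := right_absorb hf (x * (xr p .b (-(u : ℚ_[p])⁻¹) * hT 1 u⁻¹))
    (hk _ (neg_mem_ball (inv_mem_ball hu)))
  simpa only [mul_assoc] using this

theorem wα_large {E : Type*} {f : G2 p → E} (hf : ∀ g, ∀ k ∈ K, f (g * k) = f g) {g : G2 p} {k : ℕ}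
    (hk : ∀ e ∈ ball p (-k), g⁻¹ * lowA e * g ∈ K) (u : ℚ_[p]ˣ) (hu : (u : ℚ_[p]) ∈ (ball p k)ᶜ)
    (x : G2 p) :
    f (x * (wα p * (xr p .a u * g))) = f (x * (xr p .a (-(u : ℚ_[p])⁻¹) * (hT (-u⁻¹) (-u) * g))) := by
  rw [mul_of_eq (wα_mul_xr u)]
  have := right_absorb hf (x * (xr p .a (-(u : ℚ_[p])⁻¹) * hT (-u⁻¹) (-u)))
    (hk _ (neg_mem_ball (inv_mem_ball hu)))
  simpa only [mul_assoc] using this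

/-- Near infinity the integrand is |u|^(-y) f(g), whence the condition y > 1. The new exponents are
the reflection (x + y, -y) of the old ones, corrected by the Jacobian |a d⁻²|⁻¹ of the change of
variable. -/
theorem EFam.map_eB (hK : IsOpen (K : Set (G2 p))) {x y : ℝ} {f : G2 p → ℝ≥0∞} (hf : EFam K x y f)
    (hy : 1 < y) : EFam K (x + y - 1) (2 - y) (eB f) where
  inv g k hk := by
    refine lintegral_congr fun u => ?_
    rw [← mul_assoc, ← mul_assoc, hf.inv _ k hk, mul_assoc]
  uinv :=
    { a := fun c g => lintegral_congr fun u => (hf.uinv.wβ_xb u c g).1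
      b := fun c g => by
        unfold eB
        simp only [bb]
        exact lintegral_add_right_eq_self (fun u => f (wβ p * (xr p .b u * g))) c
      ab := fun c g => lintegral_congr fun u => (hf.uinv.wβ_xb u c g).2.1
      a2b := fun c g => lintegral_congr fun u => (hf.uinv.wβ_xb u c g).2.2.1
      a3b := fun c g => lintegral_congr fun u => (hf.uinv.wβ_xb u c g).2.2.2.1
      a3b2 := fun c g => lintegral_congr fun u => (hf.uinv.wβ_xb u c g).2.2.2.2 }
  torus a d g := by
    unfold eB
    simp only [wβ_xb_hT, hf.torus]
    rw [lintegral_const_mul' _ _ ENNReal.ofReal_ne_top]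
    have ha : 0 < ‖(a : ℚ_[p])‖ := by simp
    have hd : 0 < ‖(d : ℚ_[p])‖ := by simp
    have h1 : ∀ u : ℚ_[p], u * a * ((d : ℚ_[p]) ^ 2)⁻¹ = (a * ((d : ℚ_[p]) ^ 2)⁻¹) * u := fun u => by ring
    simp only [h1]
    rw [lintegral_comp_mul (by simp) (fun u => f (wβ p * (xr p .b u * g))), ← mul_assoc,
      ← ENNReal.ofReal_mul (by positivity)]
    congr 2
    simp only [Units.val_mul, Units.val_inv_eq_inv_val, norm_mul, norm_inv, norm_pow]
    rw [Real.mul_rpow ha.le (by positivity), Real.inv_rpow hd.le, ← Real.rpow_neg hd.le, mul_inv, inv_inv,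
      ← Real.rpow_natCast, show x + y - 1 = x + y + (-1) by ring, Real.rpow_add ha, Real.rpow_add ha,
      show 2 - y = -y + (2 : ℕ) by push_cast; ring, Real.rpow_add hd, Real.rpow_neg_one]
    ring
  fin g := by
    obtain ⟨k, -, h1, h2⟩ := exists_radius_b hK g
    refine lintegral_lt_top_of_tail k k (fun u e he => periodic_b hf.inv h1 _ u he)
      (fun _ => hf.fin _) hy (hf.fin g) fun u hu => ?_
    obtain ⟨u, rfl⟩ : ∃ v : ℚ_[p]ˣ, u = v := ⟨Units.mk0 u (ne_zero_of_notMem_ball hu), rfl⟩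
    have := wβ_large hf.inv h2 u hu 1
    rw [one_mul, one_mul, hf.uinv.b, hf.torus] at this
    rw [this]
    simp

/-- Here the decay is |u|^(-(x - y)), the reflection exchanges x and y, and the Jacobian is |a/d|.
-/
theorem EFam.map_eA (hK : IsOpen (K : Set (G2 p))) {x y : ℝ} {f : G2 p → ℝ≥0∞} (hf : EFam K x y f)
    (hxy : 1 < x - y) : EFam K (y + 1) (x - 1) (eA f) where
  inv g k hk := by
    refine lintegral_congr fun u => ?_
    rw [← mul_assoc, ← mul_assoc, hf.inv _ k hk, mul_assoc]
  uinv :=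
    { b := fun c g => lintegral_congr fun u => (hf.uinv.wα_xa u c g).1
      a := fun c g => by
        unfold eA
        simp only [aa]
        exact lintegral_add_right_eq_self (fun u => f (wα p * (xr p .a u * g))) c
      ab := fun c g => lintegral_congr fun u => (hf.uinv.wα_xa u c g).2.1
      a2b := fun c g => lintegral_congr fun u => (hf.uinv.wα_xa u c g).2.2.1
      a3b := fun c g => lintegral_congr fun u => (hf.uinv.wα_xa u c g).2.2.2.1
      a3b2 := fun c g => lintegral_congr fun u => (hf.uinv.wα_xa u c g).2.2.2.2 }
  torus a d g := by
    unfold eA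
    simp only [wα_xa_hT, hf.torus]
    rw [lintegral_const_mul' _ _ ENNReal.ofReal_ne_top]
    have ha : 0 < ‖(a : ℚ_[p])‖ := by simp
    have hd : 0 < ‖(d : ℚ_[p])‖ := by simp
    have h1 : ∀ u : ℚ_[p], u * d * (a : ℚ_[p])⁻¹ = (d * (a : ℚ_[p])⁻¹) * u := fun u => by ring
    simp only [h1]
    rw [lintegral_comp_mul (by simp) (fun u => f (wα p * (xr p .a u * g))), ← mul_assoc,
      ← ENNReal.ofReal_mul (by positivity)]
    congr 2
    simp only [norm_mul, norm_inv]
    rw [mul_inv, inv_inv, Real.rpow_add ha, Real.rpow_sub hd, Real.rpow_one, Real.rpow_one]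
    field_simp
  fin g := by
    obtain ⟨k, -, h1, h2⟩ := exists_radius_a hK g
    refine lintegral_lt_top_of_tail k k (fun u e he => periodic_a hf.inv h1 _ u he)
      (fun _ => hf.fin _) hxy (hf.fin g) fun u hu => ?_
    obtain ⟨u, rfl⟩ : ∃ v : ℚ_[p]ˣ, u = v := ⟨Units.mk0 u (ne_zero_of_notMem_ball hu), rfl⟩
    have := wα_large hf.inv h2 u hu 1
    rw [one_mul, one_mul, hf.uinv.a, hf.torus] at this
    rw [this]
    congr 2
    have hu : 0 < ‖(u : ℚ_[p])‖ := by simp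
    simp only [Units.val_neg, norm_neg, Units.val_inv_eq_inv_val, norm_inv]
    rw [Real.rpow_sub (by positivity), Real.inv_rpow hu.le, Real.inv_rpow hu.le]
    field_simp

end Convergence

/-! ### The rank one operators `IB` and `IA` on complex functions. -/

section RankOne

variable {p : ℕ} [Fact p.Prime]

/-- The rank one intertwining integral for the long simple root. -/
def IB (f : G2 p → ℂ) (g : G2 p) : ℂ := ∫ u, f (wβ p * (xr p .b u * g)) ∂haar p

/-- The rank one Jacquet integral for the short simple root. -/
def IA (S : ℚ_[p]) (f : G2 p → ℂ) (g : G2 p) : ℂ :=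
  ∫ v, f (wα p * (xr p .a v * g)) * psi p (S * v) ∂haar p

variable {K : Subgroup (G2 p)} {f : G2 p → ℂ}

theorem IB_inv (hf : ∀ g, ∀ k ∈ K, f (g * k) = f g) : ∀ g, ∀ k ∈ K, IB f (g * k) = IB f g := by
  intro g k hk
  refine integral_congr_ae (ae_of_all _ fun u => ?_)
  simp only
  rw [← mul_assoc, ← mul_assoc, hf _ k hk, mul_assoc]

theorem IA_inv (S : ℚ_[p]) (hf : ∀ g, ∀ k ∈ K, f (g * k) = f g) :
    ∀ g, ∀ k ∈ K, IA S f (g * k) = IA S f g := by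
  intro g k hk
  refine integral_congr_ae (ae_of_all _ fun u => ?_)
  simp only
  rw [← mul_assoc, ← mul_assoc, hf _ k hk, mul_assoc]

theorem UInv.map_IB (hf : UInv f) : UInv (IB f) where
  a c g := by unfold IB; simp only [(hf.wβ_xb _ c g).1]
  b c g := by
    unfold IB
    simp only [bb]
    exact integral_add_right_eq_self (fun u => f (wβ p * (xr p .b u * g))) c
  ab c g := by unfold IB; simp only [(hf.wβ_xb _ c g).2.1]
  a2b c g := by unfold IB; simp only [(hf.wβ_xb _ c g).2.2.1]
  a3b c g := by unfold IB; simp only [(hf.wβ_xb _ c g).2.2.2.1]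
  a3b2 c g := by unfold IB; simp only [(hf.wβ_xb _ c g).2.2.2.2]

theorem IB_hT {a d : ℚ_[p]ˣ} {c : ℂ} (h : ∀ g, f (hT a (a * d⁻¹) * g) = c * f g) (g : G2 p) :
    IB f (hT a d * g) = c * (‖(a : ℚ_[p]) * ((d : ℚ_[p]) ^ 2)⁻¹‖⁻¹ : ℝ) * IB f g := by
  unfold IB
  simp only [wβ_xb_hT, h]
  have h1 : ∀ u : ℚ_[p], u * a * ((d : ℚ_[p]) ^ 2)⁻¹ = (a * ((d : ℚ_[p]) ^ 2)⁻¹) * u := fun u => by ring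
  simp only [h1]
  rw [integral_const_mul, integral_comp_mul (by simp) (fun u => f (wβ p * (xr p .b u * g))),
    Complex.real_smul, mul_assoc]

/-- In contrast to `IB`, the torus rescales the character, from S to Sa/d. This lets the integral
vanish far out along the long root. -/
theorem IA_hT {a d : ℚ_[p]ˣ} {c : ℂ} (h : ∀ g, f (hT d a * g) = c * f g) (S : ℚ_[p]) (g : G2 p) :
    IA S f (hT a d * g) = c * (‖(d : ℚ_[p]) * (a : ℚ_[p])⁻¹‖⁻¹ : ℝ) *
      IA (S * ((a : ℚ_[p]) * (d : ℚ_[p])⁻¹)) f g := by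
  unfold IA
  simp only [wα_xa_hT, h]
  have ha := a.ne_zero
  have hd := d.ne_zero
  have h1 : ∀ v : ℚ_[p], c * f (wα p * (xr p .a (v * d * (a : ℚ_[p])⁻¹) * g)) * psi p (S * v) =
      c * (fun v => f (wα p * (xr p .a v * g)) * psi p (S * ((a : ℚ_[p]) * (d : ℚ_[p])⁻¹) * v))
        (d * (a : ℚ_[p])⁻¹ * v) := fun v => by
    have e1 : v * d * (a : ℚ_[p])⁻¹ = d * (a : ℚ_[p])⁻¹ * v := by ring
    have e2 : S * v = S * ((a : ℚ_[p]) * (d : ℚ_[p])⁻¹) * (d * (a : ℚ_[p])⁻¹ * v) := by field_simp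
    rw [e1, e2, mul_assoc]
  simp only [h1]
  rw [integral_const_mul, integral_comp_mul (by simp)
    (fun v => f (wα p * (xr p .a v * g)) * psi p (S * ((a : ℚ_[p]) * (d : ℚ_[p])⁻¹) * v)),
    Complex.real_smul, mul_assoc]

theorem enorm_IB_le (g : G2 p) : ‖IB f g‖ₑ ≤ eB (fun g => ‖f g‖ₑ) g := enorm_integral_le_lintegral_enorm _

theorem enorm_mul_psi (x : ℂ) (y : ℚ_[p]) : ‖x * psi p y‖ₑ = ‖x‖ₑ := by
  rw [enorm_mul, ← ofReal_norm (psi p y), norm_psi]; simp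

theorem enorm_IA_le (S : ℚ_[p]) (g : G2 p) : ‖IA S f g‖ₑ ≤ eA (fun g => ‖f g‖ₑ) g := by
  refine (enorm_integral_le_lintegral_enorm _).trans (le_of_eq ?_)
  simp only [enorm_mul_psi]
  rfl

theorem eB_mono {f g : G2 p → ℝ≥0∞} (h : ∀ x, f x ≤ g x) (x : G2 p) : eB f x ≤ eB g x :=
  lintegral_mono fun _ => h _

theorem eA_mono {f g : G2 p → ℝ≥0∞} (h : ∀ x, f x ≤ g x) (x : G2 p) : eA f x ≤ eA g x :=
  lintegral_mono fun _ => h _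

/-- Right invariance under an open subgroup makes the integrand continuous, so finiteness of the
integral of its absolute value suffices. -/
theorem integrable_b (hK : IsOpen (K : Set (G2 p))) (hf : ∀ g, ∀ k ∈ K, f (g * k) = f g) {g : G2 p}
    (h : eB (fun g => ‖f g‖ₑ) g ≠ ⊤) : Integrable (fun u => f (wβ p * (xr p .b u * g))) (haar p) := by
  refine ⟨Continuous.aestronglyMeasurable ?_, hasFiniteIntegral_iff_enorm.mpr h.lt_top⟩
  exact (continuous_of_right_inv hK hf).comp
    (continuous_const.mul ((continuous_xr .b).mul continuous_const))

theorem integrable_a (hK : IsOpen (K : Set (G2 p))) (hf : ∀ g, ∀ k ∈ K, f (g * k) = f g) {g : G2 p}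
    (S : ℚ_[p]) (h : eA (fun g => ‖f g‖ₑ) g ≠ ⊤) :
    Integrable (fun u => f (wα p * (xr p .a u * g)) * psi p (S * u)) (haar p) := by
  refine ⟨Continuous.aestronglyMeasurable (Continuous.mul ?_ (continuous_psi.comp (by fun_prop))),
    hasFiniteIntegral_iff_enorm.mpr ?_⟩
  · exact (continuous_of_right_inv hK hf).comp
      (continuous_const.mul ((continuous_xr .a).mul continuous_const))
  · simp only [enorm_mul_psi]; exact h.lt_top

/-- The Jacquet integral vanishes for characters that oscillate on the stabilizer of the point. -/
theorem IA_eq_zero (hf : ∀ g, ∀ k ∈ K, f (g * k) = f g) {g : G2 p} {k : ℕ}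
    (hk : ∀ e ∈ ball p (-k), g⁻¹ * xr p .a e * g ∈ K) {S : ℚ_[p]}
    (hS : 1 < ‖S‖ * (p : ℝ) ^ (-k : ℤ)) : IA S f g = 0 := by
  obtain ⟨e, he, hne⟩ := exists_psi_ne_one hS
  have h1 := integral_add_right_eq_self (μ := haar p)
    (fun v => f (wα p * (xr p .a v * g)) * psi p (S * v)) e
  have h2 : ∀ v, f (wα p * (xr p .a (v + e) * g)) * psi p (S * (v + e)) =
      psi p (S * e) * (f (wα p * (xr p .a v * g)) * psi p (S * v)) := fun v => by
    rw [periodic_a hf hk _ _ he, mul_add, psi_add]; ring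
  simp only [h2] at h1
  rw [integral_const_mul] at h1
  have h3 : (psi p (S * e) - 1) * IA S f g = 0 := by
    rw [sub_mul, one_mul, sub_eq_zero]; exact h1
  exact (mul_eq_zero.mp h3).resolve_left (sub_ne_zero.mpr hne)

end RankOne

/-! ### Continuation of the triple integral `IT` in z. -/

section Families

variable {p : ℕ} [Fact p.Prime]

/-- A family of sections of the degenerate principal series with parameters `s + z`, rational
in `p ^ (-z)` at every point and regular at `z = 0` with value `F₀`. -/
structure Fam (μ : ℚ_[p]ˣ →* Circle) (s : ℂ) (K : Subgroup (G2 p)) (F : ℂ → G2 p → ℂ)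
    (F₀ : G2 p → ℂ) : Prop where
  isOpen : IsOpen (K : Set (G2 p))
  inv : ∀ z g, ∀ k ∈ K, F z (g * k) = F z g
  uinv : ∀ z, UInv (F z)
  torus : ∀ z (a d : ℚ_[p]ˣ) g, F z (hT a d * g) = qchr μ (s + z + 3 / 2) (a * d) * F z g
  rat : ∀ g, IsRat p (fun z => F z g) (F₀ g)

variable {μ : ℚ_[p]ˣ →* Circle} {s : ℂ} {K : Subgroup (G2 p)} {F : ℂ → G2 p → ℂ} {F₀ : G2 p → ℂ}

namespace Fam

variable (hF : Fam μ s K F F₀)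

include hF

theorem eFam (z : ℂ) : EFam K (s + z + 3 / 2).re (s + z + 3 / 2).re (fun g => ‖F z g‖ₑ) where
  inv g k hk := by rw [hF.inv z g k hk]
  uinv := by
    have h := hF.uinv z
    exact ⟨fun c g => by rw [h.a], fun c g => by rw [h.b], fun c g => by rw [h.ab],
      fun c g => by rw [h.a2b], fun c g => by rw [h.a3b], fun c g => by rw [h.a3b2]⟩
  torus a d g := by
    rw [hF.torus, enorm_mul, ← ofReal_norm, norm_qchr _ _ (by simp), norm_mul,
      Real.mul_rpow (norm_nonneg _) (norm_nonneg _)]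
  fin g := by simp

/-- Finiteness of the iterated integrals of absolute values. -/
theorem finite (z : ℂ) (hz : 1 / 2 - s.re < z.re) :
    (∃ x y, EFam K x y (eB fun g => ‖F z g‖ₑ)) ∧
    (∃ x y, EFam K x y (eA (eB fun g => ‖F z g‖ₑ))) ∧
    (∃ x y, EFam K x y (eB (eA (eB fun g => ‖F z g‖ₑ)))) ∧
    (∃ x y, EFam K x y (eA (eB (eA (eB fun g => ‖F z g‖ₑ))))) ∧
    (∃ x y, EFam K x y (eB (eA (eB (eA (eB fun g => ‖F z g‖ₑ)))))) := by
  -- Starting from the exponents (σ, σ), the five successive operators converge for σ > 1, 4/3, 3/2,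
  -- 5/3 and 2 respectively; the last condition is Re(s + z) > 1/2.
  have hσ : 2 < (s + z + 3 / 2).re := by
    simp only [Complex.add_re, Complex.div_ofNat_re, Complex.re_ofNat]; linarith
  have h0 := hF.eFam z
  set σ := (s + z + 3 / 2).re
  have h1 := h0.map_eB hF.isOpen (by linarith)
  have h2 := h1.map_eA hF.isOpen (by linarith)
  have h3 := h2.map_eB hF.isOpen (by linarith)
  have h4 := h3.map_eA hF.isOpen (by linarith)
  have h5 := h4.map_eB hF.isOpen (by linarith)
  exact ⟨⟨_, _, h1⟩, ⟨_, _, h2⟩, ⟨_, _, h3⟩, ⟨_, _, h4⟩, ⟨_, _, h5⟩⟩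

theorem integrable_IB (z : ℂ) (hz : 1 / 2 - s.re < z.re) (g : G2 p) :
    Integrable (fun u => F z (wβ p * (xr p .b u * g))) (haar p) := by
  obtain ⟨⟨_, _, h⟩, -⟩ := hF.finite z hz
  exact integrable_b hF.isOpen (hF.inv z) (h.fin g)

theorem integrable_IA (z : ℂ) (hz : 1 / 2 - s.re < z.re) (S : ℚ_[p]) (g : G2 p) :
    Integrable (fun v => IB (F z) (wα p * (xr p .a v * g)) * psi p (S * v)) (haar p) := by
  obtain ⟨-, ⟨_, _, h⟩, -⟩ := hF.finite z hz
  exact integrable_a hF.isOpen (IB_inv (hF.inv z)) S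
    (ne_top_of_le_ne_top (h.fin g) (eA_mono (fun g => enorm_IB_le g) g))

/-- Inside a ball the integral is a finite sum; outside, the integrand is the quasi-character of u⁻¹
times F(g), so `isRat_tail` applies. The clause on F₀ = 0 is carried along in order to compare
families with the same value at z = 0. -/
theorem rat_IB (hμ : Continuous μ) (hL : ¬ LPole p (fun a => μ a) (s + 1 / 2)) :
    ∃ M₀ : G2 p → ℂ, (∀ g, IsRat p (fun z => IB (F z) g) (M₀ g)) ∧ (F₀ = 0 → M₀ = 0) := by
  have key : ∀ g, ∃ c, IsRat p (fun z => IB (F z) g) c ∧ (F₀ = 0 → c = 0) := by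
    intro g
    obtain ⟨k, hk, h1, h2⟩ := exists_radius_b hF.isOpen g
    obtain ⟨c, hc⟩ := isRat_tail μ hμ hL k
    have h3 : IsRat p (fun z => ∫ u in ball p k, F z (wβ p * (xr p .b u * g)) ∂haar p)
        (∫ u in ball p k, F₀ (wβ p * (xr p .b u * g)) ∂haar p) :=
      IsRat.ballIntegral k k 0 (fun z _ u e he => periodic_b (hF.inv z) h1 _ u he) fun u => hF.rat _
    refine ⟨_, (h3.add (hc.mul (hF.rat g))).congr (1 / 2 - s.re) fun z hz => ?_, ?_⟩
    · rw [IB, ← integral_add_compl (measurableSet_ball k) (hF.integrable_IB z hz g)]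
      congr 1
      rw [← integral_mul_const]
      refine setIntegral_congr_fun (measurableSet_ball _).compl fun u hu => ?_
      obtain ⟨u, rfl⟩ : ∃ v : ℚ_[p]ˣ, u = v := ⟨Units.mk0 u (ne_zero_of_notMem_ball hu), rfl⟩
      have := wβ_large (hF.inv z) h2 u hu 1
      rw [one_mul, one_mul, (hF.uinv z).b, hF.torus] at this
      rw [this]
      simp
    · rintro rfl
      simp
  choose M₀ h1 h2 using key
  exact ⟨M₀, h1, fun h => funext fun g => h2 g h⟩

/-- The level depends only on the conductor of μ, hence serves all z at once. -/
theorem IB_torus_near_one (hμ : Continuous μ) :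
    ∃ k : ℕ, 1 ≤ k ∧ ∀ z, ∀ u : ℚ_[p]ˣ, (u : ℚ_[p]) - 1 ∈ ball p (-k) → ∀ g,
      IB (F z) (hT u 1 * g) = IB (F z) g := by
  obtain ⟨k, hk, h⟩ := exists_conductor μ hμ
  refine ⟨k, hk, fun z u hu g => ?_⟩
  have h1 : qchr μ (s + z + 3 / 2) u = 1 := by
    have := qchr_one_add μ hk h (s + z + 3 / 2) hu
    simpa using this
  have hn : ‖(u : ℚ_[p])‖ = 1 := by
    have := norm_one_add hk hu
    simpa using this
  rw [IB_hT (c := 1) (fun g => by rw [hF.torus]; simp [qchr_mul, h1])]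
  simp [hn]

/-- The Jacquet integral is an integral over a ball. -/
theorem IA_eq_ball (hμ : Continuous μ) {S : ℚ_[p]} (hS : S ≠ 0) (g : G2 p) :
    ∃ N : ℕ, ∀ z : ℂ, 1 / 2 - s.re < z.re → IA S (IB (F z)) g =
      ∫ v in ball p N, IB (F z) (wα p * (xr p .a v * g)) * psi p (S * v) ∂haar p := by
  obtain ⟨k₁, hk₁, h1⟩ := hF.IB_torus_near_one hμ
  obtain ⟨k₂, hk₂, h2⟩ := exists_conj_hT_mem hF.isOpen g
  obtain ⟨m, hm⟩ := exists_norm_eq_zpow hS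
  set k := max k₁ k₂
  -- With |S| = p^m, outside this ball |Sv| exceeds p^k, so ψ(Sv ·) is non-trivial on p^k ℤ_p.
  refine ⟨(k - m).toNat, fun z hz => ?_⟩
  have hint := hF.integrable_IA z hz S g
  rw [IA, ← integral_add_compl (measurableSet_ball (k - m).toNat) hint, add_eq_left]
  have hk : 1 ≤ k := le_trans hk₁ (le_max_left _ _)
  have hne : ∀ e ∈ ball p (-k : ℤ), (1 : ℚ_[p]) + e ≠ 0 := fun e he h0 => by
    have := norm_one_add hk he
    rw [h0] at this
    simp at this
  -- The factor 1 + e is produced by a torus element near one. It is absorbed by smoothness on the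
  -- right of the word and acts trivially after passing to its left.
  have hinv : ∀ v, ∀ e ∈ ball p (-k : ℤ), IB (F z) (wα p * (xr p .a (v * (1 + e)) * g)) =
      IB (F z) (wα p * (xr p .a v * g)) := by
    intro v e he
    have e1 : e ∈ ball p (-k₁ : ℤ) := ball_mono (by omega) he
    have e2 : e ∈ ball p (-k₂ : ℤ) := ball_mono (by omega) he
    have h3 := wα_xa_hT v g 1 (Units.mk0 (1 + e) (hne e he))
    have h4 := right_absorb (IB_inv (hF.inv z)) (wα p * xr p .a v)
      (h2 (Units.mk0 (1 + e) (hne e he)) (by simpa using e2))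
    rw [mul_assoc, mul_assoc, h3, h1 z _ (by simpa using e1)] at h4
    simpa using h4
  refine integral_mul_psi_eq_zero (measurableSet_ball _).compl ?_ hk ?_ (fun v _ => hinv v) ?_
  · refine IntegrableOn.congr_fun ((hint.integrableOn (s := (ball p ↑(↑k - m).toNat)ᶜ)).mul_bdd
      (c := 1) (g := fun v => psi p (-(S * v))) ?_ ?_) ?_ (measurableSet_ball _).compl
    · exact (continuous_psi.comp (by fun_prop)).aestronglyMeasurable
    · exact ae_of_all _ fun v => by rw [norm_psi]
    · intro v _
      simp only
      rw [mul_assoc, mul_comm (psi p (S * v)), psi_neg_mul, mul_one]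
  · intro v e he
    rw [notMem_ball, notMem_ball, norm_mul, norm_one_add hk he, mul_one]
  · intro v hv
    have h3 := notMem_ball.mp hv
    rw [norm_mul, hm]
    have h4 : (p : ℝ) ^ ((k : ℤ) - m) < ‖v‖ :=
      lt_of_le_of_lt (zpow_le_zpow_right₀ one_lt_p.le (by omega)) h3
    calc (1 : ℝ) = (p : ℝ) ^ m * (p : ℝ) ^ ((k : ℤ) - m) * (p : ℝ) ^ (-k : ℤ) := by
          rw [← zpow_add₀ p_pos.ne', ← zpow_add₀ p_pos.ne']; simp
      _ < _ := by
          have := p_pos (p := p)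
          gcongr

/-- The ball of `IA_eq_ball` does not depend on z, so integrating over it preserves rationality and
regularity at z = 0. -/
theorem rat_IA (hμ : Continuous μ) (hL : ¬ LPole p (fun a => μ a) (s + 1 / 2)) {S : ℚ_[p]}
    (hS : S ≠ 0) :
    ∃ W₀ : G2 p → ℂ, (∀ g, IsRat p (fun z => IA S (IB (F z)) g) (W₀ g)) ∧ (F₀ = 0 → W₀ = 0) := by
  obtain ⟨M₀, hM, hM0⟩ := hF.rat_IB hμ hL
  have key : ∀ g, ∃ c, IsRat p (fun z => IA S (IB (F z)) g) c ∧ (F₀ = 0 → c = 0) := by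
    intro g
    obtain ⟨N, hN⟩ := hF.IA_eq_ball hμ hS g
    obtain ⟨k, hk, h1, -⟩ := exists_radius_a hF.isOpen g
    obtain ⟨m, hm⟩ := exists_mem_ball S
    refine ⟨_, IsRat.congr (IsRat.ballIntegral N (max k m) 0
      (H := fun z v => IB (F z) (wα p * (xr p .a v * g)) * psi p (S * v)) (fun z _ v e he => ?_)
      fun v => (hM _).mul (IsRat.const _)) _ fun z hz => (hN z hz).symm, ?_⟩
    · rw [periodic_a (IB_inv (hF.inv z)) h1 _ _ (ball_mono (by push_cast; omega) he), mul_add,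
        psi_add_of_norm_le_one]
      refine norm_le_one_iff_ball.mpr (ball_mono ?_ (mul_mem_ball hm he))
      push_cast; omega
    · intro h
      simp [hM0 h]
  choose W₀ h1 h2 using key
  exact ⟨W₀, h1, fun h => funext fun g => h2 g h⟩

theorem IA_b (z : ℂ) (S : ℚ_[p]) (c : ℚ_[p]) (g : G2 p) :
    IA S (IB (F z)) (xr p .b c * g) = IA S (IB (F z)) g := by
  unfold IA
  simp only [((hF.uinv z).map_IB.wα_xa _ c g).1]

/-- The integral over the long root of the Jacquet integral is an integral over a ball. -/
theorem IB_IA_eq_ball {S : ℚ_[p]} (hS : S ≠ 0) (g : G2 p) :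
    ∃ N : ℕ, ∀ z : ℂ, ∀ r ∈ (ball p N)ᶜ, IA S (IB (F z)) (wβ p * (xr p .b r * g)) = 0 := by
  obtain ⟨k₁, hk₁, h1, -⟩ := exists_radius_a hF.isOpen g
  obtain ⟨k₂, hk₂, -, h2⟩ := exists_radius_b hF.isOpen g
  obtain ⟨m, hm⟩ := exists_norm_eq_zpow hS
  refine ⟨max k₂ (k₁ - m).toNat, fun z r hr => ?_⟩
  obtain ⟨r, rfl⟩ : ∃ v : ℚ_[p]ˣ, r = v := ⟨Units.mk0 r (ne_zero_of_notMem_ball hr), rfl⟩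
  -- For large r the Bruhat relation replaces w_β x_β(r) by a torus element, up to factors that act
  -- trivially.
  have h3 := wβ_large (IA_inv S (IB_inv (hF.inv z))) h2 r (fun h => hr (ball_mono (by push_cast; omega) h)) 1
  rw [one_mul, one_mul, hF.IA_b] at h3
  have h4 : ∀ g, IB (F z) (hT r⁻¹ 1 * g) = _ := IB_hT (c := qchr μ (s + z + 3 / 2)
    ((r⁻¹ : ℚ_[p]ˣ) * ((r⁻¹ : ℚ_[p]ˣ) * (1 : ℚ_[p]ˣ)⁻¹ : ℚ_[p]ˣ))) (fun g => by rw [hF.torus])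
  -- That torus element turns S into Sr, a character that oscillates on the stabilizer of g; hence
  -- the Jacquet integral vanishes.
  rw [IA_hT h4] at h3
  have hS' : 1 < ‖S * (((1 : ℚ_[p]ˣ) : ℚ_[p]) * ((r⁻¹ : ℚ_[p]ˣ) : ℚ_[p])⁻¹)‖ * (p : ℝ) ^ (-k₁ : ℤ) := by
    have h5 := notMem_ball.mp hr
    rw [norm_mul, hm]
    have h6 : (p : ℝ) ^ ((k₁ : ℤ) - m) < ‖(r : ℚ_[p])‖ :=
      lt_of_le_of_lt (zpow_le_zpow_right₀ one_lt_p.le (by push_cast; omega)) h5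
    have h7 : ‖((1 : ℚ_[p]ˣ) : ℚ_[p]) * ((r⁻¹ : ℚ_[p]ˣ) : ℚ_[p])⁻¹‖ = ‖(r : ℚ_[p])‖ := by simp
    rw [h7]
    calc (1 : ℝ) = (p : ℝ) ^ m * (p : ℝ) ^ ((k₁ : ℤ) - m) * (p : ℝ) ^ (-k₁ : ℤ) := by
          rw [← zpow_add₀ p_pos.ne', ← zpow_add₀ p_pos.ne']; simp
      _ < _ := by
          have := p_pos (p := p)
          gcongr
  rw [IA_eq_zero (IB_inv (hF.inv z)) h1 hS', mul_zero] at h3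
  exact h3

theorem rat_T (hμ : Continuous μ) (hL : ¬ LPole p (fun a => μ a) (s + 1 / 2)) {S : ℚ_[p]}
    (hS : S ≠ 0) :
    ∃ T₀ : G2 p → ℂ, (∀ g, IsRat p (fun z => IB (IA S (IB (F z))) g) (T₀ g)) ∧ (F₀ = 0 → T₀ = 0) := by
  obtain ⟨W₀, hW, hW0⟩ := hF.rat_IA hμ hL hS
  have key : ∀ g, ∃ c, IsRat p (fun z => IB (IA S (IB (F z))) g) c ∧ (F₀ = 0 → c = 0) := by
    intro g
    obtain ⟨N, hN⟩ := hF.IB_IA_eq_ball hS g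
    obtain ⟨k, hk, h1, -⟩ := exists_radius_b hF.isOpen g
    refine ⟨_, IsRat.congr (IsRat.ballIntegral N k 0
      (H := fun z r => IA S (IB (F z)) (wβ p * (xr p .b r * g))) (fun z _ r e he => ?_)
      fun r => hW _) 0 fun z _ => ?_, ?_⟩
    · exact periodic_b (IA_inv S (IB_inv (hF.inv z))) h1 _ _ he
    · exact setIntegral_eq_integral_of_forall_compl_eq_zero fun r hr => hN z r hr
    · intro h
      simp [hW0 h]
  choose T₀ h1 h2 using key
  exact ⟨T₀, h1, fun h => funext fun g => h2 g h⟩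

end Fam

end Families

/-! ### Transformation laws of the triple integral. -/

section Equivariance

variable {p : ℕ} [Fact p.Prime]

theorem IA_xr_a (S : ℚ_[p]) (f : G2 p → ℂ) (c : ℚ_[p]) (g : G2 p) :
    IA S f (xr p .a c * g) = psi p (-(S * c)) * IA S f g := by
  unfold IA
  simp only [aa]
  have h1 := integral_add_right_eq_self (μ := haar p)
    (fun v => f (wα p * (xr p .a v * g)) * psi p (S * (v - c))) c
  simp only [add_sub_cancel_right] at h1
  rw [h1, ← integral_const_mul]
  refine integral_congr_ae (ae_of_all _ fun v => ?_)
  simp only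
  rw [mul_sub, sub_eq_add_neg, psi_add]
  ring

/-- The composition of the first three rank one integrals. -/
def IT (S : ℚ_[p]) (f : G2 p → ℂ) : G2 p → ℂ := IB (IA S (IB f))

variable {f : G2 p → ℂ}

/-- The transformation law of the triple integral under the unipotent radical. -/
theorem UInv.IT (hf : UInv f) (S c : ℚ_[p]) (g : G2 p) :
    IT S f (xr p .b c * g) = IT S f g ∧ IT S f (xr p .ab c * g) = psi p (-(S * c)) * IT S f g ∧
    IT S f (xr p .a2b c * g) = IT S f g ∧ IT S f (xr p .a3b c * g) = IT S f g ∧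
    IT S f (xr p .a3b2 c * g) = IT S f g := by
  have h2 : ∀ c g, IA S (IB f) (xr p .b c * g) = IA S (IB f) g ∧
      IA S (IB f) (xr p .ab c * g) = IA S (IB f) g ∧
      IA S (IB f) (xr p .a2b c * g) = IA S (IB f) g ∧ IA S (IB f) (xr p .a3b c * g) = IA S (IB f) g ∧
      IA S (IB f) (xr p .a3b2 c * g) = IA S (IB f) g := fun c g => by
    unfold IA
    have h := fun u => hf.map_IB.wα_xa u c g
    exact ⟨by simp only [(h _).1], by simp only [(h _).2.1], by simp only [(h _).2.2.1],
      by simp only [(h _).2.2.2.1], by simp only [(h _).2.2.2.2]⟩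
  have hb := fun c g => (h2 c g).1
  have hab := fun c g => (h2 c g).2.1
  have ha2b := fun c g => (h2 c g).2.2.1
  have ha3b := fun c g => (h2 c g).2.2.2.1
  have ha3b2 := fun c g => (h2 c g).2.2.2.2
  have ha := IA_xr_a S (IB f)
  unfold FJ.IT
  generalize IA S (IB f) = f₂ at hb hab ha2b ha3b ha3b2 ha
  unfold IB
  refine ⟨?_, ?_, ?_, ?_, ?_⟩
  · simp only [bb]
    exact integral_add_right_eq_self (fun u => f₂ (wβ p * (xr p .b u * g))) c
  · simp only [b_ab, wβ_ab, ha]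
    rw [integral_const_mul]
  · simp only [b_a2b, wβ_a2b, ha2b]
  · simp only [b_a3b, wβ_a3b, wβ_a3b2, ha3b2, ha3b]
  · simp only [b_a3b2, wβ_a3b2, ha3b]

/-- As a function of y this is the Schrödinger model: the Heisenberg group acts by characters linear
in y and x_β(c) by the quadratic phase ψ(Scy²), matching the formulas for ω_S. -/
theorem UInv.IT_wα_xa (hf : UInv f) (S y c : ℚ_[p]) (g : G2 p) :
    FJ.IT S f (wα p * (xr p .a y * (xr p .b c * g))) =
      psi p (S * (c * y ^ 2)) * FJ.IT S f (wα p * (xr p .a y * g)) ∧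
    FJ.IT S f (wα p * (xr p .a y * (xr p .ab c * g))) =
      psi p (-(S * (2 * c * y))) * FJ.IT S f (wα p * (xr p .a y * g)) ∧
    FJ.IT S f (wα p * (xr p .a y * (xr p .a2b c * g))) =
      psi p (S * c) * FJ.IT S f (wα p * (xr p .a y * g)) ∧
    FJ.IT S f (wα p * (xr p .a y * (xr p .a3b c * g))) = FJ.IT S f (wα p * (xr p .a y * g)) ∧
    FJ.IT S f (wα p * (xr p .a y * (xr p .a3b2 c * g))) = FJ.IT S f (wα p * (xr p .a y * g)) := by
  have hb := fun c g => (hf.IT S c g).1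
  have hab := fun c g => (hf.IT S c g).2.1
  have ha2b := fun c g => (hf.IT S c g).2.2.1
  have ha3b := fun c g => (hf.IT S c g).2.2.2.1
  have ha3b2 := fun c g => (hf.IT S c g).2.2.2.2
  generalize FJ.IT S f = T at hb hab ha2b ha3b ha3b2
  simp only [a_b, a_ab, a_a2b, a_a3b, a_a3b2, wα_b, wα_ab, wα_a2b, wα_a3b, wα_a3b2, hb, hab, ha2b,
    ha3b, ha3b2, mul_neg, neg_neg, and_self]

/-- Right translation of the argument by the short simple root subgroup. -/
theorem UInv.IT_translate (hf : UInv f) (S y b x : ℚ_[p]) (g : G2 p) :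
    FJ.IT S f (wα p * (xr p .a y * (wβ p * (xr p .b b * (xr p .a x * g))))) =
      psi p (S * (2 * x * y + x ^ 2 * b)) *
        FJ.IT S f (wα p * (xr p .a (y + x * b) * (wβ p * (xr p .b b * g)))) := by
  have h := hf.IT_wα_xa S
  rw [b_a, wβ_a, wβ_ab, wβ_a2b, wβ_a3b, wβ_a3b2, (h _ _ _).2.1, aa, (h _ _ _).2.2.1, (h _ _ _).2.2.2.2,
    (h _ _ _).2.2.2.1, ← mul_assoc, ← psi_add]
  congr 2
  ring

variable {μ : ℚ_[p]ˣ →* Circle} {s : ℂ} {K : Subgroup (G2 p)} {F : ℂ → G2 p → ℂ} {F₀ : G2 p → ℂ}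

/-- Through the three operators the torus element becomes hT(b⁻¹, b⁻¹), which fixes S, and then
hT(b⁻¹, 1). The Jacobians |b|⁻¹ and |b| of the two long root integrals cancel. -/
theorem Fam.IT_hT (hF : Fam μ s K F F₀) (z : ℂ) (S : ℚ_[p]) (b : ℚ_[p]ˣ) (g : G2 p) :
    FJ.IT S (F z) (hT b⁻¹ 1 * g) = (qchr μ (s + z + 3 / 2) b)⁻¹ * FJ.IT S (F z) g := by
  have h1 : ∀ g, IB (F z) (hT b⁻¹ (b⁻¹) * g) = _ := IB_hT (c := (qchr μ (s + z + 3 / 2) b)⁻¹)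
    (fun g => by rw [hF.torus]; simp [qchr_inv])
  have h2 := fun g => IA_hT h1 S g
  have h3 : S * (((b⁻¹ : ℚ_[p]ˣ) : ℚ_[p]) * ((b⁻¹ : ℚ_[p]ˣ) : ℚ_[p])⁻¹) = S := by
    rw [mul_inv_cancel₀ (Units.ne_zero _), mul_one]
  rw [h3] at h2
  rw [FJ.IT, IB_hT (fun g => by rw [inv_one, mul_one, h2])]
  congr 1
  have hb : (‖(b : ℚ_[p])‖ : ℂ) ≠ 0 := by simp
  simp
  field_simp

end Equivariance

/-! ### Iterated integrals over four and five coordinates, and shears. -/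

section Fubini

variable {p : ℕ} [Fact p.Prime]

theorem lintegral_pi_succ {n : ℕ} (i : Fin (n + 1)) {f : (Fin (n + 1) → ℚ_[p]) → ℝ≥0∞} (hf : Measurable f) :
    ∫⁻ u, f u ∂Measure.pi (fun _ => haar p) =
      ∫⁻ x, ∫⁻ v, f (i.insertNth x v) ∂Measure.pi (fun _ => haar p) ∂haar p := by
  have h := (measurePreserving_piFinSuccAbove (fun _ : Fin (n + 1) => haar p) i).symm
  rw [← h.lintegral_comp hf]
  refine (lintegral_prod _ (hf.comp h.measurable).aemeasurable).trans ?_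
  rfl

theorem integral_pi_succ {n : ℕ} (i : Fin (n + 1)) {f : (Fin (n + 1) → ℚ_[p]) → ℂ}
    (hf : Integrable f (Measure.pi fun _ => haar p)) :
    ∫ u, f u ∂Measure.pi (fun _ => haar p) =
      ∫ x, ∫ v, f (i.insertNth x v) ∂Measure.pi (fun _ => haar p) ∂haar p ∧
    ∀ᵐ x ∂haar p, Integrable (fun v => f (i.insertNth x v)) (Measure.pi fun _ => haar p) := by
  have h := (measurePreserving_piFinSuccAbove (fun _ : Fin (n + 1) => haar p) i).symm
  have h1 := h.integrable_comp_of_integrable hf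
  constructor
  · rw [← h.integral_comp']
    refine (integral_prod _ h1).trans ?_
    rfl
  · exact h1.prod_right_ae

theorem lintegral_pi_zero (f : (Fin 0 → ℚ_[p]) → ℝ≥0∞) :
    ∫⁻ u, f u ∂Measure.pi (fun _ => haar p) = f ![] := by
  rw [Measure.pi_of_empty (fun _ : Fin 0 => haar p) ![], lintegral_dirac]

theorem integral_pi_zero (f : (Fin 0 → ℚ_[p]) → ℂ) :
    ∫ u, f u ∂Measure.pi (fun _ => haar p) = f ![] := by
  rw [Measure.pi_of_empty (fun _ : Fin 0 => haar p) ![], integral_dirac]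

/-- Coordinates are split off in the order in which the rank one integrals are nested, the rightmost
letter of the word being the outermost. -/
theorem insertNth_four (y c v u : ℚ_[p]) (e : Fin 0 → ℚ_[p]) :
    (2 : Fin 4).insertNth y ((0 : Fin 3).insertNth c ((1 : Fin 2).insertNth v
      ((0 : Fin 1).insertNth (α := fun _ => ℚ_[p]) u e))) = ![c, u, y, v] := by
  funext j; fin_cases j <;> rfl

theorem insertNth_five (a₀ a₁ a₂ a₃ a₄ : ℚ_[p]) (e : Fin 0 → ℚ_[p]) :
    (0 : Fin 5).insertNth a₀ ((0 : Fin 4).insertNth a₁ ((2 : Fin 3).insertNth a₄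
      ((0 : Fin 2).insertNth a₂ ((0 : Fin 1).insertNth (α := fun _ => ℚ_[p]) a₃ e)))) =
        ![a₀, a₁, a₂, a₃, a₄] := by
  funext j; fin_cases j <;> rfl

theorem lintegral_pi_four {f : (Fin 4 → ℚ_[p]) → ℝ≥0∞} (hf : Measurable f) :
    ∫⁻ a, f a ∂Measure.pi (fun _ => haar p) =
      ∫⁻ y, ∫⁻ c, ∫⁻ v, ∫⁻ u, f ![c, u, y, v] ∂haar p ∂haar p ∂haar p ∂haar p := by
  rw [lintegral_pi_succ 2 hf]
  refine lintegral_congr fun y => ?_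
  have h1 : Measurable fun v => f ((2 : Fin 4).insertNth y v) := hf.comp (by fun_prop)
  rw [lintegral_pi_succ 0 h1]
  refine lintegral_congr fun c => ?_
  have h2 : Measurable fun v => f ((2 : Fin 4).insertNth y ((0 : Fin 3).insertNth c v)) :=
    h1.comp (by fun_prop)
  rw [lintegral_pi_succ 1 h2]
  refine lintegral_congr fun v => ?_
  have h3 : Measurable fun w => f ((2 : Fin 4).insertNth y ((0 : Fin 3).insertNth c
    ((1 : Fin 2).insertNth v w))) := h2.comp (by fun_prop)
  rw [lintegral_pi_succ 0 h3]
  refine lintegral_congr fun u => ?_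
  rw [lintegral_pi_zero]
  exact congrArg f (insertNth_four ..)

theorem integral_pi_four {f : (Fin 4 → ℚ_[p]) → ℂ} (hf : Integrable f (Measure.pi fun _ => haar p)) :
    ∫ a, f a ∂Measure.pi (fun _ => haar p) =
      ∫ y, ∫ c, ∫ v, ∫ u, f ![c, u, y, v] ∂haar p ∂haar p ∂haar p ∂haar p := by
  obtain ⟨e1, h1⟩ := integral_pi_succ 2 hf
  rw [e1]
  refine integral_congr_ae (h1.mono fun y h1 => ?_)
  obtain ⟨e2, h2⟩ := integral_pi_succ 0 h1
  refine e2.trans (integral_congr_ae (h2.mono fun c h2 => ?_))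
  obtain ⟨e3, h3⟩ := integral_pi_succ 1 h2
  refine e3.trans (integral_congr_ae (h3.mono fun v h3 => ?_))
  obtain ⟨e4, h4⟩ := integral_pi_succ 0 h3
  refine e4.trans (integral_congr_ae (ae_of_all _ fun u => ?_))
  simp only
  rw [integral_pi_zero]
  exact congrArg f (insertNth_four ..)

theorem lintegral_pi_five {f : (Fin 5 → ℚ_[p]) → ℝ≥0∞} (hf : Measurable f) :
    ∫⁻ a, f a ∂Measure.pi (fun _ => haar p) =
      ∫⁻ b, ∫⁻ y, ∫⁻ c, ∫⁻ v, ∫⁻ u, f ![b, y, v, u, c] ∂haar p ∂haar p ∂haar p ∂haar p ∂haar p := by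
  rw [lintegral_pi_succ 0 hf]
  refine lintegral_congr fun b => ?_
  have h0 : Measurable fun v => f ((0 : Fin 5).insertNth b v) := hf.comp (by fun_prop)
  rw [lintegral_pi_succ 0 h0]
  refine lintegral_congr fun y => ?_
  have h1 : Measurable fun v => f ((0 : Fin 5).insertNth b ((0 : Fin 4).insertNth y v)) :=
    h0.comp (by fun_prop)
  rw [lintegral_pi_succ 2 h1]
  refine lintegral_congr fun c => ?_
  have h2 : Measurable fun v => f ((0 : Fin 5).insertNth b ((0 : Fin 4).insertNth y
    ((2 : Fin 3).insertNth c v))) := h1.comp (by fun_prop)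
  rw [lintegral_pi_succ 0 h2]
  refine lintegral_congr fun v => ?_
  have h3 : Measurable fun w => f ((0 : Fin 5).insertNth b ((0 : Fin 4).insertNth y
    ((2 : Fin 3).insertNth c ((0 : Fin 2).insertNth v w)))) := h2.comp (by fun_prop)
  rw [lintegral_pi_succ 0 h3]
  refine lintegral_congr fun u => ?_
  rw [lintegral_pi_zero]
  exact congrArg f (insertNth_five ..)

theorem integral_pi_five {f : (Fin 5 → ℚ_[p]) → ℂ} (hf : Integrable f (Measure.pi fun _ => haar p)) :
    ∫ a, f a ∂Measure.pi (fun _ => haar p) =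
      ∫ b, ∫ y, ∫ c, ∫ v, ∫ u, f ![b, y, v, u, c] ∂haar p ∂haar p ∂haar p ∂haar p ∂haar p := by
  obtain ⟨e0, h0⟩ := integral_pi_succ 0 hf
  rw [e0]
  refine integral_congr_ae (h0.mono fun b h0 => ?_)
  obtain ⟨e1, h1⟩ := integral_pi_succ 0 h0
  refine e1.trans (integral_congr_ae (h1.mono fun y h1 => ?_))
  obtain ⟨e2, h2⟩ := integral_pi_succ 2 h1
  refine e2.trans (integral_congr_ae (h2.mono fun c h2 => ?_))
  obtain ⟨e3, h3⟩ := integral_pi_succ 0 h2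
  refine e3.trans (integral_congr_ae (h3.mono fun v h3 => ?_))
  obtain ⟨e4, h4⟩ := integral_pi_succ 0 h3
  refine e4.trans (integral_congr_ae (ae_of_all _ fun u => ?_))
  simp only
  rw [integral_pi_zero]
  exact congrArg f (insertNth_five ..)

/-- A translation of one coordinate by a function of the others preserves the measure. -/
theorem measurePreserving_shear {n : ℕ} (i : Fin (n + 1)) {τ : (Fin (n + 1) → ℚ_[p]) → ℚ_[p]}
    (hτ : Measurable τ) (hi : ∀ u x, τ (Function.update u i x) = τ u) :
    MeasurePreserving (fun u : Fin (n + 1) → ℚ_[p] => Function.update u i (u i + τ u))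
      (Measure.pi fun _ => haar p) (Measure.pi fun _ => haar p) := by
  have e := measurePreserving_piFinSuccAbove (fun _ : Fin (n + 1) => haar p) i
  have h1 : MeasurePreserving (fun q : (Fin n → ℚ_[p]) × ℚ_[p] => (q.1, q.2 + τ (i.insertNth 0 q.1)))
      ((Measure.pi fun _ => haar p).prod (haar p)) ((Measure.pi fun _ => haar p).prod (haar p)) :=
    (MeasurePreserving.id _).skew_product
      (g := fun v x => x + τ (i.insertNth 0 v))
      (by
        have : Measurable fun q : (Fin n → ℚ_[p]) × ℚ_[p] => τ (i.insertNth 0 q.1) :=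
          hτ.comp (by fun_prop)
        exact measurable_snd.add this)
      (ae_of_all _ fun v => (measurePreserving_add_right (haar p) _).map_eq)
  have h2 := (e.symm.comp Measure.measurePreserving_swap).comp
    (h1.comp (Measure.measurePreserving_swap.comp e))
  convert h2 using 1
  funext u
  obtain ⟨x, v, rfl⟩ : ∃ x v, u = i.insertNth x v := ⟨u i, i.removeNth u, by simp⟩
  have h3 : τ (i.insertNth x v) = τ (i.insertNth 0 v) := by
    rw [← hi (i.insertNth x v) 0]
    simp
  have h4 : MeasurableEquiv.piFinSuccAbove (fun _ => ℚ_[p]) i (i.insertNth x v) = (x, v) :=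
    (Fin.insertNthEquiv (fun _ => ℚ_[p]) i).symm_apply_apply (x, v)
  simp only [Function.comp_apply, h4, Prod.swap_prod_mk, Fin.insertNth_apply_same, h3,
    Fin.update_insertNth]
  rfl

/-- Integrability is to be pulled back from f ∘ T to f, although T is not given as a measurable
equivalence; continuity of f supplies the measurability. -/
theorem MeasurePreserving.integral_comp_continuous {X : Type*} [TopologicalSpace X]
    [MeasurableSpace X] [OpensMeasurableSpace X] [SecondCountableTopologyEither X ℂ]
    {ν : Measure X} {T : X → X} (hT : MeasurePreserving T ν ν) {f : X → ℂ} (hf : Continuous f)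
    (h : Integrable (f ∘ T) ν) : Integrable f ν ∧ ∫ x, f x ∂ν = ∫ x, f (T x) ∂ν := by
  have h1 : AEStronglyMeasurable f (Measure.map T ν) := by
    rw [hT.map_eq]; exact hf.aestronglyMeasurable
  constructor
  · rw [← hT.map_eq]
    exact (integrable_map_measure h1 hT.measurable.aemeasurable).mpr h
  · conv_lhs => rw [← hT.map_eq]
    exact integral_map hT.measurable.aemeasurable h1

end Fubini

/-! ### The integrals over Z_U V and over N as iterated rank one integrals. -/

section WordIntegrals

variable {p : ℕ} [Fact p.Prime]

theorem lintegral_neg_haar (f : ℚ_[p] → ℝ≥0∞) : ∫⁻ x, f (-x) ∂haar p = ∫⁻ x, f x ∂haar p := by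
  have := lintegral_comp_mul_add (p := p) (a := -1) (by simp) 0 f
  simpa using this

theorem integral_neg_haar (f : ℚ_[p] → ℂ) : ∫ x, f (-x) ∂haar p = ∫ x, f x ∂haar p := by
  have := integral_comp_mul_add (p := p) (a := -1) (by simp) 0 f
  simpa using this

variable {X : Type*} [TopologicalSpace X]

theorem continuous_word {c₁ c₂ c₃ c₄ : X → ℚ_[p]} {g : X → G2 p} (h₁ : Continuous c₁)
    (h₂ : Continuous c₂) (h₃ : Continuous c₃) (h₄ : Continuous c₄) (hg : Continuous g) :
    Continuous fun x => word (c₁ x) (c₂ x) (c₃ x) (c₄ x) (g x) := by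
  have hx := fun γ : Root => continuous_xr (p := p) γ
  unfold word
  exact continuous_const.mul (((hx _).comp h₁).mul (continuous_const.mul (((hx _).comp h₂).mul
    (continuous_const.mul (((hx _).comp h₃).mul (continuous_const.mul (((hx _).comp h₄).mul hg)))))))

theorem continuous_nG : Continuous (nG p) := by
  have hx := fun (γ : Root) (i : Fin 5) =>
    (continuous_xr (p := p) γ).comp (continuous_apply (A := fun _ => ℚ_[p]) i)
  unfold nG
  exact ((((hx _ _).mul (hx _ _)).mul (hx _ _)).mul (hx _ _)).mul (hx _ _)

theorem IsSchwartz.exists_bound {Ψ : ℚ_[p] → ℂ} (h : IsSchwartz p Ψ) : ∃ C : ℝ, ∀ y, ‖Ψ y‖ ≤ C :=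
  h.2.exists_bound_of_continuous h.1.continuous

variable {μ : ℚ_[p]ˣ →* Circle} {s : ℂ} {K : Subgroup (G2 p)} {F : ℂ → G2 p → ℂ} {F₀ : G2 p → ℂ}

theorem mu_neg_one_mul (μ : ℚ_[p]ˣ →* Circle) : (μ (-1) : ℂ) * μ (-1) = 1 := by
  rw [← Circle.coe_mul, ← map_mul]; simp

namespace Fam

variable (hF : Fam μ s K F F₀)

include hF

theorem continuous (z : ℂ) : Continuous (F z) := continuous_of_right_inv hF.isOpen (hF.inv z)

theorem IT_inv (S z : _) : ∀ g, ∀ k ∈ K, IT S (F z) (g * k) = IT S (F z) g :=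
  IB_inv (IA_inv S (IB_inv (hF.inv z)))

theorem continuous_IT (S z : _) : Continuous (IT S (F z)) :=
  continuous_of_right_inv hF.isOpen (hF.IT_inv S z)

theorem enorm_IT_le (S : ℚ_[p]) (z : ℂ) (g : G2 p) :
    ‖IT S (F z) g‖ₑ ≤ eB (eA (eB fun g => ‖F z g‖ₑ)) g :=
  (enorm_IB_le g).trans (eB_mono (fun g => (enorm_IA_le S g).trans (eA_mono (fun g => enorm_IB_le g) g)) g)

/-- Joint absolute convergence in y and b, from all five operators of `Fam.finite`; later it
justifies interchanging these variables with x. -/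
theorem integrable_wα_wβ_IT (z : ℂ) (hz : 1 / 2 - s.re < z.re) (S : ℚ_[p]) (g : G2 p) :
    Integrable (fun q : ℚ_[p] × ℚ_[p] =>
      IT S (F z) (wα p * (xr p .a q.2 * (wβ p * (xr p .b q.1 * g))))) ((haar p).prod (haar p)) := by
  obtain ⟨-, -, -, -, ⟨_, _, h⟩⟩ := hF.finite z hz
  have hc : Continuous (fun q : ℚ_[p] × ℚ_[p] =>
      IT S (F z) (wα p * (xr p .a q.2 * (wβ p * (xr p .b q.1 * g))))) :=
    (hF.continuous_IT S z).comp (continuous_const.mul (((continuous_xr .a).comp continuous_snd).mul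
      (continuous_const.mul (((continuous_xr .b).comp continuous_fst).mul continuous_const))))
  refine ⟨hc.aestronglyMeasurable, hasFiniteIntegral_iff_enorm.mpr ?_⟩
  rw [lintegral_prod _ hc.enorm.measurable.aemeasurable]
  exact lt_of_le_of_lt (eB_mono (eA_mono (hF.enorm_IT_le S z)) g) (h.fin g).lt_top

/-- The integral defining the Fourier–Jacobi map, in terms of the rank one integrals. -/
theorem integral_four (z : ℂ) (hz : 1 / 2 - s.re < z.re) (S : ℚ_[p]) (g : G2 p) {Ψ : ℚ_[p] → ℂ}
    (hΨ : IsSchwartz p Ψ) :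
    Integrable (fun u : Fin 4 → ℚ_[p] => F z (word (u 1) (-(u 3)) (u 0 - 3 * u 2 * u 3) (u 2) g) *
      (starRingEnd ℂ) (Ψ (u 2) * psi p (S * u 3))) (Measure.pi fun _ => haar p) ∧
    ∫ u : Fin 4 → ℚ_[p], F z (word (u 1) (-(u 3)) (u 0 - 3 * u 2 * u 3) (u 2) g) *
      (starRingEnd ℂ) (Ψ (u 2) * psi p (S * u 3)) ∂(Measure.pi fun _ => haar p) =
      ∫ y, (starRingEnd ℂ) (Ψ y) * IT S (F z) (wα p * (xr p .a y * g)) ∂haar p := by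
  obtain ⟨-, -, -, ⟨_, _, hfin⟩, -⟩ := hF.finite z hz
  obtain ⟨C, hC⟩ := hΨ.exists_bound
  have hΨc := hΨ.1.continuous
  set f : (Fin 4 → ℚ_[p]) → ℂ := fun u => F z (word (u 1) (-(u 3)) (u 0) (u 2) g) *
      (starRingEnd ℂ) (Ψ (u 2) * psi p (S * u 3)) with hf
  have hw : Continuous fun u : Fin 4 → ℚ_[p] => F z (word (u 1) (-(u 3)) (u 0) (u 2) g) :=
    (hF.continuous z).comp (continuous_word (by fun_prop) (by fun_prop) (by fun_prop) (by fun_prop)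
      continuous_const)
  have hfc : Continuous f := hw.mul (Complex.continuous_conj.comp ((hΨc.comp (continuous_apply _)).mul
    (continuous_psi.comp (by fun_prop))))
  have hfi : Integrable f (Measure.pi fun _ => haar p) := by
    have h1 : Integrable (fun u : Fin 4 → ℚ_[p] => F z (word (u 1) (-(u 3)) (u 0) (u 2) g))
        (Measure.pi fun _ => haar p) := by
      refine ⟨hw.aestronglyMeasurable, hasFiniteIntegral_iff_enorm.mpr ?_⟩
      rw [lintegral_pi_four hw.enorm.measurable]
      have h2 : eA (eB (eA (eB fun g => ‖F z g‖ₑ))) g < ⊤ := (hfin.fin g).lt_top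
      refine lt_of_eq_of_lt ?_ h2
      refine lintegral_congr fun y => lintegral_congr fun c => ?_
      exact lintegral_neg_haar fun v => eB (fun g => ‖F z g‖ₑ)
        (wα p * (xr p .a v * (wβ p * (xr p .b c * (wα p * (xr p .a y * g))))))
    refine h1.mul_bdd (c := C) (Continuous.aestronglyMeasurable
      (Complex.continuous_conj.comp ((hΨc.comp (continuous_apply _)).mul
        (continuous_psi.comp (by fun_prop))))) (ae_of_all _ fun u => ?_)
    rw [RCLike.norm_conj, norm_mul, norm_psi, mul_one]
    exact hC _
  -- The shear in z₁ absorbs the term -3yz, after which the four variables are independent.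
  have hT := measurePreserving_shear (p := p) (n := 3) 0 (τ := fun u => -(3 * u 2 * u 3)) (by fun_prop)
    (fun u x => by simp)
  have hfT : (fun u : Fin 4 → ℚ_[p] => F z (word (u 1) (-(u 3)) (u 0 - 3 * u 2 * u 3) (u 2) g) *
      (starRingEnd ℂ) (Ψ (u 2) * psi p (S * u 3))) =
      f ∘ fun u => Function.update u 0 (u 0 + -(3 * u 2 * u 3)) := by
    funext u
    simp [hf, sub_eq_add_neg]
  have hi := hT.integrable_comp_of_integrable hfi
  rw [hfT]
  refine ⟨hi, ?_⟩
  refine (MeasurePreserving.integral_comp_continuous hT hfc hi).2.symm.trans ?_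
  rw [integral_pi_four hfi]
  refine integral_congr_ae (ae_of_all _ fun y => ?_)
  simp only [hf, Matrix.cons_val, map_mul, conj_psi]
  rw [IT, IB, ← integral_const_mul]
  refine integral_congr_ae (ae_of_all _ fun c => ?_)
  simp only
  rw [IA, ← integral_const_mul, ← integral_neg_haar]
  refine integral_congr_ae (ae_of_all _ fun v => ?_)
  simp only [neg_neg, mul_neg]
  rw [integral_mul_const, IB, mul_comm, mul_assoc, mul_comm (psi p _)]
  rfl

theorem torus_neg_one (z : ℂ) (g : G2 p) : F z (hT (-1) 1 * g) = μ (-1) * F z g := by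
  rw [hF.torus]
  simp only [Units.val_one, mul_one]
  rw [qchr, chr_units]
  simp

/-- The Jacquet integral over the Heisenberg group, in terms of the rank one integrals. -/
theorem integral_five (z : ℂ) (hz : 1 / 2 - s.re < z.re) (S t : ℚ_[p]) (g : G2 p) :
    Integrable (fun a : Fin 5 → ℚ_[p] => F z (iota p * (nG p a * g)) * psi p (-(S * a 2 + t * a 0)))
      (Measure.pi fun _ => haar p) ∧
    ∫ a : Fin 5 → ℚ_[p], F z (iota p * (nG p a * g)) * psi p (-(S * a 2 + t * a 0))
      ∂(Measure.pi fun _ => haar p) =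
      μ (-1) * ∫ b, psi p (-(t * b)) *
        ∫ y, IT S (F z) (wα p * (xr p .a y * (wβ p * (xr p .b b * g)))) ∂haar p ∂haar p := by
  obtain ⟨-, -, -, -, ⟨_, _, hfin⟩⟩ := hF.finite z hz
  set f : (Fin 5 → ℚ_[p]) → ℂ := fun a => F z (word (-(a 3)) (-(a 2)) (a 4) (a 1)
    (wβ p * (xr p .b (a 0) * g))) * psi p (-(S * a 2 + t * a 0)) with hf
  have hfc : Continuous f := ((hF.continuous z).comp (continuous_word (by fun_prop) (by fun_prop)
    (by fun_prop) (by fun_prop) (continuous_const.mul (((continuous_xr .b).comp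
      (continuous_apply _)).mul continuous_const)))).mul (continuous_psi.comp (by fun_prop))
  have hfi : Integrable f (Measure.pi fun _ => haar p) := by
    refine ⟨hfc.aestronglyMeasurable, hasFiniteIntegral_iff_enorm.mpr ?_⟩
    rw [lintegral_pi_five hfc.enorm.measurable]
    have h2 : eB (eA (eB (eA (eB fun g => ‖F z g‖ₑ)))) g < ⊤ := (hfin.fin g).lt_top
    refine lt_of_eq_of_lt ?_ h2
    refine lintegral_congr fun b => lintegral_congr fun y => lintegral_congr fun c => ?_
    simp only [hf, enorm_mul_psi, Matrix.cons_val]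
    rw [← lintegral_neg_haar]
    refine lintegral_congr fun v => ?_
    rw [neg_neg]
    exact lintegral_neg_haar fun u => ‖F z (wβ p * (xr p .b u * (wα p * (xr p .a v *
      (wβ p * (xr p .b c * (wα p * (xr p .a y * (wβ p * (xr p .b b * g))))))))))‖ₑ
  -- The shear in the central coordinate passes from the coordinates of N to those of the word,
  -- without changing a₀ and a₂, on which the character depends.
  have hT := measurePreserving_shear (p := p) (n := 4) 4 (τ := fun a => 3 * a 1 * a 2 - a 3 * a 0)
    (by fun_prop) (fun u x => by simp)
  set f' : (Fin 5 → ℚ_[p]) → ℂ := fun a => F z (iota p * (nG p a * g)) * psi p (-(S * a 2 + t * a 0))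
    with hf'
  have hf'c : Continuous f' := ((hF.continuous z).comp (continuous_const.mul (continuous_nG.mul
    continuous_const))).mul (continuous_psi.comp (by fun_prop))
  have hfT : f' ∘ (fun a => Function.update a 4 (a 4 + (3 * a 1 * a 2 - a 3 * a 0))) =
      fun a => μ (-1) * f a := by
    funext a
    -- The torus element in `word_wβ` contributes μ(-1), which is its own inverse.
    have h1 := word_wβ (-(a 3)) (-(a 2)) (a 4) (a 1) (a 0) g
    have h2 : Function.update a 4 (a 4 + (3 * a 1 * a 2 - a 3 * a 0)) =
        ![a 0, a 1, - -a 2, - -a 3, -3 * -a 2 * a 1 + a 4 + -a 3 * a 0] := by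
      funext j
      fin_cases j <;> simp
      ring
    simp only [hf, hf', Function.comp_apply, h1, hF.torus_neg_one, h2]
    rw [mul_assoc (μ (-1) : ℂ), ← mul_assoc (μ (-1) : ℂ), mu_neg_one_mul, one_mul]
    simp
  have hi : Integrable (f' ∘ fun a => Function.update a 4 (a 4 + (3 * a 1 * a 2 - a 3 * a 0)))
      (Measure.pi fun _ => haar p) := by
    rw [hfT]; exact hfi.const_mul _
  obtain ⟨h1, h2⟩ := MeasurePreserving.integral_comp_continuous hT hf'c hi
  refine ⟨h1, h2.trans ((integral_congr_ae (ae_of_all _ fun a => congrFun hfT a)).trans ?_)⟩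
  rw [integral_const_mul, integral_pi_five hfi]
  congr 1
  refine integral_congr_ae (ae_of_all _ fun b => ?_)
  simp only [hf, Matrix.cons_val]
  rw [← integral_const_mul]
  refine integral_congr_ae (ae_of_all _ fun y => ?_)
  simp only
  rw [IT, IB, ← integral_const_mul]
  refine integral_congr_ae (ae_of_all _ fun c => ?_)
  simp only
  rw [IA, ← integral_const_mul, ← integral_neg_haar]
  refine integral_congr_ae (ae_of_all _ fun v => ?_)
  simp only [neg_neg, mul_neg]
  rw [integral_mul_const, IB, ← integral_neg_haar]
  have h3 : psi p (-(-(S * v) + t * b)) = psi p (-(t * b)) * psi p (S * v) := by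
    rw [← psi_add]; congr 1; ring
  simp only [neg_neg, h3]
  rw [mul_comm, mul_assoc, mul_comm (psi p (S * v))]
  rfl

end Fam

end WordIntegrals

/-! ### Schwartz functions, Gauss integrals and the Weil representation. -/

section Schwartz

variable {p : ℕ} [Fact p.Prime]

theorem IsSchwartz.exists_data {Φ : ℚ_[p] → ℂ} (h : IsSchwartz p Φ) :
    ∃ j N : ℕ, (∀ x, ∀ e ∈ ball p (-j), Φ (x + e) = Φ x) ∧ ∀ x ∈ (ball p N)ᶜ, Φ x = 0 := by
  obtain ⟨R, hR⟩ := (Metric.isBounded_iff_subset_closedBall (0 : ℚ_[p])).mp h.2.isCompact.isBounded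
  obtain ⟨N, hN⟩ := pow_unbounded_of_one_lt R (one_lt_p (p := p))
  have hsupp : ∀ x ∈ (ball p N)ᶜ, Φ x = 0 := fun x hx => by
    refine image_eq_zero_of_notMem_tsupport fun hc => hx ?_
    have := hR hc
    rw [mem_closedBall_zero_iff] at this
    rw [mem_ball, zpow_natCast]
    linarith
  have hloc : ∀ x, ∃ k : ℕ, ∀ e ∈ ball p (-k), Φ (x + e) = Φ x := fun x => by
    have h1 : ∀ᶠ e in nhds (0 : ℚ_[p]), Φ (x + e) = Φ x := by
      have h2 := h.1.eventually_eq x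
      have h3 : Tendsto (fun e : ℚ_[p] => x + e) (nhds 0) (nhds x) := by
        have : Continuous fun e : ℚ_[p] => x + e := by fun_prop
        simpa using this.tendsto 0
      exact h3.eventually h2
    obtain ⟨k, -, hk⟩ := exists_ball_subset h1
    exact ⟨k, fun e he => hk he⟩
  choose k hk using hloc
  -- Compactness of the ball makes the radius of local constancy uniform: the largest of finitely
  -- many levels works.
  obtain ⟨T, -, hT⟩ := (isCompact_ball (p := p) N).elim_nhds_subcover
    (fun x => coset x (k x)) (fun x _ => by
      have : coset x (k x) = (fun y => y - x) ⁻¹' ball p (-(k x)) := rfl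
      rw [this]
      have hc : Continuous fun y : ℚ_[p] => y - x := by fun_prop
      exact ((isOpen_ball _).preimage hc).mem_nhds (by simpa using zero_mem_ball _))
  refine ⟨T.sup k, N, fun x e he => ?_, hsupp⟩
  by_cases hx : x ∈ ball p N
  · have h1 := hT hx
    simp only [Set.mem_iUnion, exists_prop] at h1
    obtain ⟨y, hy, hxy⟩ := h1
    have he' : e ∈ ball p (-(k y) : ℤ) := ball_mono (by have := Finset.le_sup (f := k) hy; omega) he
    have e1 := hk y _ hxy
    have e2 := hk y _ (add_mem_ball hxy he')
    rw [show y + (x - y) = x by ring] at e1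
    rw [show y + (x - y + e) = x + e by ring] at e2
    rw [e1, e2]
  · rw [hsupp x hx, hsupp (x + e)]
    intro hc
    refine hx ?_
    have h2 : -e ∈ ball p N := neg_mem_ball (ball_mono (by omega) he)
    simpa using add_mem_ball hc h2

theorem IsSchwartz.of_data {Φ : ℚ_[p] → ℂ} {j N : ℕ} (h1 : ∀ x, ∀ e ∈ ball p (-j), Φ (x + e) = Φ x)
    (h2 : ∀ x ∈ (ball p N)ᶜ, Φ x = 0) : IsSchwartz p Φ := by
  constructor
  · rw [IsLocallyConstant.iff_eventually_eq]
    intro x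
    have hc : Continuous fun y : ℚ_[p] => y - x := by fun_prop
    have : ∀ᶠ y in nhds x, y - x ∈ ball p (-j) :=
      hc.continuousAt.eventually ((isOpen_ball _).mem_nhds (by simpa using zero_mem_ball _))
    filter_upwards [this] with y hy
    have := h1 x _ hy
    simpa using this
  · exact HasCompactSupport.intro (isCompact_ball N) fun x hx => h2 x hx

theorem IsSchwartz.continuous {Φ : ℚ_[p] → ℂ} (h : IsSchwartz p Φ) : Continuous Φ := h.1.continuous

theorem IsSchwartz.integrable {Φ : ℚ_[p] → ℂ} (h : IsSchwartz p Φ) : Integrable Φ (haar p) :=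
  h.continuous.integrable_of_hasCompactSupport h.2

theorem integrable_mul_psi {Φ : ℚ_[p] → ℂ} (h : Integrable Φ (haar p)) {a : ℚ_[p] → ℚ_[p]}
    (ha : Continuous a) : Integrable (fun x => psi p (a x) * Φ x) (haar p) := by
  refine (h.mul_bdd (c := 1) (g := fun x => psi p (a x)) ?_ ?_).congr (ae_of_all _ fun x => mul_comm _ _)
  · exact (continuous_psi.comp ha).aestronglyMeasurable
  · exact ae_of_all _ fun v => by rw [norm_psi]

/-- A function that oscillates under small translations has integral zero. -/
theorem integral_eq_zero_of_shift {G : ℚ_[p] → ℂ} (hG : Integrable G (haar p)) {a : ℚ_[p] → ℚ_[p]}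
    (ha : Continuous a) {n : ℤ} (h : ∀ e ∈ ball p n, ∀ x, G (x + e) = G x * psi p (a x * e))
    (hosc : ∀ x, G x ≠ 0 → 1 < ‖a x‖ * (p : ℝ) ^ n) : ∫ x, G x ∂haar p = 0 := by
  have h1 : ∀ e ∈ ball p n, ∫ x, G x ∂haar p = ∫ x, G x * psi p (a x * e) ∂haar p := fun e he => by
    rw [← integral_add_right_eq_self G e]
    simp only [h e he]
  have h2 : ∫ e in ball p n, (∫ x, G x ∂haar p) ∂haar p = ∫ e in ball p n,
      ∫ x, G x * psi p (a x * e) ∂haar p ∂haar p := setIntegral_congr_fun (measurableSet_ball _) h1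
  have : IsFiniteMeasure ((haar p).restrict (ball p n)) :=
    ⟨by rw [Measure.restrict_apply_univ]; exact haar_ball_lt_top _⟩
  have h3 : ∀ x, ∫ e in ball p n, G x * psi p (a x * e) ∂haar p = 0 := fun x => by
    rw [integral_const_mul]
    by_cases hx : G x = 0
    · rw [hx, zero_mul]
    · rw [integral_ball_psi (hosc x hx), mul_zero]
  have h4 : Integrable (fun z : ℚ_[p] × ℚ_[p] => G z.2) (((haar p).restrict (ball p n)).prod (haar p)) :=
    hG.comp_snd _
  have h5 : Integrable (Function.uncurry fun e x => G x * psi p (a x * e))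
      (((haar p).restrict (ball p n)).prod (haar p)) := by
    refine (h4.mul_bdd (c := 1) (g := fun z => psi p (a z.2 * z.1)) ?_ ?_).congr
      (ae_of_all _ fun z => by simp [Function.uncurry])
    · exact (continuous_psi.comp ((ha.comp continuous_snd).mul continuous_fst)).aestronglyMeasurable
    · exact ae_of_all _ fun z => by rw [norm_psi]
  rw [integral_integral_swap h5] at h2
  simp only [h3, integral_zero] at h2
  rw [setIntegral_const, haar_ball_real] at h2
  exact (smul_eq_zero.mp h2).resolve_left (zpow_pos p_pos _).ne'

/-- The Fourier transform of `x ↦ ψ(S b x²) Φ(x)`. -/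
def chirp (S b : ℚ_[p]) (Φ : ℚ_[p] → ℂ) (y : ℚ_[p]) : ℂ :=
  ∫ x, psi p (S * (-2 * y * x + b * x ^ 2)) * Φ x ∂haar p

/-- Fourier duality: the compact support of Φ gives local constancy of the transform, and the local
constancy of Φ times the quadratic phase on its support gives compact support. -/
theorem isSchwartz_chirp {S : ℚ_[p]} (hS : S ≠ 0) (b : ℚ_[p]) {Φ : ℚ_[p] → ℂ} (hΦ : IsSchwartz p Φ) :
    IsSchwartz p (chirp S b Φ) := by
  obtain ⟨j, N, hj, hN⟩ := hΦ.exists_data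
  obtain ⟨m, hm⟩ := exists_mem_ball (2 * S)
  obtain ⟨l, hl⟩ := exists_mem_ball (S * b)
  have h2S : (2 : ℚ_[p]) * S ≠ 0 := mul_ne_zero two_ne_zero hS
  obtain ⟨r, hr⟩ := exists_norm_eq_zpow h2S
  obtain ⟨l', hl'⟩ := exists_mem_ball (2 * (S * b))
  set i := max j (max l (l' + N))
  -- At scale p^(-i) both Φ and the quadratic phase on its support are constant; with |2S| = p^r the
  -- linear phase oscillates at that scale once |y| > p^(i-r).
  refine IsSchwartz.of_data (j := m + N) (N := (i - r).toNat) (fun y e he => ?_) fun y hy => ?_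
  · refine integral_congr_ae (ae_of_all _ fun x => ?_)
    simp only
    by_cases hx : x ∈ ball p N
    · congr 1
      rw [show S * (-2 * (y + e) * x + b * x ^ 2) = S * (-2 * y * x + b * x ^ 2) + -(2 * S * e * x) by ring]
      refine psi_add_of_norm_le_one (norm_le_one_iff_ball.mpr (neg_mem_ball ?_))
      refine ball_mono ?_ (mul_mem_ball (mul_mem_ball hm he) hx)
      push_cast; omega
    · rw [hN x hx, mul_zero, mul_zero]
  · refine integral_eq_zero_of_shift (a := fun _ => -(2 * S) * y) (n := -(i : ℤ))
      (integrable_mul_psi hΦ.integrable (by fun_prop)) continuous_const (fun e he x => ?_) fun x _ => ?_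
    · rw [hj x e (ball_mono (by omega) he)]
      by_cases hx : x ∈ ball p N
      · rw [mul_right_comm (psi p _) (Φ x), ← psi_add]
        congr 1
        rw [show S * (-2 * y * (x + e) + b * (x + e) ^ 2) = S * (-2 * y * x + b * x ^ 2) + -(2 * S) * y * e +
          (2 * (S * b) * x * e + S * b * e * e) by ring]
        refine psi_add_of_norm_le_one (norm_le_one_iff_ball.mpr (add_mem_ball ?_ ?_))
        · refine ball_mono ?_ (mul_mem_ball (mul_mem_ball hl' hx) he)
          omega
        · refine ball_mono ?_ (mul_mem_ball (mul_mem_ball hl he) he)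
          omega
      · rw [hN x hx]; simp
    · have h1 := notMem_ball.mp hy
      rw [norm_mul, norm_neg, hr]
      have h4 : (p : ℝ) ^ ((i : ℤ) - r) < ‖y‖ :=
        lt_of_le_of_lt (zpow_le_zpow_right₀ one_lt_p.le (by omega)) h1
      calc (1 : ℝ) = (p : ℝ) ^ r * (p : ℝ) ^ ((i : ℤ) - r) * (p : ℝ) ^ (-i : ℤ) := by
            rw [← zpow_add₀ p_pos.ne', ← zpow_add₀ p_pos.ne']; simp
        _ < _ := by
            have := p_pos (p := p)
            gcongr

theorem IsSchwartz.comp_mul {Φ : ℚ_[p] → ℂ} (hΦ : IsSchwartz p Φ) {a : ℚ_[p]} (ha : a ≠ 0) :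
    IsSchwartz p (fun t => Φ (a * t)) :=
  ⟨hΦ.1.comp_continuous (by fun_prop), hΦ.2.comp_homeomorph (Homeomorph.mulLeft₀ a ha)⟩

theorem IsSchwartz.const_psi_mul {Φ : ℚ_[p] → ℂ} (hΦ : IsSchwartz p Φ) (κ : ℂ) {a : ℚ_[p] → ℚ_[p]}
    (ha : Continuous a) : IsSchwartz p (fun t => κ * psi p (a t) * Φ t) := by
  have hψ : IsLocallyConstant (psi p) := by
    rw [IsLocallyConstant.iff_eventually_eq]
    intro x
    have : Continuous fun y => y - x := by fun_prop
    have : ∀ᶠ y in nhds x, y - x ∈ ball p 0 :=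
      this.continuousAt.eventually ((isOpen_ball 0).mem_nhds (by simpa using zero_mem_ball 0))
    filter_upwards [this] with y hy
    have : y = x + (y - x) := by ring
    rw [this, psi_add_of_norm_le_one (norm_le_one_iff_ball.mpr hy)]
  exact ⟨((IsLocallyConstant.const κ).mul (hψ.comp_continuous ha)).mul hΦ.1, hΦ.2.mul_left⟩

theorem integral_selfDual (S : ℚ_[p]) (f : ℚ_[p] → ℂ) :
    ∫ x, f x ∂selfDual p S = ((‖2 * S‖ ^ ((1 : ℝ) / 2) : ℝ) : ℂ) * ∫ x, f x ∂haar p := by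
  rw [selfDual, integral_smul_measure, ENNReal.toReal_ofReal (by positivity), Complex.real_smul]

/-- For c = 0 the operator is a dilation times a phase. Otherwise it is a phase times `chirp` with
parameter -d/c, evaluated at -t/c. -/
theorem isSchwartz_weilSL {S : ℚ_[p]} (hS : S ≠ 0) (h : Mp p) {Φ : ℚ_[p] → ℂ} (hΦ : IsSchwartz p Φ) :
    IsSchwartz p (weilSL p S h Φ) := by
  by_cases hc : h.1.val 1 0 = 0
  · have hdet := h.1.det_coe
    rw [Matrix.det_fin_two, hc] at hdet
    have ha : h.1.val 0 0 ≠ 0 := fun h0 => by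
      rw [h0] at hdet; simp at hdet
    have := (hΦ.comp_mul ha).const_psi_mul ((((h.2 : ℤ) : ℂ)) * (weilConst p S /
      weilConst p (h.1.val 0 0 * S)) * ((‖h.1.val 0 0‖ ^ ((1 : ℝ) / 2) : ℝ) : ℂ))
      (a := fun t => S * (-(h.1.val 0 0 * h.1.val 0 1) * t ^ 2)) (by fun_prop)
    convert this using 2
    simp only [weilSL, hc, if_true]
  · have h1 := (isSchwartz_chirp hS (-(h.1.val 1 1 / h.1.val 1 0)) hΦ).comp_mul
      (a := -(h.1.val 1 0)⁻¹) (by simpa using hc)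
    have := h1.const_psi_mul ((((h.2 : ℤ) : ℂ)) * weilConst p (S / h.1.val 1 0) *
      ((‖h.1.val 1 0‖ ^ (-(1 : ℝ) / 2) : ℝ) : ℂ) * ((‖2 * S‖ ^ ((1 : ℝ) / 2) : ℝ) : ℂ))
      (a := fun t => S * (-(h.1.val 0 0 / h.1.val 1 0) * t ^ 2)) (by fun_prop)
    convert this using 2 with t
    simp only [weilSL, hc, if_false, integral_selfDual, chirp]
    have e1 : ∀ x, S * (2 / h.1.val 1 0 * t * x - h.1.val 1 1 / h.1.val 1 0 * x ^ 2) =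
        S * (-2 * (-(h.1.val 1 0)⁻¹ * t) * x + -(h.1.val 1 1 / h.1.val 1 0) * x ^ 2) := fun x => by ring
    simp only [e1]
    ring

theorem wβMat_mul_xβMat (b : ℚ_[p]) : ((wβMat p * xβMat p b : Matrix.SpecialLinearGroup (Fin 2) ℚ_[p]) :
    Matrix (Fin 2) (Fin 2) ℚ_[p]) = !![0, 1; -1, b] := by
  rw [Matrix.SpecialLinearGroup.coe_mul, wβMat_val]
  change !![0, 1; -1, 0] * !![1, -b; 0, 1] = _
  simp

theorem weilSL_wβ_xβ (S b : ℚ_[p]) (Φ : ℚ_[p] → ℂ) (t : ℚ_[p]) :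
    weilSL p S (wβMat p * xβMat p b, 1) Φ t =
      weilConst p (-S) * ((‖2 * S‖ ^ ((1 : ℝ) / 2) : ℝ) : ℂ) * chirp S b Φ t := by
  have h := wβMat_mul_xβMat b
  have h00 : (wβMat p * xβMat p b).val 0 0 = 0 := by rw [h]; rfl
  have h10 : (wβMat p * xβMat p b).val 1 0 = -1 := by rw [h]; rfl
  have h11 : (wβMat p * xβMat p b).val 1 1 = b := by rw [h]; rfl
  unfold weilSL
  dsimp only
  rw [if_neg (by rw [h10]; norm_num), integral_selfDual, h00, h10, h11, chirp]
  have e1 : ∀ x, S * (2 / -1 * t * x - b / -1 * x ^ 2) = S * (-2 * t * x + b * x ^ 2) := fun x => by ring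
  rw [show S * (-(0 / -1) * t ^ 2) = 0 by ring, psi_zero]
  simp only [e1]
  simp only [norm_neg, norm_one, Real.one_rpow, Units.val_one, Int.cast_one, Complex.ofReal_one, div_neg,
    div_one]
  ring

theorem heightSL_wβ_xβ (b : ℚ_[p]) : heightSL p (wβMat p * xβMat p b) = (max 1 ‖b‖)⁻¹ := by
  simp [heightSL, wβMat_mul_xβMat b]

/-- The quadratic Gauss integral over a ball. -/
def gaussBall (S : ℚ_[p]) (j : ℕ) (b : ℚ_[p]) : ℂ := ∫ x in ball p (-j), psi p (S * b * x ^ 2) ∂haar p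

/-- Hensel's lemma for X² - (1 + e) at the approximate root 1. The bound p⁻³ < |2|² covers p = 2 as
well, where |2| = 1/p. -/
theorem exists_sq_eq {e : ℚ_[p]} (he : e ∈ ball p (-3 : ℤ)) : ∃ δ : ℚ_[p], δ ^ 2 = 1 + e ∧ ‖δ‖ = 1 := by
  have h1 : ‖1 + e‖ = 1 := norm_one_add (k := 3) (by omega) (by simpa using he)
  obtain ⟨v, hv⟩ : ∃ v : ℤ_[p], (v : ℚ_[p]) = 1 + e := ⟨⟨_, h1.le⟩, rfl⟩
  have hp := one_lt_p (p := p)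
  have h2 : (p : ℝ)⁻¹ ≤ ‖(2 : ℚ_[p])‖ := by
    by_cases h : p = 2
    · subst h
      have := Padic.norm_p (p := 2)
      rw [Nat.cast_ofNat] at this
      rw [this]
    · have h3 : ¬ (p : ℤ) ∣ 2 := fun hd => h ((Nat.prime_dvd_prime_iff_eq Fact.out Nat.prime_two).mp
        (by exact_mod_cast hd))
      have h4 : ‖((2 : ℤ) : ℚ_[p])‖ = 1 := le_antisymm (Padic.norm_int_le_one 2)
        (not_lt.mp fun hlt => h3 (Padic.norm_intCast_lt_one_iff.mp hlt))
      rw [Int.cast_ofNat] at h4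
      rw [h4]
      exact inv_le_one_of_one_le₀ hp.le
  obtain ⟨δ, h3, -⟩ := hensels_lemma (p := p) (R := ℤ_[p]) (F := Polynomial.X ^ 2 - Polynomial.C v) (a := 1) (by
    have e1 : ‖(1 : ℤ_[p]) - v‖ ≤ (p : ℝ) ^ (-3 : ℤ) := by
      rw [PadicInt.norm_def, PadicInt.coe_sub, hv, PadicInt.coe_one, sub_add_cancel_left, norm_neg]
      exact he
    have e2 : ‖(2 : ℤ_[p])‖ = ‖(2 : ℚ_[p])‖ := rfl
    simp only [map_sub, map_pow, Polynomial.aeval_X, Polynomial.aeval_C, Algebra.algebraMap_self,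
      RingHom.id_apply, one_pow, Polynomial.derivative_X_pow,
      Polynomial.derivative_C, sub_zero]
    simp only [map_mul, Polynomial.aeval_C, map_pow, Polynomial.aeval_X]
    norm_num
    rw [e2]
    refine lt_of_le_of_lt e1 (lt_of_lt_of_le ?_ (pow_le_pow_left₀ (by positivity) h2 2))
    rw [inv_pow, ← zpow_natCast, ← zpow_neg]
    exact zpow_lt_zpow_right₀ hp (by norm_num))
  have h4 : (δ : ℚ_[p]) ^ 2 = 1 + e := by
    have : δ ^ 2 - v = 0 := by simpa using h3
    rw [← hv, ← PadicInt.coe_pow, sub_eq_zero.mp this]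
  refine ⟨δ, h4, ?_⟩
  have h5 : ‖(δ : ℚ_[p])‖ ^ 2 = 1 := by rw [← norm_pow, h4, h1]
  exact (pow_eq_one_iff_of_nonneg (norm_nonneg _) two_ne_zero).mp h5

/-- Since 1 + e is the square of a unit, it can be absorbed by a substitution in x. Thus the Gauss
integral does not spoil the multiplicative invariance needed at infinity. -/
theorem gaussBall_mul (S : ℚ_[p]) (j : ℕ) (b : ℚ_[p]) {e : ℚ_[p]} (he : e ∈ ball p (-3 : ℤ)) :
    gaussBall S j (b * (1 + e)) = gaussBall S j b := by
  obtain ⟨δ, hδ, hn⟩ := exists_sq_eq he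
  unfold gaussBall
  rw [← integral_indicator (measurableSet_ball _), ← integral_indicator (measurableSet_ball _),
    ← integral_comp_mul_of_norm_one hn ((ball p (-j)).indicator fun x => psi p (S * b * x ^ 2))]
  congr 1 with x
  have hx : δ * x ∈ ball p (-j : ℤ) ↔ x ∈ ball p (-j : ℤ) := by
    rw [mem_ball, mem_ball, norm_mul, hn, one_mul]
  by_cases h : x ∈ ball p (-j : ℤ)
  · rw [Set.indicator_of_mem h, Set.indicator_of_mem (hx.mpr h), ← hδ]
    congr 1; ring
  · rw [Set.indicator_of_notMem h, Set.indicator_of_notMem (fun hc => h (hx.mp hc))]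

theorem norm_gaussBall_le (S : ℚ_[p]) (j : ℕ) (b : ℚ_[p]) : ‖gaussBall S j b‖ ≤ (p : ℝ) ^ (-j : ℤ) := by
  have := norm_setIntegral_le_of_norm_le_const (μ := haar p) (s := ball p (-j)) (C := 1)
    (f := fun x => psi p (S * b * x ^ 2)) (haar_ball_lt_top _) (fun x _ => by rw [norm_psi])
  rwa [one_mul, haar_ball_real] at this

/-- Stationary phase: completing the square leaves ∫ ψ(Sbx²) Φ(x + y) dx, and for large b only the
ball p^j ℤ_p, on which Φ(x + y) = Φ(y), contributes. -/
theorem chirp_large {S : ℚ_[p]} (hS : S ≠ 0) {Φ : ℚ_[p] → ℂ} (hΦ : IsSchwartz p Φ) {j : ℕ}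
    (hj : ∀ x, ∀ e ∈ ball p (-j), Φ (x + e) = Φ x) :
    ∃ M : ℕ, ∀ b ∈ (ball p M)ᶜ, ∀ y,
      chirp S b Φ (b * y) = psi p (-(S * b * y ^ 2)) * gaussBall S j b * Φ y := by
  obtain ⟨r, hr⟩ := exists_norm_eq_zpow hS
  obtain ⟨l, hl⟩ := exists_norm_eq_zpow (p := p) (x := 2) two_ne_zero
  refine ⟨(2 * j - 2 * l - r + 1).toNat + (2 * j - r).toNat, fun b hb y => ?_⟩
  obtain ⟨m, hm⟩ := exists_norm_eq_zpow (ne_zero_of_notMem_ball hb)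
  have hb' := notMem_ball.mp hb
  rw [hm] at hb'
  have hb2 := (zpow_lt_zpow_iff_right₀ one_lt_p).mp hb'
  have hl0 : l ≤ 0 := by
    have : ‖(2 : ℚ_[p])‖ ≤ 1 := by exact_mod_cast Padic.norm_int_le_one (p := p) 2
    rw [hl] at this
    by_contra hc
    have := one_lt_zpow₀ (one_lt_p (p := p)) (by omega : 0 < l)
    linarith
  have h1 : chirp S b Φ (b * y) = psi p (-(S * b * y ^ 2)) * ∫ x, psi p (S * b * x ^ 2) * Φ (x + y) ∂haar p := by
    rw [chirp, ← integral_add_right_eq_self _ y, ← integral_const_mul]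
    refine integral_congr_ae (ae_of_all _ fun x => ?_)
    simp only
    rw [← mul_assoc (psi p _), ← psi_add]
    congr 2; ring
  have hint : Integrable (fun x => psi p (S * b * x ^ 2) * Φ (x + y)) (haar p) :=
    integrable_mul_psi (hΦ.integrable.comp_add_right y) (by fun_prop)
  rw [h1, mul_assoc (psi p _) (gaussBall S j b)]
  congr 1
  rw [← integral_add_compl (measurableSet_ball (-j)) hint]
  have h2 : ∫ x in ball p (-j), psi p (S * b * x ^ 2) * Φ (x + y) ∂haar p = gaussBall S j b * Φ y := by
    rw [gaussBall, ← integral_mul_const]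
    refine setIntegral_congr_fun (measurableSet_ball _) fun x hx => ?_
    rw [add_comm x y, hj y x hx]
  rw [h2, add_eq_left, ← integral_indicator (measurableSet_ball _).compl]
  -- Half the exponent of |Sb|, rounded up: for |e| ≤ p^(-i) the term Sbe² is integral, while 2Sbxe
  -- still oscillates for |x| > p^(-j).
  set i : ℤ := (m + r + 1) / 2
  refine integral_eq_zero_of_shift (a := fun x => 2 * (S * b) * x) (n := -i)
    (hint.indicator (measurableSet_ball _).compl) (by fun_prop) (fun e he x => ?_) fun x hx => ?_
  · have he' : e ∈ ball p (-j : ℤ) := ball_mono (by omega) he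
    by_cases hx : x ∈ ball p (-j : ℤ)
    · have hx2 : x + e ∉ (ball p (-j : ℤ))ᶜ := fun h => h (add_mem_ball hx he')
      have hx1 : x ∉ (ball p (-j : ℤ))ᶜ := fun h => h hx
      rw [Set.indicator_of_notMem hx2, Set.indicator_of_notMem hx1, zero_mul]
    · have hx2 : x + e ∉ ball p (-j : ℤ) := fun h => hx (by simpa using add_mem_ball h (neg_mem_ball he'))
      rw [Set.indicator_of_mem (a := x) hx, Set.indicator_of_mem (a := x + e) hx2, show x + e + y = x + y + e by ring,
        hj _ _ he', mul_right_comm (psi p _) (Φ _), ← psi_add]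
      congr 1
      rw [show S * b * (x + e) ^ 2 = S * b * x ^ 2 + 2 * (S * b) * x * e + S * b * e * e by ring]
      refine psi_add_of_norm_le_one ?_
      have hSb : S * b ∈ ball p (r + m) := by
        rw [mem_ball, norm_mul, hr, hm, zpow_add₀ p_pos.ne']
      refine norm_le_one_iff_ball.mpr (ball_mono ?_ (mul_mem_ball (mul_mem_ball hSb he) he))
      omega
  · have hx1 : x ∈ (ball p (-j : ℤ))ᶜ := by
      by_contra hc
      exact hx (Set.indicator_of_notMem hc _)
    have h3 := notMem_ball.mp hx1
    have hp := p_pos (p := p)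
    rw [norm_mul, norm_mul, norm_mul, hl, hr, hm]
    calc (1 : ℝ) ≤ (p : ℝ) ^ (l + (r + m) + (-j) + -i) := one_le_zpow₀ one_lt_p.le (by omega)
      _ = (p : ℝ) ^ l * ((p : ℝ) ^ r * (p : ℝ) ^ m) * (p : ℝ) ^ (-j : ℤ) * (p : ℝ) ^ (-i) := by
          rw [zpow_add₀ hp.ne', zpow_add₀ hp.ne', zpow_add₀ hp.ne', zpow_add₀ hp.ne']
      _ < _ := by gcongr

/-- The sequence is eventually constant, since ψ(ax²) integrates to zero over the differences of
large balls. Convergence gives the limit in the definition of the Weil constant its meaning. -/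
theorem tendsto_gauss {a : ℚ_[p]} (ha : a ≠ 0) : ∃ L, Tendsto (fun k : ℕ =>
    ∫ x in Metric.closedBall (0 : ℚ_[p]) ((p : ℝ) ^ k), psi p (a * x ^ 2) ∂(haar p)) atTop (nhds L) := by
  obtain ⟨i, hi⟩ := exists_mem_ball a
  obtain ⟨r, hr⟩ := exists_norm_eq_zpow (mul_ne_zero two_ne_zero ha)
  have hball : ∀ k : ℕ, Metric.closedBall (0 : ℚ_[p]) ((p : ℝ) ^ k) = ball p k := fun k => by
    rw [ball_eq, zpow_natCast]
  simp only [hball]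
  set M := (i - r).toNat with hM
  have hint : ∀ n : ℤ, IntegrableOn (fun x => psi p (a * x ^ 2)) (ball p n) (haar p) := fun n => by
    refine ContinuousOn.integrableOn_compact (isCompact_ball n) (Continuous.continuousOn ?_)
    exact continuous_psi.comp (by fun_prop)
  refine ⟨∫ x in ball p M, psi p (a * x ^ 2) ∂haar p, tendsto_atTop_of_eventually_const (i₀ := M) fun k hk => ?_⟩
  have hsub : ball p (M : ℤ) ⊆ ball p k := ball_mono (by exact_mod_cast hk)
  rw [← sub_eq_zero, ← setIntegral_sdiff (measurableSet_ball _) (hint k) hsub]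
  have hms : MeasurableSet (ball p k \ ball p (M : ℤ)) := (measurableSet_ball _).diff (measurableSet_ball _)
  rw [← integral_indicator hms]
  refine integral_eq_zero_of_shift (a := fun x => 2 * a * x) (n := -i)
    (((hint k).mono_set Set.sdiff_subset).integrable_indicator hms) (by fun_prop) (fun e he x => ?_)
    fun x hx => ?_
  · have hs : x + e ∈ ball p k \ ball p (M : ℤ) ↔ x ∈ ball p k \ ball p (M : ℤ) := by
      have he1 : e ∈ ball p (k : ℤ) := ball_mono (by omega) he
      have he2 : e ∈ ball p (M : ℤ) := ball_mono (by omega) he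
      have key : ∀ n : ℤ, e ∈ ball p n → (x + e ∈ ball p n ↔ x ∈ ball p n) := fun n hn =>
        ⟨fun h => by simpa using add_mem_ball h (neg_mem_ball hn), fun h => add_mem_ball h hn⟩
      rw [Set.mem_sdiff, Set.mem_sdiff, key _ he1, key _ he2]
    by_cases hx : x ∈ ball p k \ ball p (M : ℤ)
    · rw [Set.indicator_of_mem hx, Set.indicator_of_mem (hs.mpr hx), ← psi_add,
        show a * (x + e) ^ 2 = a * x ^ 2 + 2 * a * x * e + a * e * e by ring]
      refine psi_add_of_norm_le_one (norm_le_one_iff_ball.mpr (ball_mono ?_ (mul_mem_ball (mul_mem_ball hi he) he)))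
      omega
    · rw [Set.indicator_of_notMem hx, Set.indicator_of_notMem (fun h => hx (hs.mp h)), zero_mul]
  · have hx1 : x ∈ ball p k \ ball p (M : ℤ) := by
      by_contra hc
      exact hx (Set.indicator_of_notMem hc _)
    have h3 := notMem_ball.mp hx1.2
    have hp := p_pos (p := p)
    rw [norm_mul, hr]
    calc (1 : ℝ) ≤ (p : ℝ) ^ (r + M + -i) := one_le_zpow₀ one_lt_p.le (by omega)
      _ = (p : ℝ) ^ r * (p : ℝ) ^ (M : ℤ) * (p : ℝ) ^ (-i : ℤ) := by
          rw [zpow_add₀ hp.ne', zpow_add₀ hp.ne']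
      _ < _ := by gcongr

/-- The operator of w_β carries γ(-S) and enters β_S conjugated; this is why γ(S) appears in the
final formula. -/
theorem conj_weilConst_neg {S : ℚ_[p]} (hS : S ≠ 0) :
    (starRingEnd ℂ) (weilConst p (-S)) = weilConst p S := by
  obtain ⟨L, hL⟩ := tendsto_gauss hS
  have hL' := (Complex.continuous_conj.tendsto L).comp hL
  have h2 : (starRingEnd ℂ ∘ fun k : ℕ =>
      ∫ x in Metric.closedBall (0 : ℚ_[p]) ((p : ℝ) ^ k), psi p (S * x ^ 2) ∂(haar p)) = fun k : ℕ =>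
      ∫ x in Metric.closedBall (0 : ℚ_[p]) ((p : ℝ) ^ k), psi p (-S * x ^ 2) ∂(haar p) := by
    funext k
    rw [Function.comp_apply, ← integral_conj]
    simp only [conj_psi, neg_mul]
  rw [h2] at hL'
  rw [weilConst, weilConst, hL.limUnder_eq, hL'.limUnder_eq]
  simp

end Schwartz

/-! ### The Fourier–Jacobi integral and its asymptotics on SL₂. -/

section FourierJacobi

variable {p : ℕ} [Fact p.Prime]

theorem zpow_cpow (m : ℤ) (w : ℂ) : (((p : ℝ) ^ m : ℝ) : ℂ) ^ w = (p : ℂ) ^ ((m : ℂ) * w) := by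
  have h1 : (((p : ℝ) ^ m : ℝ) : ℂ) ≠ 0 := by exact_mod_cast (zpow_pos p_pos m).ne'
  rw [Complex.cpow_def_of_ne_zero h1, Complex.cpow_def_of_ne_zero p_ne_zero_complex,
    ← Complex.ofReal_log (zpow_pos p_pos m).le, Real.log_zpow, ← Complex.natCast_log]
  push_cast
  ring_nf

theorem isRat_qchr_inv (μ : ℚ_[p]ˣ →* Circle) (s : ℂ) {b : ℚ_[p]} (hb : b ≠ 0) :
    IsRat p (fun z => (qchr μ (s + z + 3 / 2) b)⁻¹) (qchr μ (s + 3 / 2) b)⁻¹ := by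
  obtain ⟨m, hm⟩ := exists_norm_eq_zpow hb
  have h0 : (‖b‖ : ℂ) ≠ 0 := by simpa using hb
  have key : ∀ z : ℂ, (‖b‖ : ℂ) ^ (-z) = (p : ℂ) ^ (((-m : ℤ) : ℂ) * z) := fun z => by
    rw [hm, zpow_cpow]
    congr 1; push_cast; ring
  have h1 := ((IsRat.const (p := p) (qchr μ (s + 3 / 2) b)⁻¹).mul (IsRat.cpow (p := p) (-m)))
  rw [mul_one] at h1
  refine h1.congr 0 fun z _ => ?_
  rw [← key, qchr, qchr, show s + z + 3 / 2 = (s + 3 / 2) + z by ring, Complex.cpow_add (s + 3 / 2) z h0, Complex.cpow_neg]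
  simp only [mul_inv]
  ring

variable {μ : ℚ_[p]ˣ →* Circle} {s : ℂ} {K : Subgroup (G2 p)} {F : ℂ → G2 p → ℂ} {F₀ : G2 p → ℂ}

/-- The integral of a triple integral against a Schwartz function. -/
def pairIT (Ψ : ℚ_[p] → ℂ) (T : G2 p → ℂ) (g : G2 p) : ℂ :=
  ∫ y, (starRingEnd ℂ) (Ψ y) * T (wα p * (xr p .a y * g)) ∂haar p

theorem pairIT_eq_ball {Ψ : ℚ_[p] → ℂ} {N : ℕ} (hN : ∀ x ∈ (ball p N)ᶜ, Ψ x = 0) (T : G2 p → ℂ) (g : G2 p) :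
    ∫ y in ball p N, (starRingEnd ℂ) (Ψ y) * T (wα p * (xr p .a y * g)) ∂haar p = pairIT Ψ T g :=
  setIntegral_eq_integral_of_forall_compl_eq_zero fun y hy => by
    rw [hN y hy, map_zero, zero_mul]

namespace Fam

variable (hF : Fam μ s K F F₀)

include hF

/-- The support of Ψ confines y to a ball independent of z, so no new pole arises. -/
theorem rat_pairIT {S : ℚ_[p]} {T₀ : G2 p → ℂ} (hT : ∀ g, IsRat p (fun z => IT S (F z) g) (T₀ g))
    {Ψ : ℚ_[p] → ℂ} (hΨ : IsSchwartz p Ψ) (g : G2 p) :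
    IsRat p (fun z => pairIT Ψ (IT S (F z)) g) (pairIT Ψ T₀ g) := by
  obtain ⟨j, N, hj, hN⟩ := hΨ.exists_data
  obtain ⟨k, -, hk, -⟩ := exists_radius_a hF.isOpen g
  rw [← pairIT_eq_ball hN]
  simp only [← pairIT_eq_ball hN]
  refine IsRat.ballIntegral N (max j k) 0 (fun z _ y e he => ?_) fun y => (IsRat.const _).mul (hT _)
  rw [hj y e (ball_mono (by push_cast; omega) he),
    periodic_a (hF.IT_inv S z) hk _ _ (ball_mono (by push_cast; omega) he)]

/-- The behaviour of the Fourier–Jacobi integral at infinity. -/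
theorem pairIT_large {S : ℚ_[p]} (hS : S ≠ 0) {Φ : ℚ_[p] → ℂ} (hΦ : IsSchwartz p Φ) :
    ∃ M j : ℕ, 1 ≤ M ∧ ∀ z, ∀ b ∈ (ball p M)ᶜ,
      pairIT (chirp S b Φ) (IT S (F z)) (wβ p * xr p .b b) =
        (qchr μ (s + z + 3 / 2) b)⁻¹ * ((‖b‖ : ℝ) * (starRingEnd ℂ) (gaussBall S j b) *
          pairIT Φ (IT S (F z)) 1) := by
  obtain ⟨j, N, hj, hN⟩ := hΦ.exists_data
  obtain ⟨M, hM⟩ := chirp_large hS hΦ hj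
  obtain ⟨k, hk, -, h2⟩ := exists_radius_b hF.isOpen (1 : G2 p)
  refine ⟨max M k, j, by omega, fun z b hb => ?_⟩
  have hbM : b ∈ (ball p M)ᶜ := fun h => hb (ball_mono (by push_cast; omega) h)
  have hbk : b ∈ (ball p k)ᶜ := fun h => hb (ball_mono (by push_cast; omega) h)
  have hb0 := ne_zero_of_notMem_ball hb
  obtain ⟨u, rfl⟩ : ∃ v : ℚ_[p]ˣ, b = v := ⟨Units.mk0 b hb0, rfl⟩
  -- The Bruhat relation for w_β x_β(b): its unipotent factor gives the phase ψ(-Sy²/b), and its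
  -- torus factor gives the quasi-character and rescales y to y/b.
  have h3 : ∀ y, IT S (F z) (wα p * (xr p .a y * (wβ p * xr p .b u))) =
      (qchr μ (s + z + 3 / 2) u)⁻¹ * (psi p (-(S * u * (y * (u : ℚ_[p])⁻¹) ^ 2)) *
        IT S (F z) (wα p * (xr p .a (y * (u : ℚ_[p])⁻¹) * 1))) := fun y => by
    have e1 := wβ_large (hF.IT_inv S z) h2 u hbk (wα p * xr p .a y)
    simp only [mul_assoc, mul_one] at e1
    have e2 := ((hF.uinv z).IT_wα_xa S y (-(u : ℚ_[p])⁻¹) (hT 1 u⁻¹)).1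
    have e3 := wα_xa_hT y 1 1 u⁻¹
    rw [mul_one] at e3
    rw [e1, e2, e3, hF.IT_hT]
    simp only [Units.val_inv_eq_inv_val, Units.val_one, inv_one, mul_one]
    rw [mul_left_comm]
    congr 3
    field_simp
  unfold pairIT
  simp only [h3]
  -- In the variable y/b this phase cancels the conjugate of the one in `chirp_large`; the
  -- substitution then contributes |b|.
  have h4 : ∀ y, (starRingEnd ℂ) (chirp S u Φ y) * ((qchr μ (s + z + 3 / 2) u)⁻¹ *
      (psi p (-(S * u * (y * (u : ℚ_[p])⁻¹) ^ 2)) *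
        IT S (F z) (wα p * (xr p .a (y * (u : ℚ_[p])⁻¹) * 1)))) =
      (qchr μ (s + z + 3 / 2) u)⁻¹ * (fun y => (starRingEnd ℂ) (gaussBall S j u) * ((starRingEnd ℂ) (Φ y) *
        IT S (F z) (wα p * (xr p .a y * 1)))) ((u : ℚ_[p])⁻¹ * y) := fun y => by
    have e1 := hM u hbM ((u : ℚ_[p])⁻¹ * y)
    rw [mul_inv_cancel_left₀ hb0] at e1
    rw [e1, map_mul, map_mul, conj_psi, neg_neg, mul_comm y]
    have e2 := psi_neg_mul (S * (u : ℚ_[p]) * ((u : ℚ_[p])⁻¹ * y) ^ 2)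
    simp only []
    linear_combination (qchr μ (s + z + 3 / 2) u)⁻¹ * (starRingEnd ℂ) (gaussBall S j u) *
      (starRingEnd ℂ) (Φ ((u : ℚ_[p])⁻¹ * y)) *
        IT S (F z) (wα p * (xr p .a ((u : ℚ_[p])⁻¹ * y) * 1)) * e2
  simp only [h4]
  rw [integral_const_mul, integral_comp_mul (inv_ne_zero hb0) (fun y =>
    (starRingEnd ℂ) (gaussBall S j u) * ((starRingEnd ℂ) (Φ y) * IT S (F z) (wα p * (xr p .a y * 1)))),
    integral_const_mul, Complex.real_smul, norm_inv, inv_inv, mul_assoc]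

/-- The Whittaker integral of β_S involves the already continued values T₀; uniqueness of
continuation transfers the asymptotics to them. -/
theorem pairIT_value_large {S : ℚ_[p]} (hS : S ≠ 0) {T₀ : G2 p → ℂ}
    (hT : ∀ g, IsRat p (fun z => IT S (F z) g) (T₀ g)) {Φ : ℚ_[p] → ℂ} (hΦ : IsSchwartz p Φ) :
    ∃ M j : ℕ, 1 ≤ M ∧ (∀ z, ∀ b ∈ (ball p M)ᶜ,
      pairIT (chirp S b Φ) (IT S (F z)) (wβ p * xr p .b b) =
        (qchr μ (s + z + 3 / 2) b)⁻¹ * ((‖b‖ : ℝ) * (starRingEnd ℂ) (gaussBall S j b) *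
          pairIT Φ (IT S (F z)) 1)) ∧
      ∀ b ∈ (ball p M)ᶜ, pairIT (chirp S b Φ) T₀ (wβ p * xr p .b b) =
        (qchr μ (s + 3 / 2) b)⁻¹ * ((‖b‖ : ℝ) * (starRingEnd ℂ) (gaussBall S j b) * pairIT Φ T₀ 1) := by
  obtain ⟨M, j, hM, h⟩ := hF.pairIT_large hS hΦ
  refine ⟨M, j, hM, h, fun b hb => ?_⟩
  refine (hF.rat_pairIT hT (isSchwartz_chirp hS b hΦ) (wβ p * xr p .b b)).unique ?_
  simp only [h _ b hb]
  exact (isRat_qchr_inv μ s (ne_zero_of_notMem_ball hb)).mul ((IsRat.const _).mul (hF.rat_pairIT hT hΦ 1))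

end Fam

/-- Invariance under `1 + p ^ k ℤ_p` forces the Fourier coefficients to come from a ball. -/
theorem integral_tail_eq_zero {t : ℚ_[p]} (ht : t ≠ 0) {k : ℕ} (hk : 1 ≤ k) (M : ℕ) :
    ∃ N : ℕ, M ≤ N ∧ ∀ h : ℚ_[p] → ℂ, (∀ b ∈ (ball p M)ᶜ, ∀ e ∈ ball p (-k), h (b * (1 + e)) = h b) →
      Integrable h (haar p) → ∫ b, h b * psi p (-(t * b)) ∂haar p =
        ∫ b in ball p N, h b * psi p (-(t * b)) ∂haar p := by
  obtain ⟨m, hm⟩ := exists_norm_eq_zpow ht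
  -- With |t| = p^m, outside this ball |tb| > p^k, so ψ(tb) oscillates along the cosets b(1 + p^k
  -- ℤ_p).
  refine ⟨max M (k - m).toNat, le_max_left _ _, fun h hinv hint => ?_⟩
  set N := max M (k - m).toNat
  have hint' : Integrable (fun b => h b * psi p (-(t * b))) (haar p) :=
    (integrable_mul_psi hint (a := fun b => -(t * b)) (by fun_prop)).congr
      (ae_of_all _ fun b => mul_comm _ _)
  rw [← integral_add_compl (measurableSet_ball N) hint', add_eq_left]
  have h1 : ∀ b, psi p (-(t * b)) = psi p (-t * b) := fun b => by rw [neg_mul]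
  simp only [h1]
  refine integral_mul_psi_eq_zero (measurableSet_ball _).compl hint.integrableOn hk ?_
    (fun b hb => hinv b fun hc => hb (ball_mono (by omega) hc)) ?_
  · intro v e he
    rw [notMem_ball, notMem_ball, norm_mul, norm_one_add hk he, mul_one]
  · intro v hv
    have h3 := notMem_ball.mp hv
    rw [norm_mul, norm_neg, hm]
    have h4 : (p : ℝ) ^ ((k : ℤ) - m) < ‖v‖ :=
      lt_of_le_of_lt (zpow_le_zpow_right₀ one_lt_p.le (by omega)) h3
    calc (1 : ℝ) = (p : ℝ) ^ m * (p : ℝ) ^ ((k : ℤ) - m) * (p : ℝ) ^ (-k : ℤ) := by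
          rw [← zpow_add₀ p_pos.ne', ← zpow_add₀ p_pos.ne']; simp
      _ < _ := by
          have := p_pos (p := p)
          gcongr

end FourierJacobi

/-! ### The identity in the domain of convergence, and both continuations of the Whittaker integral.
-/

section Jacquet

variable {p : ℕ} [Fact p.Prime]

/-- The unnormalized Jacquet integral over the Heisenberg group. -/
def jac (S t : ℚ_[p]) (f : G2 p → ℂ) (g : G2 p) : ℂ :=
  ∫ a : Fin 5 → ℚ_[p], f (iota p * (nG p a * g)) * psi p (-(S * a 2 + t * a 0))
    ∂(Measure.pi fun _ => haar p)

/-- Exhibits the transform as the integral of conj(Φ) against the kernel that `jac_eq` produces. -/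
theorem conj_chirp (S b : ℚ_[p]) (Φ : ℚ_[p] → ℂ) (y : ℚ_[p]) : (starRingEnd ℂ) (chirp S b Φ y) =
    ∫ x, (starRingEnd ℂ) (Φ x) * psi p (S * (2 * x * y - x ^ 2 * b)) ∂haar p := by
  rw [chirp, ← integral_conj]
  refine integral_congr_ae (ae_of_all _ fun x => ?_)
  simp only [map_mul, conj_psi]
  rw [mul_comm]
  congr 2; ring

theorem IsSchwartz.conj {Φ : ℚ_[p] → ℂ} (h : IsSchwartz p Φ) :
    IsSchwartz p fun x => (starRingEnd ℂ) (Φ x) :=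
  ⟨h.1.comp (starRingEnd ℂ), h.2.comp_left (map_zero (starRingEnd ℂ))⟩

theorem continuous_of_periodic {E : Type*} [TopologicalSpace E] {c : ℚ_[p] → E} {k : ℕ}
    (h : ∀ x, ∀ e ∈ ball p (-k), c (x + e) = c x) : Continuous c := by
  refine IsLocallyConstant.continuous ?_
  rw [IsLocallyConstant.iff_eventually_eq]
  intro x
  have hc : Continuous fun y : ℚ_[p] => y - x := by fun_prop
  have : ∀ᶠ y in nhds x, y - x ∈ ball p (-k) :=
    hc.continuousAt.eventually ((isOpen_ball _).mem_nhds (by simpa using zero_mem_ball _))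
  filter_upwards [this] with y hy
  have := h x _ hy
  simpa using this

theorem IsRat.of_eq {f : ℂ → ℂ} {c d : ℂ} (h : IsRat p f c) (hcd : c = d) : IsRat p f d := hcd ▸ h

theorem max_one_norm_add (x : ℚ_[p]) {e : ℚ_[p]} (he : e ∈ ball p 0) : max 1 ‖x + e‖ = max 1 ‖x‖ := by
  have h1 := norm_le_one_iff_ball.mpr he
  refine le_antisymm (max_le (le_max_left _ _) ?_) (max_le (le_max_left _ _) ?_)
  · refine (IsUltrametricDist.norm_add_le_max x e).trans (max_le (le_max_right _ _) (h1.trans (le_max_left _ _)))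
  · have := IsUltrametricDist.norm_add_le_max (x + e) (-e)
    rw [add_neg_cancel_right, norm_neg] at this
    exact this.trans (max_le (le_max_right _ _) (h1.trans (le_max_left _ _)))

theorem isRat_height (x : ℚ_[p]) :
    IsRat p (fun z => (((max 1 ‖x‖)⁻¹ : ℝ) : ℂ) ^ z) 1 := by
  obtain ⟨m, hm⟩ : ∃ m : ℤ, max 1 ‖x‖ = (p : ℝ) ^ m := by
    rcases max_choice 1 ‖x‖ with h | h
    · exact ⟨0, by rw [h, zpow_zero]⟩
    · have hx : x ≠ 0 := by
        rintro rfl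
        have := le_max_left 1 ‖(0 : ℚ_[p])‖
        rw [h, norm_zero] at this
        linarith
      rw [h]; exact exists_norm_eq_zpow hx
  have h1 := IsRat.cpow (p := p) (-m)
  refine h1.congr 0 fun z _ => ?_
  rw [hm, ← zpow_neg, zpow_cpow]

variable {μ : ℚ_[p]ˣ →* Circle} {s : ℂ} {K : Subgroup (G2 p)} {F : ℂ → G2 p → ℂ} {F₀ : G2 p → ℂ}

namespace Fam

variable (hF : Fam μ s K F F₀)

include hF

/-- The dependence on the translation x is moved into an explicit phase by `UInv.IT_translate`, so
that the integral over x can be carried out first. -/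
theorem jac_eq (z : ℂ) (hz : 1 / 2 - s.re < z.re) (S t x : ℚ_[p]) :
    jac S t (F z) (xr p .a x) = μ (-1) * ∫ b, ∫ y, psi p (-(t * b)) * (psi p (S * (2 * x * y - x ^ 2 * b)) *
      IT S (F z) (wα p * (xr p .a y * (wβ p * xr p .b b)))) ∂haar p ∂haar p := by
  rw [jac, (hF.integral_five z hz S t _).2]
  congr 1
  refine integral_congr_ae (ae_of_all _ fun b => ?_)
  simp only
  rw [integral_const_mul]
  congr 1
  have h := fun y => (hF.uinv z).IT_translate S y b x 1
  simp only [mul_one] at h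
  simp only [h]
  -- Replacing y + xb by y changes the phase 2xy + x²b into 2xy - x²b.
  rw [← integral_add_right_eq_self (fun y => psi p (S * (2 * x * y - x ^ 2 * b)) *
    IT S (F z) (wα p * (xr p .a y * (wβ p * xr p .b b)))) (x * b)]
  refine integral_congr_ae (ae_of_all _ fun y => ?_)
  simp only
  congr 2; ring

/-- A product of integrable functions of x and of (b, y), times phases of absolute value one. -/
theorem integrable_kernel (z : ℂ) (hz : 1 / 2 - s.re < z.re) (S t : ℚ_[p]) {Φ : ℚ_[p] → ℂ}
    (hΦ : IsSchwartz p Φ) :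
    Integrable (Function.uncurry fun (x : ℚ_[p]) (q : ℚ_[p] × ℚ_[p]) => (starRingEnd ℂ) (Φ x) *
      (psi p (-(t * q.1)) * (psi p (S * (2 * x * q.2 - x ^ 2 * q.1)) *
        IT S (F z) (wα p * (xr p .a q.2 * (wβ p * xr p .b q.1))))))
      ((haar p).prod ((haar p).prod (haar p))) := by
  have h1 := hF.integrable_wα_wβ_IT z hz S 1
  simp only [mul_one] at h1
  have h2 : Integrable (fun x => (starRingEnd ℂ) (Φ x)) (haar p) := hΦ.conj.integrable
  refine ((h2.mul_prod h1).mul_bdd (c := 1)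
    (g := fun q => psi p (-(t * q.2.1) + S * (2 * q.1 * q.2.2 - q.1 ^ 2 * q.2.1))) ?_ ?_).congr
    (ae_of_all _ fun q => ?_)
  · exact (continuous_psi.comp (by fun_prop)).aestronglyMeasurable
  · exact ae_of_all _ fun q => by rw [norm_psi]
  · simp only [Function.uncurry, psi_add]
    ring

theorem integrable_conj_chirp (z : ℂ) (hz : 1 / 2 - s.re < z.re) (S t : ℚ_[p]) {Φ : ℚ_[p] → ℂ}
    (hΦ : IsSchwartz p Φ) :
    Integrable (fun q : ℚ_[p] × ℚ_[p] => psi p (-(t * q.1)) * ((starRingEnd ℂ) (chirp S q.1 Φ q.2) *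
      IT S (F z) (wα p * (xr p .a q.2 * (wβ p * xr p .b q.1))))) ((haar p).prod (haar p)) := by
  refine (hF.integrable_kernel z hz S t hΦ).integral_prod_right.congr (ae_of_all _ fun q => ?_)
  simp only [Function.uncurry]
  rw [conj_chirp, ← integral_mul_const, ← integral_const_mul]
  refine integral_congr_ae (ae_of_all _ fun x => ?_)
  simp only
  ring

theorem integrable_pairIT (z : ℂ) (hz : 1 / 2 - s.re < z.re) (S : ℚ_[p]) {Φ : ℚ_[p] → ℂ}
    (hΦ : IsSchwartz p Φ) :
    Integrable (fun b => pairIT (chirp S b Φ) (IT S (F z)) (wβ p * xr p .b b)) (haar p) := by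
  have := (hF.integrable_conj_chirp z hz S 0 hΦ).integral_prod_left
  simp only [zero_mul, neg_zero, psi_zero, one_mul] at this
  exact this

/-- The integral of the Jacquet integrals against a Schwartz function. -/
theorem integral_conj_mul_jac (z : ℂ) (hz : 1 / 2 - s.re < z.re) (S t : ℚ_[p]) {Φ : ℚ_[p] → ℂ}
    (hΦ : IsSchwartz p Φ) :
    ∫ x, (starRingEnd ℂ) (Φ x) * jac S t (F z) (xr p .a x) ∂haar p = μ (-1) *
      ∫ b, pairIT (chirp S b Φ) (IT S (F z)) (wβ p * xr p .b b) * psi p (-(t * b)) ∂haar p := by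
  have h1 := hF.integrable_kernel z hz S t hΦ
  have h2 := hF.integrable_wα_wβ_IT z hz S 1
  simp only [mul_one] at h2
  -- In one order the inner integral is the Jacquet integral at x_α(x); in the other it is `chirp`
  -- paired with the triple integral.
  have h3 := integral_integral_swap h1
  have h4 : ∀ x, ∫ q : ℚ_[p] × ℚ_[p], (starRingEnd ℂ) (Φ x) *
      (psi p (-(t * q.1)) * (psi p (S * (2 * x * q.2 - x ^ 2 * q.1)) *
        IT S (F z) (wα p * (xr p .a q.2 * (wβ p * xr p .b q.1))))) ∂((haar p).prod (haar p)) =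
      (starRingEnd ℂ) (Φ x) * (μ (-1) * jac S t (F z) (xr p .a x)) := fun x => by
    rw [integral_const_mul, hF.jac_eq z hz, ← mul_assoc (μ (-1) : ℂ), mu_neg_one_mul, one_mul]
    congr 1
    refine integral_prod _ ((h2.mul_bdd (c := 1)
      (g := fun q => psi p (-(t * q.1) + S * (2 * x * q.2 - x ^ 2 * q.1))) ?_ ?_).congr
      (ae_of_all _ fun q => ?_))
    · exact (continuous_psi.comp (by fun_prop)).aestronglyMeasurable
    · exact ae_of_all _ fun q => by rw [norm_psi]
    · simp only [psi_add]
      ring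
  have h5 : ∫ q : ℚ_[p] × ℚ_[p], ∫ x, (starRingEnd ℂ) (Φ x) *
      (psi p (-(t * q.1)) * (psi p (S * (2 * x * q.2 - x ^ 2 * q.1)) *
        IT S (F z) (wα p * (xr p .a q.2 * (wβ p * xr p .b q.1))))) ∂haar p ∂((haar p).prod (haar p)) =
      ∫ b, pairIT (chirp S b Φ) (IT S (F z)) (wβ p * xr p .b b) * psi p (-(t * b)) ∂haar p := by
    have h6 := integral_prod _ (hF.integrable_conj_chirp z hz S t hΦ)
    refine Eq.trans ?_ (h6.trans ?_)
    · refine integral_congr_ae (ae_of_all _ fun q => ?_)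
      simp only
      rw [conj_chirp, ← integral_mul_const, ← integral_const_mul]
      refine integral_congr_ae (ae_of_all _ fun x => ?_)
      simp only
      ring
    · refine integral_congr_ae (ae_of_all _ fun b => ?_)
      simp only
      rw [integral_const_mul, mul_comm]
      rfl
  rw [h5] at h3
  simp only [h4] at h3
  rw [← h3, ← integral_const_mul]
  refine integral_congr_ae (ae_of_all _ fun x => ?_)
  simp only
  have := mu_neg_one_mul μ
  linear_combination -(starRingEnd ℂ) (Φ x) * jac S t (F z) (xr p .a x) * this

/-- The Whittaker integral of the Fourier–Jacobi integrals, continued in two ways. -/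
theorem rat_whittaker (hμ : Continuous μ) {S t : ℚ_[p]} (hS : S ≠ 0) (ht : t ≠ 0) {T₀ : G2 p → ℂ}
    (hT : ∀ g, IsRat p (fun z => IT S (F z) g) (T₀ g)) {Φ : ℚ_[p] → ℂ} (hΦ : IsSchwartz p Φ) :
    ∃ N : ℕ, ∃ V : ℂ,
      V = ∫ b in ball p N, pairIT (chirp S b Φ) T₀ (wβ p * xr p .b b) * psi p (-(t * b)) ∂haar p ∧
      IsRat p (fun z => ∫ b, pairIT (chirp S b Φ) (IT S (F z)) (wβ p * xr p .b b) * psi p (-(t * b)) ∂haar p) V ∧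
      IsRat p (fun z => ∫ b, pairIT (chirp S b Φ) T₀ (wβ p * xr p .b b) *
        (((max 1 ‖b‖)⁻¹ : ℝ) : ℂ) ^ z * psi p (-(t * b)) ∂haar p) V ∧
      ∃ B : ℝ, ∀ z : ℂ, B < z.re → Integrable (fun b => pairIT (chirp S b Φ) T₀ (wβ p * xr p .b b) *
        (((max 1 ‖b‖)⁻¹ : ℝ) : ℂ) ^ z * psi p (-(t * b))) (haar p) := by
  obtain ⟨M, j, hM1, hlarge, hlarge₀⟩ := hF.pairIT_value_large hS hT hΦ
  obtain ⟨k₀, hk₀, hcond⟩ := exists_conductor μ hμ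
  obtain ⟨j', N', hj', hN'⟩ := hΦ.exists_data
  obtain ⟨k₁, hk₁, hb1, -⟩ := exists_radius_b hF.isOpen (1 : G2 p)
  obtain ⟨r, hr⟩ := exists_mem_ball S
  obtain ⟨r', hr'⟩ := exists_mem_ball t
  -- On 1 + p^κ ℤ_p the character μ is trivial, and level 3 makes these elements squares, as
  -- `gaussBall_mul` requires.
  set κ := max k₀ 3 with hκ
  have hκ1 : 1 ≤ κ := by omega
  obtain ⟨N, hMN, hN⟩ := integral_tail_eq_zero ht hκ1 M
  -- Additive level for b: right smoothness, triviality of ψ(te), and triviality of ψ(Sex²) on the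
  -- support of Φ.
  set k := max k₁ (max r' (r + 2 * N'))
  have hchirp : ∀ b, ∀ e ∈ ball p (-k : ℤ), chirp S (b + e) Φ = chirp S b Φ := fun b e he => by
    funext y
    refine integral_congr_ae (ae_of_all _ fun x => ?_)
    simp only
    by_cases hx : x ∈ ball p N'
    · congr 1
      rw [show S * (-2 * y * x + (b + e) * x ^ 2) = S * (-2 * y * x + b * x ^ 2) + S * e * x * x by ring]
      refine psi_add_of_norm_le_one (norm_le_one_iff_ball.mpr (ball_mono ?_
        (mul_mem_ball (mul_mem_ball (mul_mem_ball hr he) hx) hx)))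
      omega
    · rw [hN' x hx, mul_zero, mul_zero]
  have hper : ∀ z b, ∀ e ∈ ball p (-k : ℤ),
      pairIT (chirp S (b + e) Φ) (IT S (F z)) (wβ p * xr p .b (b + e)) =
      pairIT (chirp S b Φ) (IT S (F z)) (wβ p * xr p .b b) := fun z b e he => by
    rw [hchirp b e he]
    unfold pairIT
    refine integral_congr_ae (ae_of_all _ fun y => ?_)
    have := periodic_b (hF.IT_inv S z) hb1 (wα p * xr p .a y * wβ p) b (ball_mono (by omega) he)
    simp only [mul_assoc, mul_one] at this ⊢
    rw [this]
  have hrat : ∀ b, IsRat p (fun z => pairIT (chirp S b Φ) (IT S (F z)) (wβ p * xr p .b b))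
      (pairIT (chirp S b Φ) T₀ (wβ p * xr p .b b)) := fun b =>
    hF.rat_pairIT hT (isSchwartz_chirp hS b hΦ) _
  set c : ℚ_[p] → ℂ := fun b => pairIT (chirp S b Φ) T₀ (wβ p * xr p .b b) with hc
  have hcper : ∀ b, ∀ e ∈ ball p (-k : ℤ), c (b + e) = c b := fun b e he =>
    ((hrat (b + e)).congr 0 fun z _ => hper z b e he).unique (hrat b)
  have hψper : ∀ b, ∀ e ∈ ball p (-k : ℤ), psi p (-(t * (b + e))) = psi p (-(t * b)) := fun b e he => by
    rw [show -(t * (b + e)) = -(t * b) + -(t * e) by ring]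
    refine psi_add_of_norm_le_one (norm_le_one_iff_ball.mpr (neg_mem_ball (ball_mono ?_ (mul_mem_ball hr' he))))
    omega
  have hne : ∀ b ∈ (ball p M)ᶜ, ∀ e ∈ ball p (-κ : ℤ), b * (1 + e) ∈ (ball p M)ᶜ ∧
      ‖b * (1 + e)‖ = ‖b‖ ∧ gaussBall S j (b * (1 + e)) = gaussBall S j b ∧
      ∀ τ, qchr μ τ (b * (1 + e)) = qchr μ τ b := fun b hb e he => by
    have h1 : ‖b * (1 + e)‖ = ‖b‖ := by rw [norm_mul, norm_one_add hκ1 he, mul_one]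
    refine ⟨?_, h1, gaussBall_mul S j b (ball_mono (by omega) he), fun τ => ?_⟩
    · rw [notMem_ball, h1]; exact notMem_ball.mp hb
    · rw [qchr_mul, qchr_one_add μ hk₀ hcond τ (ball_mono (by omega) he), mul_one]
  have hht : Continuous fun b : ℚ_[p] => (max 1 ‖b‖)⁻¹ :=
    (continuous_const.max continuous_norm).inv₀ fun b => (lt_max_of_lt_left one_pos).ne'
  have hcc : ∀ z : ℂ, Continuous fun b => c b * (((max 1 ‖b‖)⁻¹ : ℝ) : ℂ) ^ z := fun z =>
    (continuous_of_periodic hcper).mul (continuous_iff_continuousAt.mpr fun b =>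
      (Complex.continuous_ofReal.comp hht).continuousAt.cpow continuousAt_const
        (Or.inl (by simp only [Function.comp, Complex.ofReal_re]; positivity)))
  -- Near infinity the quasi-character, the Jacobian |b| and the height combine to |b|^(-Re(s + 1/2
  -- + z)), while the Gauss integral is bounded.
  have hint : ∀ z : ℂ, 1 / 2 - s.re < z.re →
      Integrable (fun b => c b * (((max 1 ‖b‖)⁻¹ : ℝ) : ℂ) ^ z) (haar p) := fun z hz => by
    rw [← integrableOn_univ, ← Set.union_compl_self (ball p M)]
    refine ((hcc z).continuousOn.integrableOn_compact (isCompact_ball _)).union ?_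
    have hτ : 1 < (s + 1 / 2 + z).re := by
      simp only [Complex.add_re, Complex.div_ofNat_re, Complex.one_re]; linarith
    refine ((integrableOn_tail μ hμ M hτ).norm.mul_const
      ((p : ℝ) ^ (-j : ℤ) * ‖pairIT Φ T₀ 1‖)).mono' (hcc z).aestronglyMeasurable.restrict ?_
    refine (ae_restrict_iff' (measurableSet_ball _).compl).mpr (ae_of_all _ fun b hb => ?_)
    have hb0 := ne_zero_of_notMem_ball hb
    have hbp : 0 < ‖b‖ := norm_pos_iff.mpr hb0
    have hb1 : 1 ≤ ‖b‖ := by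
      have h1 := notMem_ball.mp hb
      have h2 : (1 : ℝ) ≤ (p : ℝ) ^ (M : ℤ) := one_le_zpow₀ one_lt_p.le (by omega)
      linarith
    simp only [hc]
    rw [hlarge₀ b hb, max_eq_right hb1, norm_qchr μ _ (inv_ne_zero hb0)]
    simp only [norm_mul, norm_inv, norm_qchr μ _ hb0, Complex.norm_real, RCLike.norm_conj, norm_norm]
    rw [Complex.norm_cpow_eq_rpow_re_of_pos (inv_pos.mpr hbp), Real.inv_rpow hbp.le,
      Real.inv_rpow hbp.le]
    have h3 : ‖b‖ ^ (s + 1 / 2 + z).re * ‖b‖ = ‖b‖ ^ (s + 3 / 2).re * ‖b‖ ^ z.re := by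
      rw [← Real.rpow_add hbp, ← Real.rpow_add_one hbp.ne']
      congr 1
      simp only [Complex.add_re, Complex.div_ofNat_re, Complex.one_re, Complex.re_ofNat]; ring
    have h4 : (‖b‖ ^ (s + 3 / 2).re)⁻¹ * ‖b‖ * (‖b‖ ^ z.re)⁻¹ = (‖b‖ ^ (s + 1 / 2 + z).re)⁻¹ := by
      have := (Real.rpow_pos_of_pos hbp (s + 3 / 2).re).ne'
      have := (Real.rpow_pos_of_pos hbp z.re).ne'
      have := (Real.rpow_pos_of_pos hbp (s + 1 / 2 + z).re).ne'
      generalize ‖b‖ ^ (s + 3 / 2).re = u, ‖b‖ ^ z.re = v, ‖b‖ ^ (s + 1 / 2 + z).re = w at *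
      field_simp
      linear_combination h3
    calc _ = ((‖b‖ ^ (s + 3 / 2).re)⁻¹ * ‖b‖ * (‖b‖ ^ z.re)⁻¹) * (‖gaussBall S j b‖ * ‖pairIT Φ T₀ 1‖) := by
          ring
      _ ≤ _ := by
          rw [h4]
          gcongr
          exact norm_gaussBall_le S j b
  -- Both integrals reduce to the same ball. In one the section varies with z, in the other only the
  -- height of SL₂ does; at z = 0 the integrands coincide.
  refine ⟨N, _, rfl, ?_, ?_, 1 / 2 - s.re, fun z hz => ?_⟩
  · refine (IsRat.ballIntegral N k 0 (fun z _ b e he => ?_) fun b => (hrat b).mul (IsRat.const _)).congr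
      (1 / 2 - s.re) fun z hz => ?_
    · rw [hper z b e he, hψper b e he]
    · refine (hN _ (fun b hb e he => ?_) (hF.integrable_pairIT z hz S hΦ)).symm
      obtain ⟨h1, h2, h3, h4⟩ := hne b hb e he
      rw [hlarge z _ h1, hlarge z _ hb, h2, h3, h4]
  · refine (IsRat.ballIntegral N k 0 (H := fun z b => c b * (((max 1 ‖b‖)⁻¹ : ℝ) : ℂ) ^ z *
      psi p (-(t * b))) (fun z _ b e he => ?_) fun b =>
      (((IsRat.const _).mul (isRat_height b)).mul (IsRat.const _))).congr
      (1 / 2 - s.re) (fun z hz => ?_) |>.of_eq (by simp only [mul_one, hc])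
    · rw [hcper b e he, hψper b e he, max_one_norm_add b (ball_mono (by omega) he)]
    · refine (hN _ (fun b hb e he => ?_) (hint z hz)).symm
      obtain ⟨h1, h2, h3, h4⟩ := hne b hb e he
      simp only [hc]
      rw [hlarge₀ _ h1, hlarge₀ _ hb, h2, h3, h4]
  · exact (integrable_mul_psi (hint z hz) (a := fun b => -(t * b)) (by fun_prop)).congr
      (ae_of_all _ fun b => mul_comm _ _)

end Fam

end Jacquet

/-! ### Continuation of the Jacquet integral and its independence of the chosen family. -/

section JacquetContinuation

variable {p : ℕ} [Fact p.Prime] {μ : ℚ_[p]ˣ →* Circle} {s : ℂ} {K K' : Subgroup (G2 p)}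
  {F F' : ℂ → G2 p → ℂ} {F₀ F₀' : G2 p → ℂ}

namespace Fam

theorem translate (hF : Fam μ s K F F₀) (x : G2 p) :
    ∃ K' : Subgroup (G2 p), Fam μ s K' (fun z g => F z (g * x)) (fun g => F₀ (g * x)) := by
  refine ⟨K.comap (MulAut.conj x⁻¹).toMonoidHom, ?_, fun z g k hk => ?_, fun z => ?_, fun z a d g => ?_,
    fun g => hF.rat _⟩
  · have : Continuous fun k : G2 p => x⁻¹ * k * x := by fun_prop
    have he : (K.comap (MulAut.conj x⁻¹).toMonoidHom : Set (G2 p)) =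
        (fun k : G2 p => x⁻¹ * k * x) ⁻¹' K := by
      ext k
      simp
    rw [he]
    exact hF.isOpen.preimage this
  · have h : x⁻¹ * k * x ∈ K := by simpa [Subgroup.mem_comap] using hk
    rw [← hF.inv z (g * x) _ h]
    congr 1
    group
  · have h := hF.uinv z
    exact ⟨fun c g => by rw [mul_assoc, h.a], fun c g => by rw [mul_assoc, h.b],
      fun c g => by rw [mul_assoc, h.ab], fun c g => by rw [mul_assoc, h.a2b],
      fun c g => by rw [mul_assoc, h.a3b], fun c g => by rw [mul_assoc, h.a3b2]⟩
  · rw [mul_assoc, hF.torus]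

theorem sub (hF : Fam μ s K F F₀) (hF' : Fam μ s K' F' F₀') :
    Fam μ s (K ⊓ K') (fun z g => F z g - F' z g) (fun g => F₀ g - F₀' g) where
  isOpen := hF.isOpen.inter hF'.isOpen
  inv z g k hk := by rw [hF.inv z g k hk.1, hF'.inv z g k hk.2]
  uinv z := by
    have h := hF.uinv z
    have h' := hF'.uinv z
    exact ⟨fun c g => by rw [h.a, h'.a], fun c g => by rw [h.b, h'.b], fun c g => by rw [h.ab, h'.ab],
      fun c g => by rw [h.a2b, h'.a2b], fun c g => by rw [h.a3b, h'.a3b],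
      fun c g => by rw [h.a3b2, h'.a3b2]⟩
  torus z a d g := by rw [hF.torus, hF'.torus, mul_sub]
  rat g := by
    have := (hF.rat g).add ((IsRat.const (-1)).mul (hF'.rat g))
    simpa only [neg_mul, one_mul, ← sub_eq_add_neg] using this

theorem jac_periodic (hF : Fam μ s K F F₀) : ∃ k : ℕ, ∀ z S t x, ∀ e ∈ ball p (-k),
    jac S t (F z) (xr p .a (x + e)) = jac S t (F z) (xr p .a x) := by
  obtain ⟨k, -, hk, -⟩ := exists_radius_a hF.isOpen (1 : G2 p)
  refine ⟨k, fun z S t x e he => ?_⟩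
  refine integral_congr_ae (ae_of_all _ fun a => ?_)
  have := periodic_a (hF.inv z) hk (iota p * nG p a) x he
  rw [mul_one, mul_one, mul_assoc, mul_assoc] at this
  simp only
  rw [this]

/-- The continuation of the Jacquet integrals of a family, and its relation to the Whittaker
integral of the Fourier–Jacobi integrals. -/
theorem rat_jac (hF : Fam μ s K F F₀) (hμ : Continuous μ) (hL : ¬ LPole p (fun a => μ a) (s + 1 / 2))
    {S t : ℚ_[p]} (hS : S ≠ 0) (ht : t ≠ 0) :
    ∃ J₀ : ℚ_[p] → ℂ, (∀ x, IsRat p (fun z => jac S t (F z) (xr p .a x)) (J₀ x)) ∧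
      (F₀ = 0 → J₀ = 0) := by
  obtain ⟨T₀, hT, hT0⟩ := hF.rat_T hμ hL hS
  have key : ∀ x, ∃ c, IsRat p (fun z => jac S t (F z) (xr p .a x)) c ∧ (F₀ = 0 → c = 0) := by
    intro x
    obtain ⟨k, hk⟩ := hF.jac_periodic
    obtain ⟨n, hn⟩ := exists_mem_ball x
    -- Testing against the indicator of a coset on which the Jacquet integral is constant recovers
    -- its value at x, up to the volume p^(-k) of the coset.
    set Φ : ℚ_[p] → ℂ := (coset x k).indicator 1 with hΦd
    have hΦ : IsSchwartz p Φ := by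
      refine IsSchwartz.of_data (j := k) (N := n) (fun y e he => ?_) fun y hy => ?_
      · have : y + e ∈ coset x k ↔ y ∈ coset x k := by
          constructor
          · intro h
            have := add_mem_ball h (neg_mem_ball he)
            simp only [coset, Set.mem_ofPred_eq]
            convert this using 1; ring
          · intro h
            have := add_mem_ball h he
            simp only [coset, Set.mem_ofPred_eq]
            convert this using 1; ring
        by_cases hy : y ∈ coset x k
        · rw [hΦd, Set.indicator_of_mem hy, Set.indicator_of_mem (this.mpr hy)]
          rfl
        · rw [hΦd, Set.indicator_of_notMem hy, Set.indicator_of_notMem (mt this.mp hy)]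
      · refine Set.indicator_of_notMem (fun h => hy ?_) _
        have := add_mem_ball (ball_mono (n := n) (by omega) h) hn
        simpa using this
    obtain ⟨N, V, hV, hV1, -⟩ := hF.rat_whittaker hμ hS ht hT hΦ
    refine ⟨(p : ℂ) ^ (k : ℤ) * (μ (-1) * V), ((IsRat.const _).mul ((IsRat.const _).mul hV1)).congr
      (1 / 2 - s.re) fun z hz => ?_, fun h0 => ?_⟩
    · have h1 := hF.integral_conj_mul_jac z hz S t hΦ
      rw [← h1]
      have h2 : ∀ y, (starRingEnd ℂ) (Φ y) * jac S t (F z) (xr p .a y) =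
          (coset x k).indicator (fun _ => jac S t (F z) (xr p .a x)) y := fun y => by
        by_cases hy : y ∈ coset x k
        · have := hk z S t x _ hy
          rw [add_sub_cancel] at this
          simp [hΦd, hy, this]
        · simp [hΦd, hy]
      simp only [h2]
      rw [integral_indicator (measurableSet_coset x k), setIntegral_const, measureReal_def, haar_coset,
        ← measureReal_def, haar_ball_real, Complex.real_smul, ← mul_assoc]
      have : (p : ℂ) ^ (k : ℤ) * (((p : ℝ) ^ (-k : ℤ) : ℝ) : ℂ) = 1 := by
        push_cast
        rw [← zpow_add₀ p_ne_zero_complex, add_neg_cancel, zpow_zero]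
      rw [this, one_mul]
    · rw [hV, hT0 h0]
      simp [pairIT]
  choose J₀ h1 h2 using key
  exact ⟨J₀, h1, fun h => funext fun x => h2 x h⟩

/-- The integral over x runs over a ball and commutes with continuation, so the identity valid for
large Re(z) passes to the values at z = 0. -/
theorem integral_conj_mul_jac_value (hF : Fam μ s K F F₀) {S t : ℚ_[p]} {J₀ : ℚ_[p] → ℂ}
    (hJ : ∀ x, IsRat p (fun z => jac S t (F z) (xr p .a x)) (J₀ x)) {Φ : ℚ_[p] → ℂ}
    (hΦ : IsSchwartz p Φ) {V : ℂ} (hV : IsRat p (fun z => ∫ b, pairIT (chirp S b Φ) (IT S (F z))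
      (wβ p * xr p .b b) * psi p (-(t * b)) ∂haar p) V) :
    Integrable (fun x => (starRingEnd ℂ) (Φ x) * J₀ x) (haar p) ∧
      ∫ x, (starRingEnd ℂ) (Φ x) * J₀ x ∂haar p = μ (-1) * V := by
  obtain ⟨k, hk⟩ := hF.jac_periodic
  obtain ⟨j, N, hj, hN⟩ := hΦ.exists_data
  have hJper : ∀ x, ∀ e ∈ ball p (-k), J₀ (x + e) = J₀ x := fun x e he =>
    ((hJ (x + e)).congr 0 fun z _ => hk z S t x e he).unique (hJ x)
  have hball : ∀ J : ℚ_[p] → ℂ, ∫ x, (starRingEnd ℂ) (Φ x) * J x ∂haar p =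
      ∫ x in ball p N, (starRingEnd ℂ) (Φ x) * J x ∂haar p := fun J =>
    (setIntegral_eq_integral_of_forall_compl_eq_zero fun x hx => by rw [hN x hx, map_zero, zero_mul]).symm
  refine ⟨?_, ?_⟩
  · have hc : Continuous J₀ := continuous_of_periodic hJper
    exact (hΦ.conj.continuous.mul hc).integrable_of_hasCompactSupport (hΦ.conj.2.mul_right)
  · have h1 : IsRat p (fun z => ∫ x in ball p N, (starRingEnd ℂ) (Φ x) * jac S t (F z) (xr p .a x) ∂haar p)
        (∫ x in ball p N, (starRingEnd ℂ) (Φ x) * J₀ x ∂haar p) := by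
      refine IsRat.ballIntegral N (max j k) 0 (fun z _ x e he => ?_) fun x => (IsRat.const _).mul (hJ x)
      rw [hj x e (ball_mono (by push_cast; omega) he), hk z S t x e (ball_mono (by push_cast; omega) he)]
    rw [hball]
    refine h1.unique (((IsRat.const _).mul hV).congr (1 / 2 - s.re) fun z hz => ?_)
    rw [← hball, hF.integral_conj_mul_jac z hz S t hΦ]

/-- The continued Jacquet integral depends only on the value of the family at zero. -/
theorem rat_jac_one (hF : Fam μ s K F F₀) (hμ : Continuous μ)
    (hL : ¬ LPole p (fun a => μ a) (s + 1 / 2)) {S t : ℚ_[p]} (hS : S ≠ 0) (ht : t ≠ 0) {x : ℚ_[p]}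
    (hF' : Fam μ s K' F' (fun g => F₀ (g * xr p .a x))) {c : ℂ}
    (hc : IsRat p (fun z => jac S t (F z) (xr p .a x)) c) :
    IsRat p (fun z => jac S t (F' z) 1) c := by
  obtain ⟨K'', hx⟩ := hF.translate (xr p .a x)
  -- The difference of the two families is a family with value zero at z = 0, so its continued
  -- Jacquet integral is zero.
  have hd := hF'.sub hx
  obtain ⟨J, hJ, hJ0⟩ := hd.rat_jac hμ hL hS ht
  have h0 := hJ 0
  rw [hJ0 (funext fun g => sub_self _)] at h0
  have h1 := hc.add h0
  simp only [Pi.zero_apply, add_zero] at h1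
  refine h1.congr (1 / 2 - s.re) fun z hz => ?_
  have h2 := (hF'.integral_five z hz S t 1).1
  have h3 := (hx.integral_five z hz S t 1).1
  have h4 : jac S t (fun g => F' z g - F z (g * xr p .a x)) 1 =
      jac S t (F' z) 1 - jac S t (F z) (xr p .a x) := by
    unfold jac
    simp only [mul_one, mul_assoc] at h2 h3 ⊢
    rw [← integral_sub h2 h3]
    simp only [sub_mul]
  rw [xr_zero, h4]
  ring

end Fam

end JacquetContinuation

/-! ### Sections of the principal series as families, and the normalizing factors. -/

section PrincipalSeries

variable {p : ℕ} [Fact p.Prime] {μ : ℚ_[p]ˣ →* Circle} {s : ℂ}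

theorem translate_mem_degPS {φ : G2 p → ℂ} (hφ : φ ∈ degPS p μ s) (v : G2 p) :
    translate p v φ ∈ degPS p μ s := by
  obtain ⟨⟨K, hK, hinv⟩, hlaw⟩ := hφ
  refine ⟨⟨K.comap (MulAut.conj v⁻¹).toMonoidHom, ?_, fun g k hk => ?_⟩, fun a A g => ?_⟩
  · have : Continuous fun k : G2 p => v⁻¹ * k * v := by fun_prop
    have he : (K.comap (MulAut.conj v⁻¹).toMonoidHom : Set (G2 p)) =
        (fun k : G2 p => v⁻¹ * k * v) ⁻¹' K := by
      ext k
      simp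
    rw [he]
    exact hK.preimage this
  · have h : v⁻¹ * k * v ∈ K := by simpa [Subgroup.mem_comap] using hk
    unfold translate
    rw [← hinv (g * v) _ h]
    congr 1
    group
  · unfold translate
    rw [mul_assoc _ g v, hlaw]

theorem isRat_height_cpow (g : G2 p) : IsRat p (fun z => (height p g : ℂ) ^ z) 1 := by
  obtain ⟨n, hn⟩ := exists_height_eq g
  refine (IsRat.cpow (p := p) n).congr 0 fun z _ => ?_
  rw [hn, zpow_cpow]

theorem nG_single (i : Fin 5) (c : ℚ_[p]) :
    nG p (Pi.single i c) = xr p (![Root.b, .ab, .a2b, .a3b, .a3b2] i) c := by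
  unfold nG
  fin_cases i <;> simp [xr_zero]

theorem det_upGL (c : ℚ_[p]) : Matrix.GeneralLinearGroup.det (upGL c) = 1 := by
  ext
  simp [upGL, Matrix.det_fin_two]

theorem det_diagGL (a d : ℚ_[p]ˣ) : Matrix.GeneralLinearGroup.det (diagGL a d) = a * d := by
  ext
  simp [diagGL, Matrix.det_fin_two]

/-- The family attached to a function of the degenerate principal series. -/
theorem exists_fam {φ : G2 p → ℂ} (hφ : φ ∈ degPS p μ s) :
    ∃ K : Subgroup (G2 p), Fam μ s K (fun z g => φ g * (height p g : ℂ) ^ z) φ := by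
  obtain ⟨⟨K, hK, hinv⟩, hlaw⟩ := hφ
  -- The height transforms by |det A|, so its z-th power moves the parameter from s to s + z.
  have law : ∀ (z : ℂ) a (A : GL (Fin 2) ℚ_[p]) g, φ (nG p a * mG p A * g) *
      (height p (nG p a * mG p A * g) : ℂ) ^ z =
      qchr μ (s + z + 3 / 2) (Matrix.GeneralLinearGroup.det A : ℚ_[p]) * (φ g * (height p g : ℂ) ^ z) := by
    intro z a A g
    have h0 : A.val.det ≠ 0 := (Matrix.GeneralLinearGroup.det A).ne_zero
    have h1 : (‖A.val.det‖ : ℂ) ≠ 0 := by simpa using h0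
    rw [hlaw, height_left, qchr, chr_units, Complex.ofReal_mul,
      Complex.mul_cpow_ofReal_nonneg (norm_nonneg _) (by rw [height_eq]; positivity)]
    rw [show (((Matrix.GeneralLinearGroup.det A : ℚ_[p]ˣ) : ℚ_[p])) = A.val.det from rfl,
      Complex.cpow_add _ _ h1, Complex.cpow_add _ _ h1]
    ring
  have lawn : ∀ (z : ℂ) i c g, φ (xr p (![Root.b, .ab, .a2b, .a3b, .a3b2] i) c * g) *
      (height p (xr p (![Root.b, .ab, .a2b, .a3b, .a3b2] i) c * g) : ℂ) ^ z =
      φ g * (height p g : ℂ) ^ z := fun z i c g => by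
    have := law z (Pi.single i c) 1 g
    rw [nG_single, mG_one, mul_one, map_one, Units.val_one, qchr_one, one_mul] at this
    exact this
  have lawm : ∀ (z : ℂ) (A : GL (Fin 2) ℚ_[p]) g, φ (mG p A * g) * (height p (mG p A * g) : ℂ) ^ z =
      qchr μ (s + z + 3 / 2) (Matrix.GeneralLinearGroup.det A : ℚ_[p]) * (φ g * (height p g : ℂ) ^ z) :=
    fun z A g => by
    have h0 : nG p 0 = 1 := by simp [nG, xr_zero]
    have := law z 0 A g
    rwa [h0, one_mul] at this
  refine ⟨K ⊓ integralG2 p, hK.inter isOpen_integralG2, fun z g k hk => ?_, fun z => ⟨fun c g => ?_,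
    lawn z 0, lawn z 1, lawn z 2, lawn z 3, lawn z 4⟩, fun z a d g => ?_, fun g => ?_⟩
  · rw [hinv g k hk.1, height_mul_integral g hk.2]
  · rw [xr_a_eq, lawm, det_upGL, Units.val_one, qchr_one, one_mul]
  · rw [hT, lawm, det_diagGL, Units.val_mul]
  · have := (IsRat.const (p := p) (φ g)).mul (isRat_height_cpow g)
    rwa [mul_one] at this

theorem AdM_wαMat (S t : ℚ_[p]) : AdM p (wαMat p) ![t, 0, S / 3, 0] = ![0, -S / 3, 0, -t] := by
  have h : ((wαMat p : Matrix.SpecialLinearGroup (Fin 2) ℚ_[p]) : Matrix (Fin 2) (Fin 2) ℚ_[p]) =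
      !![0, -1; 1, 0] := rfl
  funext i
  simp only [AdM, rho, Matrix.SpecialLinearGroup.coe_GL_coe_matrix, h]
  fin_cases i <;> simp <;> ring

/-- Shows that on N the character sees only the coordinates of 2α + β and β, with parameters S and
t: the first enters `IA`, the second the Whittaker integral on SL₂. -/
theorem conj_psiW (S t : ℚ_[p]) (a : Fin 5 → ℚ_[p]) :
    (starRingEnd ℂ) (psiW p ![0, -S / 3, 0, -t] a) = psi p (-(S * a 2 + t * a 0)) := by
  rw [psiW, conj_psi]
  congr 1
  simp [pairing]
  field_simp

theorem norm_quartic (S t : ℚ_[p]) : ‖quartic p ![0, -S / 3, 0, -t]‖ = ‖4 / 27 * S ^ 3‖ * ‖t‖ := by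
  rw [← norm_mul]
  congr 1
  simp [quartic]
  ring

/-- Because χ_S is quadratic, the factor L(2s + 1, (μχ_S)²) of the Whittaker functional is the L(2s
+ 1, μ²) in the denominator of β_S. -/
theorem chi_sq (S : ℚ_[p]) (a : ℚ_[p]ˣ) : chi p S a ^ 2 = 1 := by
  unfold chi hilb
  split_ifs <;> norm_num

theorem Lfac_ne_zero {δ : ℚ_[p]ˣ → ℂ} {s : ℂ} (h : ¬ LPole p δ s) : Lfac p δ s ≠ 0 := by
  unfold Lfac
  split_ifs with hu
  · refine inv_ne_zero fun h0 => h ⟨hu, ?_⟩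
    linear_combination -h0
  · exact one_ne_zero

/-- Applied with |q(w)| = q t, q = |4S³/27|: it matches |t|^(1/2) on the left with the powers on the
right, as 1/2 = -1/4 + 3/4. -/
theorem rpow_normalization {q t : ℝ} (hq : 0 < q) (ht : 0 < t) :
    t ^ ((1 : ℝ) / 2) = q ^ (-(3 : ℝ) / 4) * t ^ (-(1 : ℝ) / 4) * (q * t) ^ ((3 : ℝ) / 4) := by
  rw [Real.mul_rpow hq.le ht.le]
  have h1 : q ^ (-(3 : ℝ) / 4) * q ^ ((3 : ℝ) / 4) = 1 := by
    rw [← Real.rpow_add hq]; norm_num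
  have h2 : t ^ (-(1 : ℝ) / 4) * t ^ ((3 : ℝ) / 4) = t ^ ((1 : ℝ) / 2) := by
    rw [← Real.rpow_add ht]; norm_num
  linear_combination (-(t ^ (-(1 : ℝ) / 4) * t ^ ((3 : ℝ) / 4))) * h1 - h2

end PrincipalSeries

/-! ### The continued value of β_S. -/

section FourierJacobiValue

variable {p : ℕ} [Fact p.Prime] {μ : ℚ_[p]ˣ →* Circle} {s : ℂ}

theorem isRegVal_betaIntegrand {φ : G2 p → ℂ} {K : Subgroup (G2 p)}
    (hF : Fam μ s K (fun z g => φ g * (height p g : ℂ) ^ z) φ) {S : ℚ_[p]} (hS : S ≠ 0) {T₀ : G2 p → ℂ}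
    (hT : ∀ g, IsRat p (fun z => IT S (fun g => φ g * (height p g : ℂ) ^ z) g) (T₀ g)) {Φ : ℚ_[p] → ℂ}
    (hΦ : IsSchwartz p Φ) (h : Mp p) :
    IsRegVal p (Measure.pi fun _ : Fin 4 => haar p) (betaIntegrand p S φ Φ h)
      (pairIT (weilSL p S h Φ) T₀ (lG p h.1)) := by
  have hΨ := isSchwartz_weilSL hS h hΦ
  have he : ∀ z, betaIntegrand p S φ Φ h z = fun u : Fin 4 → ℚ_[p] =>
      (fun g => φ g * (height p g : ℂ) ^ z) (word (u 1) (-(u 3)) (u 0 - 3 * u 2 * u 3) (u 2) (lG p h.1)) *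
      (starRingEnd ℂ) (weilSL p S h Φ (u 2) * psi p (S * u 3)) := fun z => by
    funext u
    simp only [betaIntegrand, iota_wβ_zU_vG, weilV, zero_add, mul_zero, sub_zero]
  refine isRegVal_iff.mpr ⟨?_, 1 / 2 - s.re, fun z hz => ?_⟩
  · refine (hF.rat_pairIT hT hΨ (lG p h.1)).congr (1 / 2 - s.re) fun z hz => ?_
    rw [he]
    exact (hF.integral_four z hz S (lG p h.1) hΨ).2.symm
  · rw [he]
    exact (hF.integral_four z hz S (lG p h.1) hΨ).1

/-- Evaluation at w_β x_β(b) extracts the constant γ(S)|2S|^{1/2}, independent of b; the second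
factor later matches the self-dual measure. -/
theorem pairIT_weilSL {S : ℚ_[p]} (hS : S ≠ 0) (b : ℚ_[p]) (Φ : ℚ_[p] → ℂ) (T : G2 p → ℂ) :
    pairIT (weilSL p S (wβMat p * xβMat p b, 1) Φ) T (lG p (wβMat p * xβMat p b :
      Matrix.SpecialLinearGroup (Fin 2) ℚ_[p])) =
      weilConst p S * ((‖2 * S‖ ^ ((1 : ℝ) / 2) : ℝ) : ℂ) *
        pairIT (chirp S b Φ) T (wβ p * xr p .b b) := by
  have hg : lG p (wβMat p * xβMat p b : Matrix.SpecialLinearGroup (Fin 2) ℚ_[p]) = wβ p * xr p .b b := by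
    rw [map_mul, lG_mul, xr_b_eq, wβ_eq]
    congr 2
    ext i j
    fin_cases i <;> fin_cases j <;> rfl
  rw [hg]
  unfold pairIT
  rw [← integral_const_mul]
  refine integral_congr_ae (ae_of_all _ fun y => ?_)
  simp only
  rw [weilSL_wβ_xβ, map_mul, map_mul, conj_weilConst_neg hS, Complex.conj_ofReal]
  ring

end FourierJacobiValue

end FJ

end

theorem lemma7p4 (p : ℕ) [Fact p.Prime] (μ : ℚ_[p]ˣ →* Circle) (hμ : Continuous μ)
    (s : ℂ) (hs : -(2 / 3 : ℝ) < s.re) (S t : ℚ_[p]) (hS : S ≠ 0) (ht : t ≠ 0)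
    (hL₁ : ¬ FJ.LPole p (fun a => μ a) (s + 1 / 2))
    (hL₂ : ¬ FJ.LPole p (fun a => μ a) (2 * s + 1))
    (hL₃ : ¬ FJ.LPole p (fun a => μ a) (3 * s + 3 / 2))
    (hL₄ : ¬ FJ.LPole p (fun a => μ a * FJ.chi p S a) (s + 1 / 2))
    (hL₅ : ¬ FJ.LPole p (fun a => (μ a : ℂ) ^ 2) (2 * s + 1))
    (φ : FJ.G2 p → ℂ) (hφ : φ ∈ FJ.degPS p μ s)
    (Φ : ℚ_[p] → ℂ) (hΦ : FJ.IsSchwartz p Φ)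
    (w : Fin 4 → ℚ_[p]) (hw : w = FJ.AdM p (FJ.wαMat p) ![t, 0, S / 3, 0]) :
    (∀ h : FJ.Mp p, FJ.RegExists p (MeasureTheory.Measure.pi fun _ : Fin 4 => FJ.haar p)
      (FJ.betaIntegrand p S φ Φ h)) ∧
    FJ.RegExists p (FJ.haar p) (FJ.whitSLIntegrand p t (FJ.beta p μ s S w φ Φ)) ∧
    (∀ x : ℚ_[p], FJ.RegExists p (MeasureTheory.Measure.pi fun _ : Fin 5 => FJ.haar p)
      (FJ.jacquetIntegrand p w (FJ.translate p (FJ.vG p x 0 0) φ))) ∧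
    MeasureTheory.Integrable (fun x => (starRingEnd ℂ) (Φ x) *
      FJ.whitG2 p μ s w (FJ.translate p (FJ.vG p x 0 0) φ)) (FJ.selfDual p S) ∧
    FJ.whitSL p (fun a => μ a * FJ.chi p S a) s t (FJ.beta p μ s S w φ Φ) =
      μ (-1) * FJ.weilConst p S *
        ((‖4 / 27 * S ^ 3‖ ^ (-(3 : ℝ) / 4) * ‖t‖ ^ (-(1 : ℝ) / 4) : ℝ) : ℂ) *
        ∫ x, (starRingEnd ℂ) (Φ x) *
          FJ.whitG2 p μ s w (FJ.translate p (FJ.vG p x 0 0) φ) ∂(FJ.selfDual p S) := by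
  open FJ MeasureTheory in
    obtain ⟨K, hF⟩ := exists_fam hφ
    obtain ⟨T₀, hT, -⟩ := hF.rat_T hμ hL₁ hS
    obtain ⟨J₀, hJ, -⟩ := hF.rat_jac hμ hL₁ hS ht
    obtain ⟨N, V, -, hV₁, hV₂, B, hB⟩ := hF.rat_whittaker hμ hS ht hT hΦ
    obtain ⟨hJint, hJV⟩ := hF.integral_conj_mul_jac_value hJ hΦ hV₁
    rw [AdM_wαMat] at hw
    have hβ := fun h => isRegVal_betaIntegrand hF hS hT hΦ h
    have hjac : ∀ x, IsRegVal p (Measure.pi fun _ : Fin 5 => haar p)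
        (jacquetIntegrand p w (FJ.translate p (vG p x 0 0) φ)) (J₀ x) := fun x => by
      have hv : vG p x 0 0 = xr p .a x := by simp [vG, xr_zero]
      rw [hv]
      -- The functional applied to the translate uses the height at ιn, whereas `hF` evaluated at a
      -- translated point would use it at ιn x_α(x). Hence a new family and `rat_jac_one`.
      obtain ⟨K', hF'⟩ := exists_fam (translate_mem_degPS hφ (xr p .a x))
      have he : ∀ z, jacquetIntegrand p w (FJ.translate p (xr p .a x) φ) z = fun a =>
          (fun g => FJ.translate p (xr p .a x) φ g * (height p g : ℂ) ^ z) (iota p * (nG p a * 1)) *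
            psi p (-(S * a 2 + t * a 0)) := fun z => by
        funext a
        simp only [jacquetIntegrand, hw, conj_psiW, mul_one]
      refine isRegVal_iff.mpr ⟨?_, 1 / 2 - s.re, fun z hz => ?_⟩
      · simp only [he]
        exact hF.rat_jac_one hμ hL₁ hS ht hF' (hJ x)
      · rw [he]
        exact (hF'.integral_five z hz S t 1).1
    have hwhit : ∀ x, whitG2 p μ s w (FJ.translate p (vG p x 0 0) φ) =
        ((‖quartic p w‖ ^ ((3 : ℝ) / 4) : ℝ) : ℂ) * normG2 p μ s w * J₀ x := fun x => by
      rw [whitG2, regVal_eq (hjac x)]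
    set C : ℂ := normG2 p μ s w * Lfac p (fun a => μ a * chi p S a) (s + 1 / 2) /
      Lfac p (fun a => (μ a : ℂ) ^ 2) (2 * s + 1) with hC
    set κ : ℂ := weilConst p S * ((‖2 * S‖ ^ ((1 : ℝ) / 2) : ℝ) : ℂ) with hκ
    have hwSL : ∀ z, whitSLIntegrand p t (beta p μ s S w φ Φ) z = fun b => C * κ *
        (pairIT (chirp S b Φ) T₀ (wβ p * xr p .b b) * (((max 1 ‖b‖)⁻¹ : ℝ) : ℂ) ^ z * psi p (-(t * b))) :=
      fun z => by
        funext b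
        rw [whitSLIntegrand, beta, regVal_eq (hβ _), pairIT_weilSL hS, heightSL_wβ_xβ, conj_psi]
        ring
    have hwhitSL : IsRegVal p (haar p) (whitSLIntegrand p t (beta p μ s S w φ Φ)) (C * κ * V) := by
      refine isRegVal_iff.mpr ⟨?_, B, fun z hz => ?_⟩
      · simp only [hwSL, integral_const_mul]
        exact (IsRat.const _).mul hV₂
      · rw [hwSL]
        exact (hB z hz).const_mul _
    have hcongr : (fun x => (starRingEnd ℂ) (Φ x) * whitG2 p μ s w (FJ.translate p (vG p x 0 0) φ)) =
        fun x => ((‖quartic p w‖ ^ ((3 : ℝ) / 4) : ℝ) : ℂ) * normG2 p μ s w *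
          ((starRingEnd ℂ) (Φ x) * J₀ x) := by
      funext x
      rw [hwhit]
      ring
    refine ⟨fun h => ⟨_, hβ h⟩, ⟨_, hwhitSL⟩, fun x => ⟨_, hjac x⟩, ?_, ?_⟩
    · rw [hcongr]
      exact (hJint.const_mul _).smul_measure ENNReal.ofReal_ne_top
    · rw [hcongr, integral_selfDual, integral_const_mul, hJV, whitSL, regVal_eq hwhitSL]
      have hsq : (fun a : ℚ_[p]ˣ => ((μ a : ℂ) * chi p S a) ^ 2) = fun a => (μ a : ℂ) ^ 2 := by
        funext a
        rw [mul_pow, chi_sq, mul_one]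
      have hq : 0 < ‖4 / 27 * S ^ 3‖ := norm_pos_iff.mpr (by simp [hS])
      rw [hsq, rpow_normalization hq (norm_pos_iff.mpr ht), hw, norm_quartic, ← hw, hC, hκ]
      -- At a pole the inverse in `Lfac` would be zero; away from poles the factors are non-zero and
      -- cancel.
      have h4 := Lfac_ne_zero hL₄
      have h5 := Lfac_ne_zero hL₅
      have hm := mu_neg_one_mul μ
      generalize Lfac p (fun a => (μ a : ℂ) * chi p S a) (s + 1 / 2) = L at h4 ⊢
      generalize Lfac p (fun a => (μ a : ℂ) ^ 2) (2 * s + 1) = L' at h5 ⊢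
      generalize normG2 p μ s w = n
      have hL : L' / L * (n * L / L') = n := by field_simp
      rw [Complex.ofReal_mul _ ((_ * _ : ℝ) ^ _)]
      generalize ((‖4 / 27 * S ^ 3‖ ^ (-(3 : ℝ) / 4) * ‖t‖ ^ (-(1 : ℝ) / 4) : ℝ) : ℂ) = k
      generalize (((‖4 / 27 * S ^ 3‖ * ‖t‖) ^ ((3 : ℝ) / 4) : ℝ) : ℂ) = q
      generalize ((‖2 * S‖ ^ ((1 : ℝ) / 2) : ℝ) : ℂ) = c
      -- The two L-factors cancel, and the two signs μ(-1), one from the statement and one from the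
      -- Jacquet integral, multiply to one.
      linear_combination k * q * weilConst p S * c * V * hL -
        k * q * weilConst p S * c * V * n * hm
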